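/- Let $c\in\mathbb N$ be a constant. Consider graphs $G=(V,E)$ (directed; an undirected graph is treated as a symmetric directed graph) with $n\ge 1$ vertices, $V=\{0,\dots,n-1\}$, and edge weights $E\to\{0,\dots,n^c\}$. Let $d(s,t)$ be the minimum weight of a directed path from $s$ to $t$, with $d(s,t)=\infty$ if there is none, and let $\overline\Delta=\frac1n\sum_{v}\deg(v)$ be the average (out-)degree of $G$. The model is the word RAM with unit-cost instructions and word size $w$: a program uses a fixed number of registers and a working memory of $w$-bit words; it can copy, add, subtract and compare words and read and write memory, but has no multiplication. The graph is given by read-only adjacency lists (in arbitrary order) with constant-time access to $n$, to the degree of each vertex, and to each list entry and the weight of its edge. The working memory is initially uninitialized, and no word may be read before it is written. All-pairs shortest distance (APSD) enumeration is the task of emitting, for each pair $(s,t)\in V\times V$, the triple $(s,t,d(s,t))$ exactly once, and nothing else, and then halting. The delay of a run is the maximum number of steps up to the first output, between two consecutive outputs, and from the last output to the end of the computation; there is no preprocessing. **Theorem.** APSD enumeration on graphs with edge weights in $\{0,\dots,n^c\}$ can be solved with delay in $O(\overline\Delta+\log n)$ and with space complexity in $\Theta(n)$, on a word RAM with word size in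 $\Omega(\log n)$. Precisely: for each $c$ there are a program and constants $K,C$ such that, for all $n\ge1$, all such graphs $G$, all adjacency-list representations of $G$ and all word sizes $w\ge K\cdot(\lfloor\log_2 n\rfloor+1)$, the program halts, solves APSD enumeration with delay at most $C\,(\overline\Delta+\log n+1)$, uses no words of working memory outside the first $Cn$ ones, and uses at least $n/C$ words. -/

import Mathlib

namespace APSD

/-! ### Weighted graphs, distances, adjacency lists -/

/-- A directed graph on the vertices `0, …, n - 1` with natural-number edge weights (only the values
of `weight` on edges matter). An undirected graph is a symmetric `graph` with symmetric weights. -/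
structure WeightedGraph (n : ℕ) where
  graph : Digraph (Fin n)
  weight : Fin n → Fin n → ℕ

namespace WeightedGraph

variable {n : ℕ}

/-- `G.Path s t ℓ`: there is a directed path from `s` to `t` whose edge weights sum to `ℓ`.
Vertices may repeat, which does not affect the minimum of `ℓ`, as weights are non-negative. -/
inductive Path (G : WeightedGraph n) : Fin n → Fin n → ℕ → Prop
  | nil (s : Fin n) : Path G s s 0
  | cons {s u t : Fin n} {l : ℕ} :
      G.graph.Adj s u → Path G u t l → Path G s t (G.weight s u + l)

/-- The shortest distance; it is `⊤` (the infimum of `∅`) if `t` is not reachable from `s`. -/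
noncomputable def dist (G : WeightedGraph n) (s t : Fin n) : ℕ∞ :=
  ⨅ (l : ℕ) (_ : G.Path s t l), (l : ℕ∞)

/-- The number of outgoing edges of `v`. -/
noncomputable def degree (G : WeightedGraph n) (v : Fin n) : ℕ :=
  {u | G.graph.Adj v u}.ncard

noncomputable def averageDegree (G : WeightedGraph n) : ℝ :=
  (∑ v, (G.degree v : ℝ)) / n

end WeightedGraph

/-- An adjacency-list representation of `G`: the out-neighbours of each vertex, each listed once,
in an arbitrary order. -/
structure AdjLists {n : ℕ} (G : WeightedGraph n) where
  nbrs : Fin n → List (Fin n)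
  nodup : ∀ v, (nbrs v).Nodup
  mem_iff : ∀ v u, u ∈ nbrs v ↔ G.graph.Adj v u

/-! ### The word RAM (without multiplication) -/

/-- Instructions. All operands are registers, apart from the constant `k`. -/
inductive Instr
  /-- `d := k` -/
  | const (d k : ℕ)
  /-- `d := a` -/
  | move (d a : ℕ)
  /-- `d := a + b` (modulo `2 ^ w`) -/
  | add (d a b : ℕ)
  /-- `d := a - b` (modulo `2 ^ w`) -/
  | sub (d a b : ℕ)
  /-- `d := memory[a]` -/
  | load (d a : ℕ)
  /-- `memory[a] := b` -/
  | store (a b : ℕ)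
  /-- `d := ` number of vertices of the input graph -/
  | numVertices (d : ℕ)
  /-- `d := ` degree of vertex `v` of the input graph -/
  | degree (d v : ℕ)
  /-- `d := ` entry number `i` (counted from 0) of the adjacency list of `v` -/
  | neighbor (d v i : ℕ)
  /-- `d := ` weight of the edge at entry number `i` of the adjacency list of `v` -/
  | weight (d v i : ℕ)
  /-- output the triple `(s, t, x)` -/
  | emit (s t x : ℕ)
  /-- output the triple `(s, t, ∞)` -/
  | emitInf (s t : ℕ)

/-- Comparisons of two registers. -/
inductive Cond
  | lt (a b : ℕ)
  | eq (a b : ℕ)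

/-- Programs, with structured control flow. -/
inductive Program
  | instr (i : Instr)
  | seq (P Q : Program)
  | ite (b : Cond) (P Q : Program)
  | while (b : Cond) (P : Program)

/-- Output triples `(s, t, d)`, with `d = ⊤` for an infinite distance. -/
abbrev Output := ℕ × ℕ × ℕ∞

/-- The contents of the registers (a program mentions only finitely many of them) and of the working
memory, where `none` marks a word that has not been written yet. -/
structure State where
  reg : ℕ → ℕ
  mem : ℕ → Option ℕ

namespace State

/-- At the start the registers are 0 and the memory is uninitialized. -/
def init : State := ⟨fun _ => 0, fun _ => none⟩

/-- Write `x`, reduced to a `w`-bit word, to register `d`. -/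
def setReg (w : ℕ) (σ : State) (d x : ℕ) : State :=
  { σ with reg := Function.update σ.reg d (x % 2 ^ w) }

def setMem (σ : State) (a x : ℕ) : State :=
  { σ with mem := Function.update σ.mem a (some x) }

/-- The addresses of all words of working memory that have been used. (A written word remains
written, and reading a word that is not yet written is impossible.) -/
def usedMem (σ : State) : Set ℕ := {a | σ.mem a ≠ none}

end State

/-- The truth value of a comparison. -/
def Cond.Holds (σ : State) : Cond → Prop
  | .lt a b => σ.reg a < σ.reg b
  | .eq a b => σ.reg a = σ.reg b

/-- The effect of one instruction with word size `w` on an input graph given by the adjacency lists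
`A`: the new state and the emitted triple, if any. The result is `none` (the machine is stuck) if a
word of memory is read before it is written or if the input is accessed out of range. -/
def Instr.step {n : ℕ} {G : WeightedGraph n} (w : ℕ) (A : AdjLists G) (σ : State) :
    Instr → Option (State × Option Output)
  | .const d k => some (σ.setReg w d k, none)
  | .move d a => some (σ.setReg w d (σ.reg a), none)
  | .add d a b => some (σ.setReg w d (σ.reg a + σ.reg b), none)
  | .sub d a b => some (σ.setReg w d (σ.reg a + 2 ^ w - σ.reg b), none)
  | .load d a => (σ.mem (σ.reg a)).map fun x => (σ.setReg w d x, none)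
  | .store a b => some (σ.setMem (σ.reg a) (σ.reg b), none)
  | .numVertices d => some (σ.setReg w d n, none)
  | .degree d v =>
      if h : σ.reg v < n then some (σ.setReg w d (A.nbrs ⟨σ.reg v, h⟩).length, none) else none
  | .neighbor d v i =>
      if h : σ.reg v < n then
        ((A.nbrs ⟨σ.reg v, h⟩)[σ.reg i]?).map fun u => (σ.setReg w d u, none)
      else none
  | .weight d v i =>
      if h : σ.reg v < n then
        ((A.nbrs ⟨σ.reg v, h⟩)[σ.reg i]?).map fun u =>
          (σ.setReg w d (G.weight ⟨σ.reg v, h⟩ u), none)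
      else none
  | .emit s t x => some (σ, some (σ.reg s, σ.reg t, (σ.reg x : ℕ∞)))
  | .emitInf s t => some (σ, some (σ.reg s, σ.reg t, ⊤))

/-- `Exec w A P σ tr τ`: started in state `σ`, the program `P` terminates in state `τ`. Its run is
recorded in `tr`, which has one entry for each time step (an instruction or a comparison), namely the
triple that is emitted in this step, if any. -/
inductive Exec {n : ℕ} {G : WeightedGraph n} (w : ℕ) (A : AdjLists G) :
    Program → State → List (Option Output) → State → Prop
  | instr {i : Instr} {σ τ : State} {o : Option Output} :
      i.step w A σ = some (τ, o) → Exec w A (.instr i) σ [o] τ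
  | seq {P Q : Program} {σ ρ τ : State} {tr tr' : List (Option Output)} :
      Exec w A P σ tr ρ → Exec w A Q ρ tr' τ → Exec w A (.seq P Q) σ (tr ++ tr') τ
  | ite_true {b : Cond} {P Q : Program} {σ τ : State} {tr : List (Option Output)} :
      b.Holds σ → Exec w A P σ tr τ → Exec w A (.ite b P Q) σ (none :: tr) τ
  | ite_false {b : Cond} {P Q : Program} {σ τ : State} {tr : List (Option Output)} :
      ¬ b.Holds σ → Exec w A Q σ tr τ → Exec w A (.ite b P Q) σ (none :: tr) τ
  | while_true {b : Cond} {P : Program} {σ ρ τ : State} {tr tr' : List (Option Output)} :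
      b.Holds σ → Exec w A P σ tr ρ → Exec w A (.while b P) ρ tr' τ →
      Exec w A (.while b P) σ (none :: (tr ++ tr')) τ
  | while_false {b : Cond} {P : Program} {σ : State} :
      ¬ b.Holds σ → Exec w A (.while b P) σ [none] σ

/-! ### Enumeration and delay -/

/-- The emitted triples, in order. -/
def outputs (tr : List (Option Output)) : List Output := tr.filterMap id

/-- For each `s` and `t`, the triple `(s, t, d(s, t))` is emitted exactly once, and nothing else. -/
def EnumeratesAPSD {n : ℕ} (G : WeightedGraph n) (tr : List (Option Output)) : Prop :=
  (outputs tr).Nodup ∧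
    ∀ o : Output, o ∈ outputs tr ↔ ∃ s t : Fin n, o = ((s : ℕ), (t : ℕ), G.dist s t)

/-- The numbers of steps up to and including the first output, from each output to the next one, and
from the last output to the end of the run, where `k` steps since the last output (or the start) have
already been counted. -/
def delaysFrom : ℕ → List (Option Output) → List ℕ
  | k, [] => [k]
  | k, none :: tr => delaysFrom (k + 1) tr
  | k, some _ :: tr => (k + 1) :: delaysFrom 0 tr

/-- The run has delay at most `D`, without preprocessing. -/
def HasDelay (tr : List (Option Output)) (D : ℝ) : Prop :=
  ∀ k ∈ delaysFrom 0 tr, (k : ℝ) ≤ D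

end APSD

set_option linter.constructorNameAsVariable false

/-! A row of the distance matrix has `n` entries. With `m` edges in total, delay `O(m / n + log n)`
allows time `O(m + n log n)` per row, which is what one run of Dijkstra's algorithm costs. So the
run for a source is executed while the row of the preceding source is being emitted, one output per
period of `Θ(m / n + log n)` steps of the run. Two regions of `O(n)` words alternate: one holds the
finished row, the other serves the current run. As preprocessing is not allowed, something must be
emitted before the first row is known. These are the diagonal entries `(t, t, 0)`, which are left
out of the rows. At most half of them are spent while the parameters of the algorithm are computed,
and the others cover the first run.

Dijkstra's algorithm uses a one-level radix heap with `K = O(log n)` levels. Level 0 contains the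
settled vertices. Level `j` with `2 ≤ j < K` has a key range of width at most `2 ^ (j - 2)`, level 1
has width at most one, and level `K` is for infinite keys. All vertices lie in one array sorted by
level, so that moving a vertex down by one level is a swap (`Buckets.descend`). If level 1 is empty,
the first nonempty level is split at its minimum key. Its width is small enough that all its
vertices go down (`Split.eq_level`), and the minimum arrives on level 1 (`Split.bk_eq_one`).
Vertices never move up, so the sum of all levels, initially at most `n * K`, is a potential that
pays for the moves. In addition, a settled vertex costs `O(K)` for scanning and for new bounds, and
an edge costs `O(1)`. This gives `computes_dijkstra`.

The algorithm is verified as a silent program on named variables and arrays (`Sim`, `Computes`),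
started in an empty memory. As a program cannot read a word before writing it, it runs in the same
way in a memory that contains other data. Hence a `tick`, which emits an output when one is due, can
be inserted after each of its steps (`Exec.interleave`). The number of ticks that the pending
outputs suffice for is tracked by `Feed.fuel`, and the time since the last output by `Paced`. The
lemma `enough_time` shows that the outputs outlast the run. Outputs that are left over are flushed
before the roles of the regions are exchanged (`exec_processSource`). -/

namespace APSD

/-! ### From machine programs to silent programs on named variables and arrays. -/

variable {n : ℕ} {G : WeightedGraph n}

/-! ### Silent runs -/

/-- The program `P`, started in `σ`, terminates without emitting anything, and the number of steps
and the final state satisfy `Q`. -/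
def Runs (w : ℕ) (A : AdjLists G) (P : Program) (σ : State) (Q : ℕ → State → Prop) : Prop :=
  ∃ k τ, Exec w A P σ (List.replicate k none) τ ∧ Q k τ

namespace Runs

variable {w : ℕ} {A : AdjLists G} {P P' : Program} {b : Cond} {σ : State} {Q Q' : ℕ → State → Prop}

theorem mono (h : Runs w A P σ Q) (hQ : ∀ k τ, Q k τ → Q' k τ) : Runs w A P σ Q' :=
  let ⟨k, τ, h₁, h₂⟩ := h
  ⟨k, τ, h₁, hQ k τ h₂⟩

theorem instr {i : Instr} {τ : State} (h : i.step w A σ = some (τ, none)) (hQ : Q 1 τ) :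
    Runs w A (.instr i) σ Q :=
  ⟨1, τ, .instr h, hQ⟩

theorem seq (h : Runs w A P σ fun k ρ => Runs w A P' ρ fun j => Q (k + j)) :
    Runs w A (.seq P P') σ Q := by
  obtain ⟨k, ρ, h₁, j, τ, h₂, hQ⟩ := h
  refine ⟨k + j, τ, ?_, hQ⟩
  rw [List.replicate_add]
  exact .seq h₁ h₂

theorem ite (h₁ : b.Holds σ → Runs w A P σ fun k => Q (k + 1))
    (h₂ : ¬ b.Holds σ → Runs w A P' σ fun k => Q (k + 1)) :
    Runs w A (.ite b P P') σ Q := by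
  by_cases hb : b.Holds σ
  · obtain ⟨k, τ, h, hQ⟩ := h₁ hb
    exact ⟨k + 1, τ, .ite_true hb h, hQ⟩
  · obtain ⟨k, τ, h, hQ⟩ := h₂ hb
    exact ⟨k + 1, τ, .ite_false hb h, hQ⟩

/-- A loop whose body decreases a potential by more than its number of steps. -/
theorem loop (I : State → Prop) (Φ : State → ℕ) (h : I σ)
    (body : ∀ σ, I σ → b.Holds σ →
      Runs w A P σ fun k τ => I τ ∧ k + 1 + Φ τ ≤ Φ σ) :
    Runs w A (.while b P) σ fun k τ => I τ ∧ ¬ b.Holds τ ∧ k + Φ τ ≤ Φ σ + 1 := by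
  induction hm : Φ σ using Nat.strong_induction_on generalizing σ with
  | _ m ih =>
    by_cases hb : b.Holds σ
    · obtain ⟨k, ρ, h₁, hI, hk⟩ := body σ h hb
      obtain ⟨j, τ, h₂, hI', hb', hj⟩ := ih (Φ ρ) (by omega) hI rfl
      refine ⟨k + j + 1, τ, ?_, hI', hb', by omega⟩
      rw [List.replicate_succ, List.replicate_add]
      exact .while_true hb h₁ h₂
    · exact ⟨1, σ, .while_false hb, h, hb, by omega⟩

theorem seq_move {d a v : ℕ} (h : σ.reg a = v) (hv : v < 2 ^ w)
    (hQ : Runs w A P ⟨Function.update σ.reg d v, σ.mem⟩ fun j => Q (1 + j)) :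
    Runs w A (.seq (.instr (.move d a)) P) σ Q := by
  refine .seq (.instr rfl ?_)
  rwa [h, State.setReg, Nat.mod_eq_of_lt hv]

theorem seq_const {d v : ℕ} (hv : v < 2 ^ w)
    (hQ : Runs w A P ⟨Function.update σ.reg d v, σ.mem⟩ fun j => Q (1 + j)) :
    Runs w A (.seq (.instr (.const d v)) P) σ Q := by
  refine .seq (.instr rfl ?_)
  rwa [State.setReg, Nat.mod_eq_of_lt hv]

theorem seq_add {d a b v : ℕ} (h : σ.reg a + σ.reg b = v) (hv : v < 2 ^ w)
    (hQ : Runs w A P ⟨Function.update σ.reg d v, σ.mem⟩ fun j => Q (1 + j)) :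
    Runs w A (.seq (.instr (.add d a b)) P) σ Q := by
  refine .seq (.instr rfl ?_)
  rwa [h, State.setReg, Nat.mod_eq_of_lt hv]

theorem seq_sub {d a b v : ℕ} (h : σ.reg a = σ.reg b + v) (hv : v < 2 ^ w)
    (hQ : Runs w A P ⟨Function.update σ.reg d v, σ.mem⟩ fun j => Q (1 + j)) :
    Runs w A (.seq (.instr (.sub d a b)) P) σ Q := by
  refine .seq (.instr rfl ?_)
  rwa [h, show σ.reg b + v + 2 ^ w - σ.reg b = v + 2 ^ w by omega, State.setReg,
    Nat.add_mod_right, Nat.mod_eq_of_lt hv]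

end Runs

/-! ### Abstract stores -/

/-- Variables of an abstract program. -/
inductive Var
  | i | j | v | u | x | y | p | e | mu | k | g | a | b | q | dv
deriving DecidableEq

/-- Read-only parameters of an abstract program. -/
inductive Param
  | one | src | size | top | inf | base | stride

/-- Arrays of an abstract program. -/
inductive Arr
  | dist | pos | ord | bk | st | bd
deriving DecidableEq

inductive Opnd
  | var (x : Var)
  | par (p : Param)

instance : Coe Var Opnd := ⟨.var⟩
instance : Coe Param Opnd := ⟨.par⟩

/-- The values of the parameters, apart from the number of vertices. -/
structure Env where
  src : ℕ
  top : ℕ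
  inf : ℕ
  base : ℕ
  stride : ℕ

@[simp] def Env.par (E : Env) (n : ℕ) : Param → ℕ
  | .one => 1
  | .src => E.src
  | .size => n
  | .top => E.top
  | .inf => E.inf
  | .base => E.base
  | .stride => E.stride

def tmpReg : ℕ := 16

def Param.reg : Param → ℕ
  | .one => 17
  | .src => 18
  | .size => 19
  | .top => 20
  | .inf => 21
  | .base => 22
  | .stride => 23

def Arr.idx : Arr → ℕ
  | .dist => 0
  | .pos => 1
  | .ord => 2
  | .bk => 3
  | .st => 4
  | .bd => 5

def Arr.reg (k : Arr) : ℕ := 24 + k.idx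

def Var.reg : Var → ℕ
  | .i => 30
  | .j => 31
  | .v => 32
  | .u => 33
  | .x => 34
  | .y => 35
  | .p => 36
  | .e => 37
  | .mu => 38
  | .k => 39
  | .g => 40
  | .a => 41
  | .b => 42
  | .q => 43
  | .dv => 44

def Opnd.reg : Opnd → ℕ
  | .var x => x.reg
  | .par p => p.reg

theorem Var.reg_injective : Function.Injective Var.reg := by
  intro a b h
  cases a <;> cases b <;> first | rfl | cases h

theorem Var.le_reg (x : Var) : 30 ≤ x.reg := by cases x <;> decide

theorem Param.reg_le (p : Param) : 17 ≤ p.reg ∧ p.reg ≤ 23 := by cases p <;> decide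

theorem Arr.idx_injective : Function.Injective Arr.idx := by
  intro a b h
  cases a <;> cases b <;> first | rfl | cases h

theorem Arr.idx_le (k : Arr) : k.idx ≤ 5 := by cases k <;> decide

theorem Arr.reg_le (k : Arr) : 24 ≤ k.reg ∧ k.reg ≤ 29 := by cases k <;> decide

/-- The address of entry `i` of an array. -/
def Env.addr (E : Env) (k : Arr) (i : ℕ) : ℕ := E.base + k.idx * E.stride + i

/-- The arrays occupy consecutive blocks of length `stride`, so indices below `stride` in different
blocks cannot collide. -/
theorem Env.addr_inj {E : Env} {k k' : Arr} {i i' : ℕ} (hi : i < E.stride) (hi' : i' < E.stride) :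
    E.addr k i = E.addr k' i' ↔ k = k' ∧ i = i' := by
  refine ⟨fun h => ?_, by rintro ⟨rfl, rfl⟩; rfl⟩
  unfold Env.addr at h
  have hk : k.idx = k'.idx := by
    rcases lt_trichotomy k.idx k'.idx with hlt | heq | hlt
    · have := Nat.mul_le_mul_right E.stride hlt
      rw [Nat.succ_mul] at this
      omega
    · exact heq
    · have := Nat.mul_le_mul_right E.stride hlt
      rw [Nat.succ_mul] at this
      omega
  rw [hk] at h
  exact ⟨Arr.idx_injective hk, by omega⟩

theorem Env.addr_lt {E : Env} {k : Arr} {i : ℕ} (hi : i < E.stride) :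
    E.addr k i < E.base + 6 * E.stride := by
  have := Nat.mul_le_mul_right E.stride k.idx_le
  unfold Env.addr
  omega

/-- An abstract memory: variables and arrays. -/
structure Store where
  var : Var → ℕ
  arr : Arr → ℕ → ℕ

namespace Store

def setVar (s : Store) (d : Var) (x : ℕ) : Store := { s with var := Function.update s.var d x }

def setArr (s : Store) (k : Arr) (i x : ℕ) : Store :=
  { s with arr := Function.update s.arr k (Function.update (s.arr k) i x) }

/-- The value of an operand. -/
def val (E : Env) (n : ℕ) (s : Store) : Opnd → ℕ
  | .var x => s.var x
  | .par p => E.par n p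

@[simp] theorem val_var (E : Env) (s : Store) (x : Var) : s.val E n (.var x) = s.var x := rfl
@[simp] theorem val_par (E : Env) (s : Store) (p : Param) : s.val E n (.par p) = E.par n p := rfl
@[simp] theorem setVar_arr (s : Store) (d : Var) (x : ℕ) : (s.setVar d x).arr = s.arr := rfl
@[simp] theorem setArr_var (s : Store) (k : Arr) (i x : ℕ) : (s.setArr k i x).var = s.var := rfl
@[simp] theorem setVar_var (s : Store) (d : Var) (x : ℕ) (z : Var) :
    (s.setVar d x).var z = if z = d then x else s.var z := by
  simp [setVar, Function.update_apply]
@[simp] theorem setArr_arr (s : Store) (k : Arr) (i x : ℕ) (l : Arr) :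
    (s.setArr k i x).arr l = if l = k then Function.update (s.arr k) i x else s.arr l := by
  unfold setArr
  by_cases h : l = k
  · subst h; simp
  · simp [h]

end Store

namespace AdjLists

/-- The degree of a vertex, as a total function. -/
def deg (A : AdjLists G) (v : ℕ) : ℕ := if h : v < n then (A.nbrs ⟨v, h⟩).length else 0

/-- Entry `i` of the adjacency list of `v`, as a total function. -/
def nbr (A : AdjLists G) (v i : ℕ) : ℕ :=
  if h : v < n then (((A.nbrs ⟨v, h⟩)[i]?).map Fin.val).getD 0 else 0

/-- The weight of the edge at entry `i` of the adjacency list of `v`, as a total function. -/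
def wt (A : AdjLists G) (v i : ℕ) : ℕ :=
  if h : v < n then (((A.nbrs ⟨v, h⟩)[i]?).map (G.weight ⟨v, h⟩)).getD 0 else 0

end AdjLists

/-! ### Straight-line abstract programs -/

/-- Instructions on abstract stores. -/
inductive Op
  | const (d : Var) (k : ℕ)
  | move (d : Var) (a : Opnd)
  | add (d : Var) (a b : Opnd)
  | sub (d : Var) (a b : Opnd)
  | get (d : Var) (k : Arr) (i : Opnd)
  | put (k : Arr) (i b : Opnd)
  | degree (d : Var) (v : Opnd)
  | neighbor (d : Var) (v i : Opnd)
  | weight (d : Var) (v i : Opnd)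

namespace Op

def compile : Op → Program
  | .const d k => .instr (.const d.reg k)
  | .move d a => .instr (.move d.reg a.reg)
  | .add d a b => .instr (.add d.reg a.reg b.reg)
  | .sub d a b => .instr (.sub d.reg a.reg b.reg)
  | .get d k i => .seq (.instr (.add tmpReg k.reg i.reg)) (.instr (.load d.reg tmpReg))
  | .put k i b => .seq (.instr (.add tmpReg k.reg i.reg)) (.instr (.store tmpReg b.reg))
  | .degree d v => .instr (.degree d.reg v.reg)
  | .neighbor d v i => .instr (.neighbor d.reg v.reg i.reg)
  | .weight d v i => .instr (.weight d.reg v.reg i.reg)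

/-- The number of steps. -/
@[simp] def cost : Op → ℕ
  | .get .. => 2
  | .put .. => 2
  | _ => 1

/-- The instruction is executed without overflow and without access out of range. -/
@[simp] def Ok (w : ℕ) (A : AdjLists G) (E : Env) (s : Store) : Op → Prop
  | .const _ k => k < 2 ^ w
  | .move _ _ => True
  | .add _ a b => s.val E n a + s.val E n b < 2 ^ w
  | .sub _ a b => s.val E n b ≤ s.val E n a
  | .get _ _ i => s.val E n i < E.stride
  | .put _ i _ => s.val E n i < E.stride
  | .degree _ v => s.val E n v < n
  | .neighbor _ v i => s.val E n v < n ∧ s.val E n i < A.deg (s.val E n v)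
  | .weight _ v i => s.val E n v < n ∧ s.val E n i < A.deg (s.val E n v) ∧
      A.wt (s.val E n v) (s.val E n i) < 2 ^ w

@[simp] def next (A : AdjLists G) (E : Env) (s : Store) : Op → Store
  | .const d k => s.setVar d k
  | .move d a => s.setVar d (s.val E n a)
  | .add d a b => s.setVar d (s.val E n a + s.val E n b)
  | .sub d a b => s.setVar d (s.val E n a - s.val E n b)
  | .get d k i => s.setVar d (s.arr k (s.val E n i))
  | .put k i b => s.setArr k (s.val E n i) (s.val E n b)
  | .degree d v => s.setVar d (A.deg (s.val E n v))
  | .neighbor d v i => s.setVar d (A.nbr (s.val E n v) (s.val E n i))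
  | .weight d v i => s.setVar d (A.wt (s.val E n v) (s.val E n i))

end Op

/-- Comparisons of operands. -/
inductive Test
  | lt (a b : Opnd)
  | eq (a b : Opnd)

namespace Test

def compile : Test → Cond
  | .lt a b => .lt a.reg b.reg
  | .eq a b => .eq a.reg b.reg

@[simp] def Holds (E : Env) (n : ℕ) (s : Store) : Test → Prop
  | .lt a b => s.val E n a < s.val E n b
  | .eq a b => s.val E n a = s.val E n b

end Test

/-- The program that does nothing. -/
def nop : Program := .instr (.move tmpReg tmpReg)

def block : List Op → Program
  | [] => nop
  | o :: l => .seq o.compile (block l)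

@[simp] def blockOk (w : ℕ) (A : AdjLists G) (E : Env) : Store → List Op → Prop
  | _, [] => True
  | s, o :: l => o.Ok w A E s ∧ blockOk w A E (o.next A E s) l

@[simp] def blockNext (A : AdjLists G) (E : Env) : Store → List Op → Store
  | s, [] => s
  | s, o :: l => blockNext A E (o.next A E s) l

@[simp] def blockCost : List Op → ℕ
  | [] => 1
  | o :: l => o.cost + blockCost l

/-! ### Representation of abstract stores -/

/-- The machine state `σ` represents the abstract store `s`. -/
structure Sim (w : ℕ) (E : Env) (n : ℕ) (σ : State) (s : Store) : Prop where
  par : ∀ p : Param, σ.reg p.reg = E.par n p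
  par_lt : ∀ p : Param, E.par n p < 2 ^ w
  var : ∀ x : Var, σ.reg x.reg = s.var x
  var_lt : ∀ x : Var, s.var x < 2 ^ w
  ptr : ∀ k : Arr, σ.reg k.reg = E.addr k 0
  arr : ∀ k i, i < E.stride → σ.mem (E.addr k i) = some (s.arr k i)
  arr_lt : ∀ k i, i < E.stride → s.arr k i < 2 ^ w
  unused : ∀ a, (∀ k i, i < E.stride → a ≠ E.addr k i) → σ.mem a = none

namespace Sim

variable {w : ℕ} {E : Env} {σ : State} {s : Store}

theorem val (h : Sim w E n σ s) (a : Opnd) : σ.reg a.reg = s.val E n a := by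
  cases a with
  | var x => exact h.var x
  | par p => exact h.par p

theorem val_lt (h : Sim w E n σ s) (a : Opnd) : s.val E n a < 2 ^ w := by
  cases a with
  | var x => exact h.var_lt x
  | par p => exact h.par_lt p

theorem holds (h : Sim w E n σ s) (t : Test) : t.compile.Holds σ ↔ t.Holds E n s := by
  cases t <;> simp [Test.compile, Cond.Holds, h.val]

theorem setReg_var (h : Sim w E n σ s) (d : Var) {x : ℕ} (hx : x < 2 ^ w) :
    Sim w E n (σ.setReg w d.reg x) (s.setVar d x) where
  par p := by
    have := p.reg_le
    have := d.le_reg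
    simp only [State.setReg]
    rw [Function.update_of_ne (by omega), h.par]
  par_lt := h.par_lt
  var y := by
    simp only [State.setReg, Store.setVar]
    by_cases hy : y = d
    · subst hy
      simp [Nat.mod_eq_of_lt hx]
    · rw [Function.update_of_ne (fun e => hy (Var.reg_injective e)), Function.update_of_ne hy, h.var]
  var_lt y := by
    rw [Store.setVar_var]
    split
    · exact hx
    · exact h.var_lt y
  ptr k := by
    have := k.reg_le
    have := d.le_reg
    simp only [State.setReg]
    rw [Function.update_of_ne (by omega), h.ptr]
  arr := h.arr
  arr_lt := h.arr_lt
  unused := h.unused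

theorem setReg_tmp (h : Sim w E n σ s) (x : ℕ) : Sim w E n (σ.setReg w tmpReg x) s where
  par p := by
    have := p.reg_le
    simp only [State.setReg, tmpReg]
    rw [Function.update_of_ne (by omega), h.par]
  par_lt := h.par_lt
  var y := by
    have := y.le_reg
    simp only [State.setReg, tmpReg]
    rw [Function.update_of_ne (by omega), h.var]
  var_lt := h.var_lt
  ptr k := by
    have := k.reg_le
    simp only [State.setReg, tmpReg]
    rw [Function.update_of_ne (by omega), h.ptr]
  arr := h.arr
  arr_lt := h.arr_lt
  unused := h.unused

theorem setMem (h : Sim w E n σ s) (k : Arr) {i x : ℕ} (hi : i < E.stride) (hx : x < 2 ^ w) :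
    Sim w E n (σ.setMem (E.addr k i) x) (s.setArr k i x) where
  par := h.par
  par_lt := h.par_lt
  var := h.var
  var_lt := h.var_lt
  ptr := h.ptr
  arr l j hj := by
    simp only [State.setMem, Function.update_apply, Env.addr_inj hj hi, Store.setArr_arr]
    by_cases hl : l = k
    · subst hl
      by_cases hji : j = i
      · simp [hji]
      · simp [hji, h.arr _ _ hj]
    · simp [hl, h.arr _ _ hj]
  arr_lt l j hj := by
    rw [Store.setArr_arr]
    split
    · rw [Function.update_apply]
      split
      · exact hx
      · exact h.arr_lt _ _ hj
    · exact h.arr_lt _ _ hj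
  unused a ha := by
    simp only [State.setMem]
    rw [Function.update_of_ne (ha k i hi), h.unused a ha]

end Sim

/-- The constraints that a machine of word size `w` can handle the environment. -/
structure Env.Fits (E : Env) (n w : ℕ) : Prop where
  mem : E.base + 6 * E.stride ≤ 2 ^ w
  size : n < 2 ^ w

/-! ### Reasoning about abstract programs -/

/-- Started in any state representing `s`, the program `P` terminates silently, in a state that
represents some store that satisfies `Q` together with the number of steps. -/
def Computes (w : ℕ) (A : AdjLists G) (E : Env) (P : Program) (s : Store)
    (Q : ℕ → Store → Prop) : Prop :=
  ∀ σ, Sim w E n σ s → Runs w A P σ fun k τ => ∃ s', Sim w E n τ s' ∧ Q k s'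

namespace Computes

variable {w : ℕ} {A : AdjLists G} {E : Env} {P P' : Program} {t : Test} {s : Store}
  {Q Q' : ℕ → Store → Prop}

theorem mono (h : Computes w A E P s Q) (hQ : ∀ k s', Q k s' → Q' k s') :
    Computes w A E P s Q' :=
  fun σ hσ => (h σ hσ).mono fun k _ ⟨s', h₁, h₂⟩ => ⟨s', h₁, hQ k s' h₂⟩

theorem seq (h : Computes w A E P s fun k s' => Computes w A E P' s' fun j => Q (k + j)) :
    Computes w A E (.seq P P') s Q :=
  fun σ hσ => .seq ((h σ hσ).mono fun _ ρ ⟨_, h₁, h₂⟩ => h₂ ρ h₁)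

theorem ite (h₁ : t.Holds E n s → Computes w A E P s fun k => Q (k + 1))
    (h₂ : ¬ t.Holds E n s → Computes w A E P' s fun k => Q (k + 1)) :
    Computes w A E (.ite t.compile P P') s Q :=
  fun σ hσ => .ite (fun hb => h₁ ((hσ.holds t).1 hb) σ hσ)
    (fun hb => h₂ (fun ht => hb ((hσ.holds t).2 ht)) σ hσ)

/-- The potential pays for steps rather than rounds, so it can be amortized over nested loops. The
`+ 1` in the body is the successful test, and the one in the conclusion is the failing test. -/
theorem loop (I : Store → Prop) (Φ : Store → ℕ) (h : I s)
    (body : ∀ s, I s → t.Holds E n s →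
      Computes w A E P s fun k s' => I s' ∧ k + 1 + Φ s' ≤ Φ s) :
    Computes w A E (.while t.compile P) s fun k s' =>
      I s' ∧ ¬ t.Holds E n s' ∧ k + Φ s' ≤ Φ s + 1 := by
  intro σ hσ
  induction hm : Φ s using Nat.strong_induction_on generalizing σ s with
  | _ m ih =>
    by_cases hb : t.Holds E n s
    · obtain ⟨k, ρ, h₁, s₁, hs₁, hI, hk⟩ := body s h hb σ hσ
      obtain ⟨j, τ, h₂, s₂, hs₂, hI', hb', hj⟩ := ih (Φ s₁) (by omega) hI ρ hs₁ rfl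
      refine ⟨k + j + 1, τ, ?_, s₂, hs₂, hI', hb', by omega⟩
      rw [List.replicate_succ, List.replicate_add]
      exact .while_true ((hσ.holds t).2 hb) h₁ h₂
    · exact ⟨1, σ, .while_false (fun hb' => hb ((hσ.holds t).1 hb')), s, hσ, h, hb, by omega⟩

/-- All blocks lie below `2 ^ w`, so the address computed in the scratch register does not wrap
around. Degrees and vertices fit into words because `n < 2 ^ w`. -/
theorem op (hE : E.Fits n w) {o : Op} (h : o.Ok w A E s) (hQ : Q o.cost (o.next A E s)) :
    Computes w A E o.compile s Q := by
  intro σ hσ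
  have hadd : ∀ (k : Arr) (i : Opnd), s.val E n i < E.stride →
      (σ.reg k.reg + σ.reg i.reg) % 2 ^ w = E.addr k (s.val E n i) := by
    intro k i hi
    have h₁ := Env.addr_lt (k := k) hi
    have h₂ := hE.mem
    rw [hσ.ptr, hσ.val]
    exact Nat.mod_eq_of_lt (by unfold Env.addr at *; omega)
  cases o with
  | const d k => exact .instr rfl ⟨_, hσ.setReg_var d h, hQ⟩
  | move d a =>
    refine .instr rfl ⟨_, ?_, hQ⟩
    rw [hσ.val]
    exact hσ.setReg_var d (hσ.val_lt a)
  | add d a b =>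
    refine .instr rfl ⟨_, ?_, hQ⟩
    rw [hσ.val, hσ.val]
    exact hσ.setReg_var d h
  | sub d a b =>
    refine .instr rfl ⟨_, ?_, hQ⟩
    have h₁ : s.val E n b ≤ s.val E n a := h
    have h₂ := hσ.val_lt a
    have h₃ : σ.setReg w d.reg (σ.reg a.reg + 2 ^ w - σ.reg b.reg) =
        σ.setReg w d.reg (s.val E n a - s.val E n b) := by
      rw [hσ.val, hσ.val]
      unfold State.setReg
      rw [show s.val E n a + 2 ^ w - s.val E n b = (s.val E n a - s.val E n b) + 2 ^ w by omega,
        Nat.add_mod_right]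
    rw [h₃]
    exact hσ.setReg_var d (by omega)
  | get d k i =>
    have hi : s.val E n i < E.stride := h
    refine .seq (.instr rfl ?_)
    have hσ' := hσ.setReg_tmp (σ.reg k.reg + σ.reg i.reg)
    refine .instr (τ := (σ.setReg w tmpReg (σ.reg k.reg + σ.reg i.reg)).setReg w d.reg
      (s.arr k (s.val E n i))) ?_ ⟨_, hσ'.setReg_var d (hσ.arr_lt k _ hi), hQ⟩
    have : (σ.setReg w tmpReg (σ.reg k.reg + σ.reg i.reg)).reg tmpReg =
        E.addr k (s.val E n i) := by
      simp [State.setReg, hadd k i hi]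
    simp only [Instr.step]
    rw [this, hσ'.arr k _ hi]
    rfl
  | put k i b =>
    have hi : s.val E n i < E.stride := h
    refine .seq (.instr rfl ?_)
    have hσ' := hσ.setReg_tmp (σ.reg k.reg + σ.reg i.reg)
    refine .instr rfl ⟨_, ?_, hQ⟩
    have : (σ.setReg w tmpReg (σ.reg k.reg + σ.reg i.reg)).reg tmpReg =
        E.addr k (s.val E n i) := by
      simp [State.setReg, hadd k i hi]
    rw [this, hσ'.val]
    exact hσ'.setMem k hi (hσ.val_lt b)
  | degree d v =>
    have hv : s.val E n v < n := h
    refine .instr (τ := σ.setReg w d.reg (A.deg (s.val E n v))) ?_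
      ⟨_, hσ.setReg_var d ?_, hQ⟩
    · simp [Instr.step, hσ.val, hv, AdjLists.deg]
    · simp only [AdjLists.deg, hv, dite_true]
      exact lt_of_le_of_lt (by simpa using (A.nodup ⟨_, hv⟩).length_le_card) hE.size
  | neighbor d v i =>
    obtain ⟨hv, hi⟩ : s.val E n v < n ∧ s.val E n i < A.deg (s.val E n v) := h
    have hi' := hi
    simp only [AdjLists.deg, hv, dite_true] at hi'
    refine .instr (τ := σ.setReg w d.reg (A.nbr (s.val E n v) (s.val E n i))) ?_
      ⟨_, hσ.setReg_var d ?_, hQ⟩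
    · simp [Instr.step, hσ.val, hv, AdjLists.nbr, hi']
    · simp only [AdjLists.nbr, hv, dite_true, List.getElem?_eq_getElem hi', Option.map_some,
        Option.getD_some]
      exact lt_trans (Fin.is_lt _) hE.size
  | weight d v i =>
    obtain ⟨hv, hi, hw⟩ : s.val E n v < n ∧ s.val E n i < A.deg (s.val E n v) ∧
      A.wt (s.val E n v) (s.val E n i) < 2 ^ w := h
    have hi' := hi
    simp only [AdjLists.deg, hv, dite_true] at hi'
    refine .instr (τ := σ.setReg w d.reg (A.wt (s.val E n v) (s.val E n i))) ?_
      ⟨_, hσ.setReg_var d hw, hQ⟩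
    simp [Instr.step, hσ.val, hv, AdjLists.wt, hi']

theorem block (hE : E.Fits n w) {l : List Op} (h : blockOk w A E s l)
    (hQ : Q (blockCost l) (blockNext A E s l)) : Computes w A E (APSD.block l) s Q := by
  induction l generalizing s Q with
  | nil => exact fun σ hσ => .instr rfl ⟨_, hσ.setReg_tmp _, hQ⟩
  | cons o l ih => exact .seq (op hE h.1 (ih h.2 hQ))

end Computes

end APSD

/-! ### Mathematics of the radix heap and of tentative distances, without machines. -/

namespace APSD

variable {n : ℕ} {G : WeightedGraph n}

/-! ### An array of vertices that is partitioned into levels -/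

/-- The vertices `0, …, n - 1` are arranged in the array `ord`, with inverse `pos`, by their levels
`bk v ∈ {0, …, K}`: level `j` occupies the positions from `st j` up to `st (j + 1)`. The sentinel
`st (K + 1) = n + 1` makes level `K` look nonempty. -/
structure Buckets (n K : ℕ) (ord pos bk st : ℕ → ℕ) : Prop where
  pos_lt : ∀ v < n, pos v < n
  ord_lt : ∀ p < n, ord p < n
  ord_pos : ∀ v < n, ord (pos v) = v
  pos_ord : ∀ p < n, pos (ord p) = p
  bk_le : ∀ v < n, bk v ≤ K
  st_le : ∀ v < n, st (bk v) ≤ pos v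
  lt_st : ∀ v < n, pos v < st (bk v + 1)
  mono : ∀ j ≤ K, st j ≤ st (j + 1)
  st_zero : st 0 = 0
  st_le_size : st K ≤ n
  st_top : st (K + 1) = n + 1

/-- The sum of the levels of all vertices. -/
def levelSum (n : ℕ) (bk : ℕ → ℕ) : ℕ := ∑ v ∈ Finset.range n, bk v

theorem levelSum_update {bk : ℕ → ℕ} {u : ℕ} (hu : u < n) (h : 1 ≤ bk u) :
    levelSum n (Function.update bk u (bk u - 1)) + 1 = levelSum n bk := by
  unfold levelSum
  have hu' : u ∈ Finset.range n := Finset.mem_range.2 hu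
  rw [← Finset.add_sum_erase _ bk hu', ← Finset.add_sum_erase _ _ hu', Function.update_self,
    Finset.sum_congr rfl fun v hv => Function.update_of_ne (Finset.ne_of_mem_erase hv) _ _]
  omega

namespace Buckets

variable {K : ℕ} {ord pos bk st : ℕ → ℕ}

theorem st_mono (h : Buckets n K ord pos bk st) {i j : ℕ} (hij : i ≤ j) (hj : j ≤ K + 1) :
    st i ≤ st j := by
  induction j, hij using Nat.le_induction with
  | base => exact le_rfl
  | succ j hij ih => exact (ih (by omega)).trans (h.mono j (by omega))

/-- The levels are disjoint intervals of positions, so a position determines the level. -/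
theorem bk_eq (h : Buckets n K ord pos bk st) {v j : ℕ} (hv : v < n) (hj : j ≤ K)
    (h₁ : st j ≤ pos v) (h₂ : pos v < st (j + 1)) : bk v = j := by
  have := h.bk_le v hv
  have := h.st_le v hv
  have := h.lt_st v hv
  rcases lt_trichotomy (bk v) j with hlt | heq | hlt
  · have := h.st_mono (i := bk v + 1) (j := j) hlt (by omega)
    omega
  · exact heq
  · have := h.st_mono (i := j + 1) (j := bk v) hlt (by omega)
    omega

/-- The vertex `u` is moved down to the next level by swapping it with the first vertex of its
level. -/
theorem descend (h : Buckets n K ord pos bk st) {u : ℕ} (hu : u < n) (hb : 1 ≤ bk u) :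
    Buckets n K
      (Function.update (Function.update ord (pos u) (ord (st (bk u)))) (st (bk u)) u)
      (Function.update (Function.update pos (ord (st (bk u))) (pos u)) u (st (bk u)))
      (Function.update bk u (bk u - 1))
      (Function.update st (bk u) (st (bk u) + 1)) := by
  have hp := h.pos_lt u hu
  have h₁ := h.st_le u hu
  have h₂ := h.lt_st u hu
  have hK := h.bk_le u hu
  have hop := h.ord_pos u hu
  set a := st (bk u) with ha
  have hx := h.ord_lt a (by omega)
  have hpx := h.pos_ord a (by omega)
  have hbx : bk (ord a) = bk u := h.bk_eq hx hK (by omega) (by omega)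
  have hinj : ∀ v < n, ∀ v' < n, pos v = pos v' → v = v' := fun v hv v' hv' e => by
    rw [← h.ord_pos v hv, ← h.ord_pos v' hv', e]
  have hinj' : ∀ p < n, ∀ p' < n, ord p = ord p' → p = p' := fun v hv v' hv' e => by
    rw [← h.pos_ord v hv, ← h.pos_ord v' hv', e]
  -- After the swap only `u` is at position `a`. The other vertices of its old level therefore lie
  -- strictly above `a`, as the raised start of that level requires.
  have hposu : ∀ v < n, v ≠ u → Function.update pos (ord a) (pos u) v ≠ a := by
    intro v hv hvu
    rw [Function.update_apply]
    split
    · intro e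
      apply hvu
      rw [‹v = ord a›, ← e, hop]
    · rename_i hva
      intro e
      exact hva (by rw [← e, h.ord_pos v hv])
  constructor
  · intro v hv
    simp only [Function.update_apply]
    split_ifs <;> first | omega | exact h.pos_lt v hv
  · intro p hp
    simp only [Function.update_apply]
    split_ifs <;> first | omega | exact h.ord_lt p hp
  · intro v hv
    by_cases hvu : v = u
    · subst hvu; simp
    · rw [Function.update_of_ne hvu, Function.update_of_ne (hposu v hv hvu)]
      simp only [Function.update_apply]
      split_ifs with e₁ e₂ e₂
      · exact e₁.symm
      · exact absurd rfl e₂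
      · exact absurd (hinj v hv u hu e₂) hvu
      · exact h.ord_pos v hv
  · intro p hp'
    by_cases hpa : p = a
    · subst hpa; simp
    · rw [Function.update_of_ne hpa]
      by_cases hpu : p = pos u
      · subst hpu
        rw [Function.update_self]
        have : ord a ≠ u := fun e => hpa (by rw [← e, hpx])
        rw [Function.update_of_ne this, Function.update_self]
      · rw [Function.update_of_ne hpu, Function.update_of_ne, Function.update_of_ne]
        · exact h.pos_ord p hp'
        · exact fun e => hpa (hinj' p hp' a (by omega) e)
        · exact fun e => hpu (by rw [← e, h.pos_ord p hp'])
  · intro v hv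
    rw [Function.update_apply]
    split_ifs
    · omega
    · exact h.bk_le v hv
  · intro v hv
    by_cases hvu : v = u
    · subst hvu
      rw [Function.update_self, Function.update_self, Function.update_of_ne (by omega)]
      exact h.st_mono (by omega) (by omega)
    · rw [Function.update_of_ne hvu, Function.update_of_ne hvu]
      have h₃ := hposu v hv hvu
      by_cases hva : v = ord a
      · subst hva
        rw [Function.update_self] at h₃ ⊢
        rw [hbx, Function.update_self]
        omega
      · rw [Function.update_of_ne hva] at h₃ ⊢
        have h₄ := h.st_le v hv
        rw [Function.update_apply]
        split_ifs with e
        · rw [e] at h₄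
          omega
        · exact h₄
  · intro v hv
    by_cases hvu : v = u
    · subst hvu
      rw [Function.update_self, Function.update_self, Nat.sub_add_cancel hb, Function.update_self]
      omega
    · rw [Function.update_of_ne hvu, Function.update_of_ne hvu]
      by_cases hva : v = ord a
      · subst hva
        rw [Function.update_self, hbx, Function.update_of_ne (by omega)]
        exact h₂
      · rw [Function.update_of_ne hva]
        have h₄ := h.lt_st v hv
        rw [Function.update_apply]
        split_ifs with e
        · rw [e] at h₄
          omega
        · exact h₄
  · intro j hj
    have h₃ := h.mono j hj
    simp only [Function.update_apply]
    split_ifs with e₁ e₂ e₂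
    · omega
    -- The level contains `u`, so its start can be raised by one without passing the start of the
    -- next level.
    · subst e₁; omega
    · rw [e₂] at h₃; omega
    · exact h₃
  · rw [Function.update_of_ne (by omega)]
    exact h.st_zero
  · rw [Function.update_apply]
    split_ifs
    · omega
    · exact h.st_le_size
  · rw [Function.update_of_ne (by omega)]
    exact h.st_top

end Buckets

/-- The effect on levels of moving the vertex `u` down by some levels. -/
structure Sunk (n u : ℕ) (bk st bk' st' : ℕ → ℕ) : Prop where
  bk_ne : ∀ v, v ≠ u → bk' v = bk v
  bk_le : bk' u ≤ bk u
  st_above : ∀ j, bk u < j → st' j = st j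
  st_below : ∀ j, j ≤ bk' u → st' j = st j
  st_add : ∀ j, st' j + levelSum n bk' ≤ st j + levelSum n bk

namespace Sunk

variable {u : ℕ} {bk st bk' st' : ℕ → ℕ}

theorem refl (n u : ℕ) (bk st : ℕ → ℕ) : Sunk n u bk st bk st :=
  ⟨fun _ _ => rfl, le_rfl, fun _ _ => rfl, fun _ _ => rfl, fun _ => le_rfl⟩

/-- One descent raises a single level start by one and lowers the level sum by one, which is why
`st_add` persists. That inequality later converts the size of a level that has been emptied into a
drop of the potential. -/
theorem descend (h : Sunk n u bk st bk' st') (hu : u < n) (hb : 1 ≤ bk' u) :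
    Sunk n u bk st (Function.update bk' u (bk' u - 1))
      (Function.update st' (bk' u) (st' (bk' u) + 1)) where
  bk_ne v hv := by rw [Function.update_of_ne hv, h.bk_ne v hv]
  bk_le := by
    have := h.bk_le
    rw [Function.update_self]
    omega
  st_above j hj := by
    have := h.bk_le
    rw [Function.update_of_ne (by omega), h.st_above j hj]
  st_below j hj := by
    rw [Function.update_self] at hj
    rw [Function.update_of_ne (by omega), h.st_below j (by omega)]
  st_add j := by
    have h₁ := levelSum_update hu hb
    have h₂ := h.st_add j
    rw [Function.update_apply]
    split_ifs with e
    · subst e; omega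
    · omega

theorem levelSum_le (h : Sunk n u bk st bk' st') : levelSum n bk' ≤ levelSum n bk := by
  refine Finset.sum_le_sum fun v _ => ?_
  by_cases hv : v = u
  · exact hv ▸ h.bk_le
  · exact (h.bk_ne v hv).le

/-- Sinking that stops above level 0 settles nothing, so everything that depends only on the set of
settled vertices is preserved. -/
theorem bk_pos_iff (h : Sunk n u bk st bk' st') (hu : 1 ≤ bk' u) (v : ℕ) :
    1 ≤ bk' v ↔ 1 ≤ bk v := by
  by_cases hv : v = u
  · subst hv
    have := h.bk_le
    exact ⟨fun _ => by omega, fun _ => hu⟩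
  · rw [h.bk_ne v hv]

end Sunk

/-! ### Level bounds of a radix heap -/

/-- The levels `1, …, K` are for keys in `[bd j, bd (j + 1))`, where `bd 1` is the last key that has
been extracted and `bd K` is infinity. -/
structure Bounds (K inf : ℕ) (bd : ℕ → ℕ) : Prop where
  mono : ∀ j, 1 ≤ j → j < K → bd j ≤ bd (j + 1)
  top : bd K = inf
  width_one : bd 2 ≤ bd 1 + 1
  width : ∀ j, 2 ≤ j → j < K → bd (j + 1) ≤ bd j + 2 ^ (j - 2)

theorem Bounds.mono_le {K inf : ℕ} {bd : ℕ → ℕ} (h : Bounds K inf bd) {i j : ℕ} (hi : 1 ≤ i)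
    (hij : i ≤ j) (hj : j ≤ K) : bd i ≤ bd j := by
  induction j, hij using Nat.le_induction with
  | base => exact le_rfl
  | succ j hij ih => exact (ih (by omega)).trans (h.mono j (by omega) (by omega))

/-- The keys `D v` fit the bounds of the levels `bk v`, where vertices on level `0` are settled, and
exempt vertices may be on too high a level. -/
structure Keys (n K inf : ℕ) (D bk bd : ℕ → ℕ) (exempt : Set ℕ) : Prop where
  upper : ∀ v < n, 1 ≤ bk v → bk v < K → D v < bd (bk v + 1)
  lower : ∀ v < n, 1 ≤ bk v → v ∉ exempt → bd (bk v) ≤ D v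
  last_le : ∀ v < n, 1 ≤ bk v → bd 1 ≤ D v
  le_last : ∀ v < n, bk v = 0 → D v ≤ bd 1
  le_inf : ∀ v < n, D v ≤ inf

namespace Keys

variable {K inf : ℕ} {D bk bd st bk' st' : ℕ → ℕ} {exempt : Set ℕ}

/-- Once `u` has reached the level of its key it needs no exemption. The other vertices keep their
keys and levels. -/
theorem sunk (h : Keys n K inf D bk bd exempt) {u : ℕ} (hs : Sunk n u bk st bk' st')
    (hu : 1 ≤ bk' u) (hlow : bd (bk' u) ≤ D u) (hup : bk' u < K → D u < bd (bk' u + 1)) :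
    Keys n K inf D bk' bd (exempt \ {u}) where
  upper v hv h₁ h₂ := by
    by_cases hvu : v = u
    · exact hvu ▸ hup (hvu ▸ h₂)
    · rw [hs.bk_ne v hvu] at *
      exact h.upper v hv h₁ h₂
  lower v hv h₁ h₂ := by
    by_cases hvu : v = u
    · exact hvu ▸ hlow
    · rw [hs.bk_ne v hvu] at *
      exact h.lower v hv h₁ fun e => h₂ ⟨e, hvu⟩
  last_le v hv h₁ := h.last_le v hv ((hs.bk_pos_iff hu v).1 h₁)
  le_last v hv h₁ := h.le_last v hv (by have := hs.bk_pos_iff hu v; omega)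
  le_inf := h.le_inf

theorem mono_exempt (h : Keys n K inf D bk bd exempt) {exempt' : Set ℕ}
    (he : ∀ v, v ∈ exempt → v ∈ exempt') : Keys n K inf D bk bd exempt' where
  upper := h.upper
  lower v hv h₁ h₂ := h.lower v hv h₁ fun e => h₂ (he v e)
  last_le := h.last_le
  le_last := h.le_last
  le_inf := h.le_inf

/-- A smaller key can only violate the lower bound of its level. So the vertex is never too low, and
it becomes exempt until it is sunk. -/
theorem decrease (h : Keys n K inf D bk bd exempt) {u x : ℕ} (hx : x < D u) (hl : bd 1 ≤ x) :
    Keys n K inf (Function.update D u x) bk bd (exempt ∪ {u}) := by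
  have hle : ∀ v, Function.update D u x v ≤ D v := by
    intro v
    rw [Function.update_apply]
    split_ifs with e
    · subst e; exact hx.le
    · exact le_rfl
  constructor
  · exact fun v hv h₁ h₂ => (hle v).trans_lt (h.upper v hv h₁ h₂)
  · intro v hv h₁ h₂
    rw [Function.update_of_ne (fun e => h₂ (Or.inr e))]
    exact h.lower v hv h₁ fun e => h₂ (Or.inl e)
  · intro v hv h₁
    rw [Function.update_apply]
    split_ifs
    · exact hl
    · exact h.last_le v hv h₁
  · exact fun v hv h₁ => (hle v).trans (h.le_last v hv h₁)
  · exact fun v hv => (hle v).trans (h.le_inf v hv)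

/-- Settling a vertex with the last key. -/
theorem settle (h : Keys n K inf D bk bd exempt) {u : ℕ} (hu : D u ≤ bd 1) :
    Keys n K inf D (Function.update bk u 0) bd exempt := by
  constructor
  · intro v hv
    rw [Function.update_apply]
    split_ifs
    · omega
    · exact h.upper v hv
  · intro v hv
    rw [Function.update_apply]
    split_ifs
    · omega
    · exact h.lower v hv
  · intro v hv
    rw [Function.update_apply]
    split_ifs
    · omega
    · exact h.last_le v hv
  · intro v hv
    rw [Function.update_apply]
    split_ifs with e
    · exact fun _ => e ▸ hu
    · exact h.le_last v hv
  · exact h.le_inf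

end Keys

/-- The bounds after splitting the range of level `i` from its minimum `mu` on. -/
structure Split (mu i : ℕ) (bd bd' : ℕ → ℕ) : Prop where
  one : bd' 1 = mu
  low : ∀ j, 2 ≤ j → j ≤ i → bd' j = min (mu + 2 ^ (j - 2)) (bd (i + 1))
  high : ∀ j, i < j → bd' j = bd j

namespace Split

variable {K inf mu i : ℕ} {D bk bd bd' : ℕ → ℕ}

/-- Level `i` has width at most `2 ^ (i - 2)`, so its new start reaches its old end and its key
range becomes empty. Every vertex on it will have to descend, which is what makes the potential
argument work. -/
theorem eq_level (hs : Split mu i bd bd') (h : Bounds K inf bd) (hi : 2 ≤ i) (hiK : i < K)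
    (hmu : bd i ≤ mu) : bd' i = bd (i + 1) := by
  rw [hs.low i hi le_rfl]
  have := h.width i hi hiK
  omega

/-- The new bounds `mu + 2 ^ (j - 2)` double their offset with each level, so level `j` gets width
`2 ^ (j - 2)`. Capping them at the old end of level `i` only shrinks widths. -/
theorem bounds (hs : Split mu i bd bd') (h : Bounds K inf bd) (hi : 2 ≤ i) (hiK : i < K)
    (hmu : bd i ≤ mu) (hmu' : mu < bd (i + 1)) : Bounds K inf bd' where
  mono j h₁ h₂ := by
    rcases lt_trichotomy j i with hlt | rfl | hlt
    · rw [hs.low (j + 1) (by omega) hlt]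
      rcases Nat.lt_or_ge 1 j with hj | hj
      · rw [hs.low j hj hlt.le]
        have : 2 ^ (j - 2) ≤ 2 ^ (j + 1 - 2) := Nat.pow_le_pow_right (by norm_num) (by omega)
        omega
      · rw [show j = 1 by omega, hs.one]
        have := Nat.zero_le (2 ^ (1 + 1 - 2))
        omega
    · rw [hs.eq_level h hi hiK hmu, hs.high _ (by omega)]
    · rw [hs.high _ hlt, hs.high _ (by omega)]
      exact h.mono j h₁ h₂
  top := by rw [hs.high K hiK, h.top]
  width_one := by
    rw [hs.low 2 le_rfl hi, hs.one]
    simp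
  width j h₁ h₂ := by
    rcases lt_trichotomy j i with hlt | rfl | hlt
    · rw [hs.low (j + 1) (by omega) hlt, hs.low j h₁ hlt.le]
      have : 2 ^ (j + 1 - 2) = 2 ^ (j - 2) + 2 ^ (j - 2) := by
        rw [show j + 1 - 2 = (j - 2) + 1 by omega, pow_succ]
        ring
      omega
    · rw [hs.eq_level h hi hiK hmu, hs.high _ (by omega)]
      exact Nat.le_add_right _ _
    · rw [hs.high _ hlt, hs.high _ (by omega)]
      exact h.width j h₁ h₂

/-- As `i` is the first nonempty level above 0, the levels whose bounds are lowered or redefined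
contain no vertices except for level `i` itself. Thus only the vertices of level `i` need an
exemption. -/
theorem keys (hs : Split mu i bd bd') (h : Bounds K inf bd) (hk : Keys n K inf D bk bd ∅)
    (hi : 2 ≤ i) (hiK : i < K) (hmu : bd i ≤ mu) (hmu' : mu < bd (i + 1))
    (hbk : ∀ v < n, 1 ≤ bk v → i ≤ bk v) (hbK : ∀ v < n, bk v ≤ K)
    (hmin : ∀ v < n, bk v = i → mu ≤ D v) :
    Keys n K inf D bk bd' {v | bk v = i} where
  upper v hv h₁ h₂ := by
    have := hbk v hv h₁
    rw [hs.high _ (by omega)]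
    exact hk.upper v hv h₁ h₂
  lower v hv h₁ h₂ := by
    have h₃ := hbk v hv h₁
    have h₄ : bk v ≠ i := h₂
    rw [hs.high _ (by omega)]
    exact hk.lower v hv h₁ (by simp)
  last_le v hv h₁ := by
    have h₃ := hbk v hv h₁
    rw [hs.one]
    by_cases h₄ : bk v = i
    · exact hmin v hv h₄
    · have := hk.lower v hv h₁ (by simp)
      have := h.mono_le (i := i + 1) (j := bk v) (by omega) (by omega) (hbK v hv)
      omega
  le_last v hv h₁ := by
    rw [hs.one]
    exact (hk.le_last v hv h₁).trans ((h.mono_le le_rfl (by omega) hiK.le).trans hmu)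
  le_inf := hk.le_inf

/-- A vertex with the minimum key belongs to level 1. -/
theorem bk_eq_one (hs : Split mu i bd bd') (h : Bounds K inf bd) (hi : 2 ≤ i) 
    (hmu' : mu < bd (i + 1)) {v : ℕ} (h₁ : 1 ≤ bk v) (h₂ : bk v ≤ K) (hD : D v = mu)
    (hlow : bd' (bk v) ≤ D v) : bk v = 1 := by
  by_contra hne
  rcases Nat.lt_or_ge i (bk v) with hlt | hge
  · rw [hs.high _ hlt] at hlow
    have := h.mono_le (i := i + 1) (j := bk v) (by omega) hlt h₂
    omega
  · rw [hs.low _ (by omega) hge] at hlow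
    have : 0 < 2 ^ (bk v - 2) := by positivity
    omega

end Split

/-! ### Shortest-path trees -/

theorem WeightedGraph.Path.snoc {s u t : Fin n} {l : ℕ} (h : G.Path s u l)
    (hut : G.graph.Adj u t) : G.Path s t (l + G.weight u t) := by
  induction h with
  | nil s => simpa using Path.cons hut (.nil t)
  | cons h' _ ih =>
    rw [add_assoc]
    exact .cons h' (ih hut)

theorem AdjLists.deg_le (A : AdjLists G) (v : ℕ) : A.deg v ≤ n := by
  unfold AdjLists.deg
  split_ifs with h
  · simpa using (A.nodup ⟨v, h⟩).length_le_card
  · exact Nat.zero_le n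

theorem AdjLists.nbr_spec (A : AdjLists G) {v i : ℕ} (hv : v < n) (hi : i < A.deg v) :
    ∃ h : A.nbr v i < n, G.graph.Adj ⟨v, hv⟩ ⟨A.nbr v i, h⟩ ∧
      G.weight ⟨v, hv⟩ ⟨A.nbr v i, h⟩ = A.wt v i := by
  simp only [AdjLists.deg, hv, dite_true] at hi
  have h₁ : A.nbr v i = ((A.nbrs ⟨v, hv⟩)[i] : ℕ) := by simp [AdjLists.nbr, hv, hi]
  have h₂ : A.wt v i = G.weight ⟨v, hv⟩ (A.nbrs ⟨v, hv⟩)[i] := by simp [AdjLists.wt, hv, hi]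
  have h₃ : (⟨A.nbr v i, h₁ ▸ Fin.is_lt _⟩ : Fin n) = (A.nbrs ⟨v, hv⟩)[i] := Fin.ext h₁
  refine ⟨h₁ ▸ Fin.is_lt _, ?_, ?_⟩
  · rw [h₃]
    exact (A.mem_iff _ _).1 (List.getElem_mem hi)
  · rw [h₃, h₂]

theorem AdjLists.exists_nbr (A : AdjLists G) {v u : Fin n} (h : G.graph.Adj v u) :
    ∃ i < A.deg v, A.nbr v i = u := by
  obtain ⟨i, hi, e⟩ := List.getElem_of_mem ((A.mem_iff v u).2 h)
  refine ⟨i, ?_, ?_⟩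
  · simpa [AdjLists.deg] using hi
  · simp [AdjLists.nbr, hi, e]

/-- The state of Dijkstra's algorithm from `s` with tentative distances `D`, after `cnt` vertices
have been settled (those with `bk v = 0`), where of each settled vertex `v` only the first `lim v`
edges have been relaxed. Edge weights are at most `W`. -/
structure Tree (A : AdjLists G) (s : Fin n) (W inf : ℕ) (D bk : ℕ → ℕ) (cnt : ℕ) (lim : ℕ → ℕ) :
    Prop where
  path : ∀ v : Fin n, D v < inf → G.Path s v (D v)
  bound : ∀ v < n, D v < inf → D v ≤ cnt * W
  src : D s = 0
  closed : ∀ v < n, bk v = 0 → ∀ i < lim v, D (A.nbr v i) ≤ D v + A.wt v i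

namespace Tree

variable {A : AdjLists G} {s : Fin n} {W inf cnt : ℕ} {D bk : ℕ → ℕ} {lim : ℕ → ℕ}

/-- Levels matter to the tree only through which vertices are settled. -/
theorem congr (h : Tree A s W inf D bk cnt lim) {bk' : ℕ → ℕ}
    (hb : ∀ v, 1 ≤ bk' v ↔ 1 ≤ bk v) : Tree A s W inf D bk' cnt lim where
  path := h.path
  bound := h.bound
  src := h.src
  closed v hv h₁ := h.closed v hv (by have := hb v; omega)

/-- A newly settled vertex has no relaxed edges yet, hence the limit 0. The larger count makes room
for one more edge in the distance bound. -/
theorem settle (h : Tree A s W inf D bk cnt A.deg) (u : ℕ) :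
    Tree A s W inf D (Function.update bk u 0) (cnt + 1) (Function.update A.deg u 0) where
  path := h.path
  bound v hv h₁ := (h.bound v hv h₁).trans (Nat.mul_le_mul_right _ (by omega))
  src := h.src
  closed v hv := by
    by_cases hvu : v = u
    · subst hvu; simp
    · rw [Function.update_of_ne hvu, Function.update_of_ne hvu]
      exact h.closed v hv

theorem skip {v k : ℕ} (h : Tree A s W inf D bk cnt (Function.update A.deg v k))
    (hk : D (A.nbr v k) ≤ D v + A.wt v k) :
    Tree A s W inf D bk cnt (Function.update A.deg v (k + 1)) where
  path := h.path
  bound := h.bound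
  src := h.src
  closed z hz h₁ i hi := by
    by_cases hzv : z = v
    · subst hzv
      rw [Function.update_self] at hi
      rcases Nat.lt_succ_iff_lt_or_eq.1 hi with hi | rfl
      · exact h.closed z hz h₁ i (by rw [Function.update_self]; exact hi)
      · exact hk
    · rw [Function.update_of_ne hzv] at hi
      exact h.closed z hz h₁ i (by rw [Function.update_of_ne hzv]; exact hi)

/-- Settled vertices have keys at most `D v`, so the improved vertex is not settled, and lowering
its key cannot spoil an inequality that has already been established. The finite value replaces a
larger one, hence `D v` is finite and its path can be extended. -/
theorem relax (hW : ∀ u v, G.graph.Adj u v → G.weight u v ≤ W) {v k : ℕ} (hv : v < n)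
    (h : Tree A s W inf D bk cnt (Function.update A.deg v k))
    (hk : k < A.deg v) (hlt : D v + A.wt v k < D (A.nbr v k)) (hinf : D (A.nbr v k) ≤ inf)
    (hset : ∀ z < n, bk z = 0 → D z ≤ D v) (hbound : D v + W ≤ cnt * W) :
    Tree A s W inf (Function.update D (A.nbr v k) (D v + A.wt v k)) bk cnt
      (Function.update A.deg v (k + 1)) := by
  obtain ⟨hu, hadj, hw⟩ := A.nbr_spec hv hk
  have hle : ∀ z, Function.update D (A.nbr v k) (D v + A.wt v k) z ≤ D z := by
    intro z
    rw [Function.update_apply]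
    split_ifs with e
    · subst e; exact hlt.le
    · exact le_rfl
  have hne : ∀ z < n, bk z = 0 → z ≠ A.nbr v k := by
    intro z hz h₁ e
    have := hset z hz h₁
    rw [e] at this
    omega
  constructor
  · intro z h₁
    rw [Function.update_apply] at h₁ ⊢
    split_ifs at h₁ ⊢ with e
    · have : z = ⟨A.nbr v k, hu⟩ := Fin.ext e
      subst this
      rw [← hw]
      exact (h.path ⟨v, hv⟩ (show D v < inf by omega)).snoc hadj
    · exact h.path z h₁
  · intro z hz h₁
    rw [Function.update_apply] at h₁ ⊢
    split_ifs at h₁ ⊢ with e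
    · have := hW _ _ hadj
      omega
    · exact h.bound z hz h₁
  · have := hle s
    rw [h.src] at this
    omega
  · intro z hz h₁ i hi
    rw [Function.update_of_ne (hne z hz h₁)]
    by_cases hzv : z = v
    · subst hzv
      rw [Function.update_self] at hi
      rcases Nat.lt_succ_iff_lt_or_eq.1 hi with hi | rfl
      · exact (hle _).trans (h.closed z hz h₁ i (by rw [Function.update_self]; exact hi))
      · rw [Function.update_self]
    · rw [Function.update_of_ne hzv] at hi
      exact (hle _).trans (h.closed z hz h₁ i (by rw [Function.update_of_ne hzv]; exact hi))

/-- At the end, the tentative distances are correct. -/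
theorem dist_eq (h : Tree A s W inf D bk cnt A.deg) (hinf : 0 < inf)
    (hset : ∀ v < n, D v < inf → bk v = 0)
    (hW : ∀ u v, G.graph.Adj u v → G.weight u v ≤ W) (hbound : (cnt + 1) * W < inf)
    (hle : ∀ v < n, D v ≤ inf) (t : Fin n) :
    G.dist s t = if D t = inf then ⊤ else (D t : ℕ∞) := by
  -- Finiteness propagates along a path because a finite key plus an edge weight is at most `(cnt +
  -- 1) * W < inf`. So a relaxed edge out of a finite vertex leads to a finite, hence settled,
  -- vertex.
  have key : ∀ {x t : Fin n} {l : ℕ}, G.Path x t l → D x < inf → D t < inf ∧ D t ≤ D x + l := by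
    intro x t l hp
    induction hp with
    | nil s => exact fun hx => ⟨hx, by omega⟩
    | @cons x u t l hadj _ ih =>
      intro hx
      obtain ⟨i, hi, hu⟩ := A.exists_nbr hadj
      obtain ⟨h₁, h₂, h₃⟩ := A.nbr_spec x.2 hi
      have h₄ := h.closed x x.2 (hset x x.2 hx) i hi
      have h₅ := h.bound x x.2 hx
      have h₆ := hW x u hadj
      have h₇ : A.wt x i = G.weight x u := by
        rw [← h₃]
        congr 1
        exact Fin.ext hu
      rw [hu, h₇] at h₄
      rw [Nat.succ_mul] at hbound
      obtain ⟨h₈, h₉⟩ := ih (by omega)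
      exact ⟨h₈, by omega⟩
  have hs : D s < inf := by rw [h.src]; exact hinf
  unfold WeightedGraph.dist
  split_ifs with ht
  · rw [iInf_eq_top]
    intro l
    rw [iInf_eq_top]
    intro hp
    have := (key hp hs).1
    omega
  · apply le_antisymm
    · exact iInf₂_le (D t) (h.path t (lt_of_le_of_ne (hle t t.2) ht))
    · refine le_iInf₂ fun l hp => ?_
      have := (key hp hs).2
      rw [h.src, zero_add] at this
      exact_mod_cast this

end Tree

end APSD

/-! ### Sinking a vertex, with amortized cost. -/

namespace APSD

variable {n : ℕ} {G : WeightedGraph n}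

/-! ### Moving a vertex down to its level -/

infixr:60 " ;; " => Program.seq

/-- Move the vertex `u` from level `j` to level `j - 1`. -/
def descendOps : List Op :=
  [.get .q .pos Var.u, .get .a .st Var.j, .get .y .ord Var.a,
    .put .ord Var.q Var.y, .put .pos Var.y Var.q, .put .ord Var.a Var.u, .put .pos Var.u Var.a,
    .add .a Var.a Param.one, .put .st Var.j Var.a, .sub .j Var.j Param.one, .put .bk Var.u Var.j]

/-- Move the vertex `u` down to the level of the key `x`. -/
def sink : Program :=
  block [.get .j .bk Var.u, .get .b .bd Var.j] ;;
  .while (Test.lt Var.x Var.b).compile (block (descendOps ++ [.get .b .bd Var.j]))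

/-- Only the given variables and arrays are changed. -/
structure Frame (V : List Var) (B : List Arr) (s s' : Store) : Prop where
  var : ∀ z, z ∉ V → s'.var z = s.var z
  arr : ∀ k, k ∉ B → s'.arr k = s.arr k

theorem Frame.refl (V : List Var) (B : List Arr) (s : Store) : Frame V B s s :=
  ⟨fun _ _ => rfl, fun _ _ => rfl⟩

theorem Frame.trans {V V' V'' : List Var} {B B' B'' : List Arr} {s s' s'' : Store}
    (h : Frame V B s s') (h' : Frame V' B' s' s'') (hV : V ⊆ V'' := by decide)
    (hV' : V' ⊆ V'' := by decide) (hB : B ⊆ B'' := by decide) (hB' : B' ⊆ B'' := by decide) :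
    Frame V'' B'' s s'' where
  var z hz := by rw [h'.var z fun e => hz (hV' e), h.var z fun e => hz (hV e)]
  arr k hk := by rw [h'.arr k fun e => hk (hB' e), h.arr k fun e => hk (hB e)]

/-- The arrays of a store represent a partition into levels. -/
def Store.Leveled (s : Store) (n K : ℕ) : Prop :=
  Buckets n K (s.arr .ord) (s.arr .pos) (s.arr .bk) (s.arr .st)

structure SinkPost (n K : ℕ) (s s' : Store) : Prop where
  frame : Frame [.j, .b, .q, .a, .y] [.ord, .pos, .bk, .st] s s'
  leveled : s'.Leveled n K
  sunk : Sunk n (s.var .u) (s.arr .bk) (s.arr .st) (s'.arr .bk) (s'.arr .st)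
  pos : 1 ≤ s'.arr .bk (s.var .u)
  upper : s'.arr .bk (s.var .u) < K → s.var .x < s.arr .bd (s'.arr .bk (s.var .u) + 1)

/-- The start level may be too high for the key but not too low. The loop stops on a positive level
because `bd 1 ≤ x`. Each round costs 24 steps and lowers the level sum by one. -/
theorem computes_sink {w : ℕ} {A : AdjLists G} {E : Env} {s : Store} (hE : E.Fits n w)
    (hst : E.stride = n + E.top + 2) (hL : s.Leveled n E.top) (hu : s.var .u < n)
    (hb : 1 ≤ s.arr .bk (s.var .u)) (hx : s.arr .bd 1 ≤ s.var .x)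
    (hup : s.arr .bk (s.var .u) < E.top → s.var .x < s.arr .bd (s.arr .bk (s.var .u) + 1)) :
    Computes w A E sink s fun k s' => SinkPost n E.top s s' ∧
      s.arr .bd (s'.arr .bk (s.var .u)) ≤ s.var .x ∧
      k + 24 * levelSum n (s'.arr .bk) ≤ 24 * levelSum n (s.arr .bk) + 6 := by
  have hmem := hE.mem
  have hbk := hL.bk_le _ hu
  refine .seq (.block hE (by simp; omega) ?_)
  refine .mono (.loop (fun s' => SinkPost n E.top s s' ∧ s'.var .j = s'.arr .bk (s.var .u) ∧
    s'.var .b = s.arr .bd (s'.var .j)) (fun s' => 24 * levelSum n (s'.arr .bk)) ?_ ?_) ?_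
  · refine ⟨⟨⟨?_, ?_⟩, hL, Sunk.refl .., hb, ?_⟩, ?_, ?_⟩
    · intro z hz
      simp at hz
      simp [hz]
    · simp
    · simpa using hup
    · simp
    · simp
  · rintro s₁ ⟨h, hj, hb₁⟩ ht
    have hu₁ : s₁.var .u = s.var .u := h.frame.var _ (by decide)
    have hx₁ : s₁.var .x = s.var .x := h.frame.var _ (by decide)
    have hbd : s₁.arr .bd = s.arr .bd := h.frame.arr _ (by decide)
    have hL₁ := h.leveled
    have hpos := h.pos
    unfold Store.Leveled at hL₁
    simp at ht
    rw [hx₁, hb₁, hj] at ht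
    have hd := hL₁.descend hu hpos
    have h₁ := hL₁.pos_lt _ hu
    have h₂ := hL₁.st_le _ hu
    have h₃ := hL₁.ord_lt _ (h₂.trans_lt h₁)
    have h₄ := hL₁.bk_le _ hu
    have h₅ := levelSum_update hu hpos
    have h₆ := h.sunk.descend hu hpos
    refine .block hE ?_ ?_
    · simp [descendOps, hu₁, hj]
      omega
    · refine ⟨⟨⟨⟨?_, ?_⟩, ?_, ?_, ?_, ?_⟩, ?_, ?_⟩, ?_⟩
      · intro z hz
        have := h.frame.var z hz
        simp at hz
        simp [descendOps, hz, this]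
      · intro k hk
        have := h.frame.arr k hk
        simp at hk
        simp [descendOps, hk, this]
      · simpa [descendOps, hu₁, hj, Store.Leveled] using hd
      · simpa [descendOps, hu₁, hj] using h₆
      · simp [descendOps, hu₁, hj]
        by_contra hlt
        have : s₁.arr .bk (s.var .u) = 1 := by omega
        rw [this] at ht
        omega
      · simp [descendOps, hu₁, hj]
        rw [Nat.sub_add_cancel hpos]
        exact fun _ => ht
      · simp [descendOps, hu₁, hj]
      · simp [descendOps, hbd]
      · simp [descendOps, hu₁, hj]
        omega
  · rintro k s' ⟨⟨h, hj, hb'⟩, hlt, hk⟩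
    simp [hb', hj, h.frame.var .x] at hlt
    simp at hk
    refine ⟨h, hlt, ?_⟩
    simp
    omega

end APSD

/-! ### Splitting the first nonempty level of the heap. -/

namespace APSD

variable {n : ℕ} {G : WeightedGraph n}

/-! ### Splitting a level -/

/-- Compute the minimum `mu` of the keys on level `i`. -/
def findMin : Program :=
  block [.get .p .st Var.i, .add .g Var.i Param.one, .get .e .st Var.g, .get .u .ord Var.p,
    .get .mu .dist Var.u] ;;
  .while (Test.lt Var.p Var.e).compile
    (block [.get .u .ord Var.p, .get .x .dist Var.u] ;;
    .ite (Test.lt Var.x Var.mu).compile (block [.move .mu Var.x]) (block []) ;;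
    block [.add .p Var.p Param.one])

/-- Split the range of level `i = g - 1` from `mu` on. -/
def setBounds : Program :=
  block [.put .bd Param.one Var.mu, .get .b .bd Var.g, .move .x Param.one, .const .j 2] ;;
  .while (Test.lt Var.j Var.g).compile
    (block [.add .y Var.mu Var.x] ;;
    .ite (Test.lt Var.b Var.y).compile (block [.move .y Var.b]) (block []) ;;
    block [.put .bd Var.j Var.y, .add .x Var.x Var.x, .add .j Var.j Param.one])

/-- Move all vertices of level `i` down. -/
def distribute : Program :=
  block [.get .p .st Var.i] ;;
  .while (Test.lt Var.p Var.e).compile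
    (block [.get .u .ord Var.p, .get .x .dist Var.u] ;; sink ;; block [.get .p .st Var.i])

def redistribute : Program := findMin ;; setBounds ;; distribute

/-- The environment of Dijkstra's algorithm on a graph with `n` vertices. -/
structure Env.Good (E : Env) (n w : ℕ) : Prop extends E.Fits n w where
  stride_eq : E.stride = n + E.top + 2
  top_ge : 3 ≤ E.top
  inf_eq : E.inf = 2 ^ (E.top - 3)
  inf_lt : 4 * E.inf < 2 ^ w
  src_lt : E.src < n

variable {w : ℕ} {A : AdjLists G} {E : Env} {s : Store}

structure MinPost (n i : ℕ) (s s' : Store) : Prop where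
  frame : Frame [.p, .g, .e, .u, .mu, .x] [] s s'
  g_eq : s'.var .g = i + 1
  e_eq : s'.var .e = s.arr .st (i + 1)
  p_ge : s.arr .st i ≤ s'.var .p
  attained : ∃ v < n, s.arr .bk v = i ∧ s.arr .dist v = s'.var .mu
  le : ∀ p, s.arr .st i ≤ p → p < s'.var .p → s'.var .mu ≤ s.arr .dist (s.arr .ord p)

/-- The minimum is initialized with the first vertex of the level, which exists by `hne`, so it is
attained throughout. The level lies below the sentinel, so its positions are below `n`. -/
theorem computes_findMin (hE : E.Good n w) (hL : s.Leveled n E.top) (hi : s.var .i < E.top)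
    (hne : s.arr .st (s.var .i) < s.arr .st (s.var .i + 1)) :
    Computes w A E findMin s fun k s' => MinPost n (s.var .i) s s' ∧
      (∀ v < n, s.arr .bk v = s.var .i → s'.var .mu ≤ s.arr .dist v) ∧
      k + 12 * s.arr .st (s.var .i) ≤ 12 * s.arr .st (s.var .i + 1) + 15 := by
  have hmem := hE.mem
  have hst := hE.stride_eq
  unfold Store.Leveled at hL
  have he : s.arr .st (s.var .i + 1) ≤ n := (hL.st_mono hi (by omega)).trans hL.st_le_size
  have hu := hL.ord_lt (s.arr .st (s.var .i)) (by omega)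
  refine .seq (.block hE.toFits (by simp; omega) ?_)
  refine .mono (.loop (fun s' => MinPost n (s.var .i) s s')
    (fun s' => 12 * (s'.var .e - s'.var .p)) ?_ ?_) ?_
  · refine ⟨⟨?_, ?_⟩, ?_, ?_, ?_, ?_, ?_⟩
    · intro z hz
      simp at hz
      simp [hz]
    · simp
    · simp
    · simp
    · simp
    · refine ⟨s.arr .ord (s.arr .st (s.var .i)), hu, ?_, by simp⟩
      refine hL.bk_eq hu hi.le ?_ ?_ <;> rw [hL.pos_ord _ (by omega)]
      exact hne
    · intro p h₁ h₂
      simp at h₂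
      omega
  · intro s₁ h ht
    have hord : s₁.arr .ord = s.arr .ord := h.frame.arr _ (by decide)
    have hdist : s₁.arr .dist = s.arr .dist := h.frame.arr _ (by decide)
    have h₁ := h.e_eq
    have h₂ := h.p_ge
    simp at ht
    have h₃ := hL.ord_lt (s₁.var .p) (by omega)
    have h₄ : s.arr .bk (s.arr .ord (s₁.var .p)) = s.var .i := by
      refine hL.bk_eq h₃ hi.le ?_ ?_ <;> rw [hL.pos_ord _ (by omega)] <;> omega
    refine .seq (.block hE.toFits (by simp [hord]; omega) (.seq (.ite ?_ ?_))) <;> intro hlt <;>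
      simp [hord, hdist] at hlt <;> refine .block hE.toFits (by simp)
        (.block hE.toFits (by simp; omega) ⟨⟨⟨?_, ?_⟩, ?_, ?_, ?_, ?_, ?_⟩, ?_⟩)
    · intro z hz
      have := h.frame.var z hz
      simp at hz
      simp [hz, this]
    · intro k hk
      simp [h.frame.arr k hk]
    · simp [h.g_eq]
    · simp [h.e_eq]
    · simp; omega
    · exact ⟨_, h₃, h₄, by simp [hord, hdist]⟩
    · intro p hp₁ hp₂
      simp at hp₂
      simp [hord, hdist]
      rcases hp₂.lt_or_eq with hp | rfl
      · exact hlt.le.trans (h.le p hp₁ hp)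
      · exact le_rfl
    · simp
      omega
    · intro z hz
      have := h.frame.var z hz
      simp at hz
      simp [hz, this]
    · intro k hk
      simp [h.frame.arr k hk]
    · simp [h.g_eq]
    · simp [h.e_eq]
    · simp; omega
    · simpa using h.attained
    · intro p hp₁ hp₂
      simp at hp₂
      simp
      rcases hp₂.lt_or_eq with hp | rfl
      · exact h.le p hp₁ hp
      · exact hlt
    · simp
      omega
  · rintro k s' ⟨h, hlt, hk⟩
    simp [h.e_eq] at hlt hk ⊢
    refine ⟨h, ?_, by omega⟩
    intro v hv hvi
    have h₁ := hL.st_le v hv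
    have h₂ := hL.lt_st v hv
    rw [hvi] at h₁ h₂
    have := h.le (s.arr .pos v) h₁ (by omega)
    rwa [hL.ord_pos v hv] at this

/-- Without multiplication, the power `2 ^ (j - 2)` is maintained in `x` by doubling. The end of
level `i` is kept in `b`. Index 1 is written in advance, so `high` starts from 2. -/
structure BoundsInv (i : ℕ) (s s' : Store) : Prop where
  frame : Frame [.b, .x, .j, .y] [.bd] s s'
  b_eq : s'.var .b = s.arr .bd (i + 1)
  j_ge : 2 ≤ s'.var .j
  j_le : s'.var .j ≤ i + 1
  x_eq : s'.var .x = 2 ^ (s'.var .j - 2)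
  one : s'.arr .bd 1 = s.var .mu
  low : ∀ l, 2 ≤ l → l < s'.var .j →
    s'.arr .bd l = min (s.var .mu + 2 ^ (l - 2)) (s.arr .bd (i + 1))
  high : ∀ l, 2 ≤ l → s'.var .j ≤ l → s'.arr .bd l = s.arr .bd l

theorem computes_setBounds (hE : E.Good n w) {i : ℕ} (hg : s.var .g = i + 1) (hi : 2 ≤ i)
    (hiK : i < E.top) (hmu : s.var .mu ≤ E.inf) :
    Computes w A E setBounds s fun k s' => Frame [.b, .x, .j, .y] [.bd] s s' ∧
      Split (s.var .mu) i (s.arr .bd) (s'.arr .bd) ∧ k ≤ 15 * i + 15 := by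
  have hmem := hE.mem
  have hst := hE.stride_eq
  have hinf := hE.inf_lt
  refine .seq (.block hE.toFits (by simp; omega) ?_)
  refine .mono (.loop (BoundsInv i s) (fun s' => 15 * (i + 1 - s'.var .j)) ?_ ?_) ?_
  · refine ⟨⟨?_, ?_⟩, ?_, ?_, ?_, ?_, ?_, ?_, ?_⟩
    · intro z hz
      simp at hz
      simp [hz]
    · intro k hk
      simp at hk
      simp [hk]
    · simp [hg]
      rw [Function.update_of_ne (by omega)]
    · simp
    · simp; omega
    · simp
    · simp
    · intro l h₁ h₂
      simp at h₂
      omega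
    · intro l h₁ h₂
      simp
      rw [Function.update_of_ne (by omega)]
  · intro s₁ h ht
    have hmu₁ : s₁.var .mu = s.var .mu := h.frame.var _ (by decide)
    have hg₁ : s₁.var .g = i + 1 := (h.frame.var _ (by decide)).trans hg
    have h₁ := h.j_ge
    have h₂ := h.x_eq
    have h₃ := h.b_eq
    simp [hg₁] at ht
    -- Here `j ≤ i < top` and `inf = 2 ^ (top - 3)`, so the sums and the doubling stay below `4 *
    -- inf` and do not overflow.
    have hx : 2 ^ (s₁.var .j - 2) ≤ E.inf := by
      rw [hE.inf_eq]
      exact Nat.pow_le_pow_right (by norm_num) (by omega)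
    have hx' : 2 ^ (s₁.var .j - 1) = 2 ^ (s₁.var .j - 2) + 2 ^ (s₁.var .j - 2) := by
      rw [show s₁.var .j - 1 = (s₁.var .j - 2) + 1 by omega, pow_succ]
      ring
    refine .seq (.block hE.toFits (by simp [h₂]; omega) (.seq (.ite ?_ ?_))) <;> intro hlt <;>
      simp at hlt <;> refine .block hE.toFits (by simp)
        (.block hE.toFits (by simp [h₂]; omega) ⟨⟨⟨?_, ?_⟩, ?_, ?_, ?_, ?_, ?_, ?_, ?_⟩, ?_⟩)
    · intro z hz
      have := h.frame.var z hz
      simp at hz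
      simp [hz, this]
    · intro k hk
      have := h.frame.arr k hk
      simp at hk
      simp [hk, this]
    · simp [h₃]
    · simp; omega
    · simp; omega
    · simp [h₂, hx']
    · simp
      rw [Function.update_of_ne (by omega), h.one]
    · intro l hl₁ hl₂
      simp at hl₂
      simp
      rw [Function.update_apply]
      split_ifs with e
      · subst e
        omega
      · exact h.low l hl₁ (by omega)
    · intro l hl₀ hl
      simp at hl
      simp
      rw [Function.update_of_ne (by omega), h.high l hl₀ (by omega)]
    · simp
      omega
    · intro z hz
      have := h.frame.var z hz
      simp at hz
      simp [hz, this]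
    · intro k hk
      have := h.frame.arr k hk
      simp at hk
      simp [hk, this]
    · simp [h₃]
    · simp; omega
    · simp; omega
    · simp [h₂, hx']
    · simp
      rw [Function.update_of_ne (by omega), h.one]
    · intro l hl₁ hl₂
      simp at hl₂
      simp
      rw [Function.update_apply]
      split_ifs with e
      · subst e
        omega
      · exact h.low l hl₁ (by omega)
    · intro l hl₀ hl
      simp at hl
      simp
      rw [Function.update_of_ne (by omega), h.high l hl₀ (by omega)]
    · simp
      omega
  · rintro k s' ⟨h, hlt, hk⟩
    have hg' : s'.var .g = i + 1 := (h.frame.var _ (by decide)).trans hg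
    simp [hg'] at hlt hk ⊢
    refine ⟨h.frame, ⟨h.one, fun j h₁ h₂ => h.low j h₁ (by omega), fun j h₁ => ?_⟩, by omega⟩
    have := h.j_le
    exact h.high j (by omega) (by omega)

/-- The clause `high` says that the key range of level `i` is already empty, so each sink moves its
vertex by at least one level. The clauses on `st` allow the work to be charged to the level sum. -/
structure DistPost (n K inf i : ℕ) (s s' : Store) : Prop where
  frame : Frame [.p, .u, .x, .j, .b, .q, .a, .y] [.ord, .pos, .bk, .st] s s'
  leveled : s'.Leveled n K
  keys : Keys n K inf (s.arr .dist) (s'.arr .bk) (s.arr .bd) {v | s'.arr .bk v = i}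
  high : ∀ v < n, s'.arr .bk v = i → s.arr .dist v < s.arr .bd i
  settled_iff : ∀ v, 1 ≤ s'.arr .bk v ↔ 1 ≤ s.arr .bk v
  st_one : s'.arr .st 1 = s.arr .st 1
  st_high : s'.arr .st (i + 1) = s.arr .st (i + 1)
  st_add : s'.arr .st i + levelSum n (s'.arr .bk) ≤ s.arr .st i + levelSum n (s.arr .bk)

/-- The first vertex of level `i` is sunk until the start of the level meets its end, which never
moves. A round costs 15 steps plus 24 per level descended, and at least one level is descended, so
40 per level suffices. -/
theorem computes_distribute (hE : E.Good n w) (hL : s.Leveled n E.top)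
    (hiK : s.var .i < E.top) (hi : 2 ≤ s.var .i)
    (he : s.var .e = s.arr .st (s.var .i + 1))
    (hk : Keys n E.top E.inf (s.arr .dist) (s.arr .bk) (s.arr .bd) {v | s.arr .bk v = s.var .i})
    (hhigh : ∀ v < n, s.arr .bk v = s.var .i → s.arr .dist v < s.arr .bd (s.var .i)) :
    Computes w A E distribute s fun k s' => DistPost n E.top E.inf (s.var .i) s s' ∧
      Keys n E.top E.inf (s.arr .dist) (s'.arr .bk) (s.arr .bd) ∅ ∧
      s.arr .st (s.var .i + 1) + levelSum n (s'.arr .bk) ≤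
        s.arr .st (s.var .i) + levelSum n (s.arr .bk) ∧
      k + 40 * levelSum n (s'.arr .bk) ≤ 40 * levelSum n (s.arr .bk) + 4 := by
  have hmem := hE.mem
  have hst := hE.stride_eq
  unfold Store.Leveled at hL
  have he' : s.arr .st (s.var .i + 1) ≤ n := (hL.st_mono hiK (by omega)).trans hL.st_le_size
  refine .seq (.block hE.toFits (by simp; omega) ?_)
  refine .mono (.loop (fun s' => DistPost n E.top E.inf (s.var .i) s s' ∧
    s'.var .p = s'.arr .st (s.var .i)) (fun s' => 40 * levelSum n (s'.arr .bk)) ?_ ?_) ?_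
  · refine ⟨⟨⟨?_, ?_⟩, hL, hk, hhigh, ?_, ?_, ?_, ?_⟩, ?_⟩
    · intro z hz
      simp at hz
      simp [hz]
    all_goals simp
  · rintro s₁ ⟨h, hp⟩ ht
    have hi₁ : s₁.var .i = s.var .i := h.frame.var _ (by decide)
    have he₁ : s₁.var .e = s.var .e := h.frame.var _ (by decide)
    have hdist : s₁.arr .dist = s.arr .dist := h.frame.arr _ (by decide)
    have hbd : s₁.arr .bd = s.arr .bd := h.frame.arr _ (by decide)
    have hL₁ := h.leveled
    unfold Store.Leveled at hL₁
    simp [hp, he₁, he] at ht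
    rw [← h.st_high] at ht
    have h₁ := h.st_high
    set i := s.var .i with hidef
    have hu := hL₁.ord_lt (s₁.arr .st i) (by omega)
    set u := s₁.arr .ord (s₁.arr .st i) with hudef
    have hbk : s₁.arr .bk u = i := by
      refine hL₁.bk_eq hu hiK.le ?_ ?_ <;> rw [hL₁.pos_ord _ (by omega)]
      exact ht
    have hDu := h.high u hu hbk
    have hlast := h.keys.last_le u hu (by omega)
    have hupper := h.keys.upper u hu (by omega)
    refine .seq (.block hE.toFits (by simp [hp, ← hudef]; omega) ?_)
    refine .seq (.mono (computes_sink hE.toFits hst ?_ ?_ ?_ ?_ ?_) ?_)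
    · simpa [Store.Leveled] using hL₁
    · simpa [hp, ← hudef] using hu
    · simp [hp, ← hudef]
      omega
    · simpa [hp, ← hudef, hdist, hbd] using hlast
    · simpa [hp, ← hudef, hdist, hbd] using hupper
    · rintro k₁ s₂ ⟨h₂, hlow, hcost⟩
      have hsunk := h₂.sunk
      have hpos := h₂.pos
      have hup := h₂.upper
      have hframe : Frame [.p, .u, .x, .j, .b, .q, .a, .y] [.ord, .pos, .bk, .st] s s₂ := by
        refine h.frame.trans (V' := [.u, .x, .j, .b, .q, .a, .y])
          (B' := [.ord, .pos, .bk, .st]) ⟨?_, ?_⟩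
        · intro z hz
          have := h₂.frame.var z
          simp at hz this
          rw [this] <;> simp [hz]
        · intro z hz
          simpa using h₂.frame.arr z hz
      simp [hp, ← hudef, hdist, hbd] at hsunk hpos hup hlow hcost
      -- Staying on level `i` would require `bd i ≤ D u`, contrary to `high`.
      have hlt : s₂.arr .bk u < i := by
        refine lt_of_le_of_ne (hbk ▸ hsunk.bk_le) fun e => ?_
        rw [e] at hlow
        omega
      have hls := hsunk.st_add i
      have hls' : levelSum n (s₂.arr .bk) < levelSum n (s₁.arr .bk) := by
        refine Finset.sum_lt_sum (fun v _ => ?_) ⟨u, Finset.mem_range.2 hu, by omega⟩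
        by_cases hv : v = u
        · exact hv ▸ hsunk.bk_le
        · exact (hsunk.bk_ne v hv).le
      have hi₂ : s₂.var .i = i := hframe.var _ (by decide)
      refine .block hE.toFits (by simp [hi₂]; omega)
        ⟨⟨⟨⟨?_, ?_⟩, ?_, ?_, ?_, ?_, ?_, ?_, ?_⟩, ?_⟩, ?_⟩
      · intro z hz
        have := hframe.var z hz
        simp at hz
        simp [hz, this]
      · intro z hz
        simpa using hframe.arr z hz
      · simpa [Store.Leveled] using h₂.leveled
      · simp
        refine (h.keys.sunk hsunk hpos hlow hup).mono_exempt ?_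
        rintro v ⟨hv₁, hv₂⟩
        exact (hsunk.bk_ne v hv₂).trans hv₁
      · intro v hv hvi
        simp at hvi
        by_cases hvu : v = u
        · rw [hvu] at hvi
          omega
        · rw [hsunk.bk_ne v hvu] at hvi
          exact h.high v hv hvi
      · intro v
        simp
        exact (hsunk.bk_pos_iff hpos v).trans (h.settled_iff v)
      · simp
        rw [hsunk.st_below 1 hpos, h.st_one]
      · simp
        rw [hsunk.st_above _ (by omega), h.st_high]
      · simp
        have := h.st_add
        omega
      · simp [hi₂]
      · simp
        omega
  · rintro k s' ⟨⟨h, hp⟩, hlt, hk'⟩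
    have he₁ : s'.var .e = s.var .e := h.frame.var _ (by decide)
    simp [hp, he₁, he] at hlt hk' ⊢
    have h₁ := h.st_add
    refine ⟨h, ?_, by omega, by omega⟩
    refine ⟨h.keys.upper, fun v hv h₂ _ => ?_, h.keys.last_le, h.keys.le_last, h.keys.le_inf⟩
    -- At the end level `i` is empty, so there are no exempt vertices any more.
    refine h.keys.lower v hv h₂ fun e => ?_
    have h₃ := h.leveled.st_le v hv
    have h₄ := h.leveled.lt_st v hv
    have h₅ := h.st_high
    rw [show s'.arr .bk v = s.var .i from e] at h₃ h₄
    omega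

structure RedistributePost (n K inf : ℕ) (s s' : Store) : Prop where
  frame : Frame [.p, .g, .e, .u, .mu, .x, .j, .b, .q, .a, .y] [.ord, .pos, .bk, .st, .bd] s s'
  leveled : s'.Leveled n K
  bounds : Bounds K inf (s'.arr .bd)
  keys : Keys n K inf (s.arr .dist) (s'.arr .bk) (s'.arr .bd) ∅
  settled_iff : ∀ v, 1 ≤ s'.arr .bk v ↔ 1 ≤ s.arr .bk v
  st_one : s'.arr .st 1 = s.arr .st 1
  nonempty : s'.arr .st 1 < s'.arr .st 2

/-- Finding the minimum costs 12 steps per vertex of the level, and each of these vertices descends.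
Together with 40 for the distribution this gives 52 per unit of the level sum. Level 1 becomes
nonempty because the vertex `m` that attains the minimum is forced onto it. -/
theorem computes_redistribute (hE : E.Good n w) (hL : s.Leveled n E.top)
    (hB : Bounds E.top E.inf (s.arr .bd))
    (hk : Keys n E.top E.inf (s.arr .dist) (s.arr .bk) (s.arr .bd) ∅)
    (hiK : s.var .i < E.top) (hi : 2 ≤ s.var .i)
    (hne : s.arr .st (s.var .i) < s.arr .st (s.var .i + 1))
    (hfirst : ∀ v < n, 1 ≤ s.arr .bk v → s.var .i ≤ s.arr .bk v) :
    Computes w A E redistribute s fun k s' => RedistributePost n E.top E.inf s s' ∧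
      k + 52 * levelSum n (s'.arr .bk) ≤ 52 * levelSum n (s.arr .bk) + 15 * E.top + 34 := by
  refine .seq (.mono (computes_findMin hE hL hiK hne) ?_)
  rintro k₁ s₁ ⟨h₁, hmin, hc₁⟩
  have hi₁ : s₁.var .i = s.var .i := h₁.frame.var _ (by decide)
  have harr₁ : s₁.arr = s.arr := funext fun k => h₁.frame.arr k (by simp)
  obtain ⟨m, hm, hbm, hDm⟩ := h₁.attained
  have hm₁ := hk.lower m hm (by omega) (by simp)
  have hm₂ := hk.upper m hm (by omega) (by omega)
  have hm₃ := hk.le_inf m hm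
  rw [hbm, hDm] at hm₁ hm₂
  rw [hDm] at hm₃
  refine .seq (.mono (computes_setBounds hE h₁.g_eq hi hiK hm₃) ?_)
  rintro k₂ s₂ ⟨h₂, hs, hc₂⟩
  rw [harr₁] at hs
  have hi₂ : s₂.var .i = s.var .i := (h₂.var _ (by decide)).trans hi₁
  have he₂ : s₂.var .e = s.arr .st (s.var .i + 1) := (h₂.var _ (by decide)).trans h₁.e_eq
  have harr₂ : ∀ k ≠ Arr.bd, s₂.arr k = s.arr k := fun k hk' => by
    rw [h₂.arr k (by simp [hk']), harr₁]
  have hkeys := hs.keys hB hk hi hiK hm₁ hm₂ hfirst hL.bk_le hmin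
  have hbounds := hs.bounds hB hi hiK hm₁ hm₂
  have hdist₂ := harr₂ .dist (by decide)
  have hbk₂ := harr₂ .bk (by decide)
  have hst₂ := harr₂ .st (by decide)
  refine .mono (computes_distribute hE ?_ ?_ ?_ ?_ ?_ ?_) ?_
  · unfold Store.Leveled
    rwa [harr₂ .ord (by decide), harr₂ .pos (by decide), hbk₂, hst₂]
  · rwa [hi₂]
  · rwa [hi₂]
  · rw [he₂, hi₂, hst₂]
  · rwa [hdist₂, hbk₂, hi₂]
  · intro v hv hvi
    rw [hbk₂, hi₂] at hvi
    rw [hdist₂, hi₂, hs.eq_level hB hi hiK hm₁, ← hvi]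
    exact hk.upper v hv (by omega) (by omega)
  · rintro k₃ s₃ ⟨h₃, hkeys₃, hadd, hc₃⟩
    rw [hdist₂] at hkeys₃
    have hbd₃ : s₃.arr .bd = s₂.arr .bd := h₃.frame.arr _ (by decide)
    have hiff : ∀ v, 1 ≤ s₃.arr .bk v ↔ 1 ≤ s.arr .bk v := fun v => by
      rw [h₃.settled_iff v, hbk₂]
    refine ⟨⟨?_, h₃.leveled, ?_, ?_, hiff, ?_, ?_⟩, ?_⟩
    · exact (h₁.frame.trans (V'' := [.p, .g, .e, .u, .mu, .x, .b, .j, .y]) (B'' := [.bd]) h₂).trans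
        h₃.frame
    · rwa [hbd₃]
    · rwa [hbd₃]
    · rw [h₃.st_one, hst₂]
    · have hpos := (hiff m).2 (by omega)
      have hone := hs.bk_eq_one hB hi hm₂ hpos (h₃.leveled.bk_le m hm) hDm
        (hkeys₃.lower m hm hpos (by simp))
      have h₄ := h₃.leveled.st_le m hm
      have h₅ := h₃.leveled.lt_st m hm
      rw [hone] at h₄ h₅
      exact h₄.trans_lt h₅
    · rw [hbk₂] at hc₃ hadd
      rw [hst₂, hi₂] at hadd
      omega

end APSD

/-! ### One run of Dijkstra's algorithm in time `O(m + n log n)`. -/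

namespace APSD

variable {n : ℕ} {G : WeightedGraph n}

/-! ### Dijkstra's algorithm -/

/-- Find the first nonempty level `i ≥ 1`. -/
def scan : Program :=
  block [.move .i Param.one, .add .y Var.i Param.one, .get .a .st Var.i, .get .b .st Var.y] ;;
  .while (Test.eq Var.a Var.b).compile
    (block [.move .i Var.y, .add .y Var.i Param.one, .get .a .st Var.i, .get .b .st Var.y])

/-- Relax the edges of the vertex `v`. -/
def relaxEdges : Program :=
  .while (Test.lt Var.k Var.g).compile
    (block [.neighbor .u Var.v Var.k, .weight .x Var.v Var.k, .add .x Var.x Var.dv,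
      .get .y .dist Var.u] ;;
    .ite (Test.lt Var.x Var.y).compile (block [.put .dist Var.u Var.x] ;; sink) (block []) ;;
    block [.add .k Var.k Param.one])

/-- Settle a vertex of level 1. -/
def settleNext : Program :=
  block ([.move .j Param.one, .get .a .st Var.j, .get .u .ord Var.a] ++ descendOps ++
    [.move .v Var.u, .get .dv .dist Var.v, .degree .g Var.v, .const .k 0]) ;;
  relaxEdges

def initHeap : Program :=
  block [.const .i 0] ;;
  .while (Test.lt Var.i Param.size).compile
    (block [.put .dist Var.i Param.inf, .put .pos Var.i Var.i, .put .ord Var.i Var.i,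
      .put .bk Var.i Param.top, .add .i Var.i Param.one]) ;;
  block [.add .y Param.top Param.one, .add .x Param.size Param.one, .put .st Var.y Var.x,
    .put .bd Param.top Param.inf, .move .u Param.src, .const .x 0, .put .dist Var.u Var.x] ;;
  sink

/-- Single-source shortest distances from `src`, on arrays that are initialized to 0. -/
def dijkstra : Program :=
  initHeap ;; scan ;;
  .while (Test.lt Var.i Param.top).compile
    (.ite (Test.lt Param.one Var.i).compile redistribute (block []) ;; settleNext ;; scan)

variable {w : ℕ} {A : AdjLists G} {E : Env} {s : Store}

structure ScanPost (K : ℕ) (s s' : Store) : Prop where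
  frame : Frame [.i, .y, .a, .b] [] s s'
  ge : 1 ≤ s'.var .i
  le : s'.var .i ≤ K
  empty : ∀ l, 1 ≤ l → l < s'.var .i → s.arr .st l = s.arr .st (l + 1)

/-- The sentinel `st (K + 1) = n + 1` exceeds `st K ≤ n`, so the search stops at level `K` at the
latest, without a test for the end. -/
theorem computes_scan (hE : E.Good n w) (hL : s.Leveled n E.top) :
    Computes w A E scan s fun k s' => ScanPost E.top s s' ∧
      s.arr .st (s'.var .i) < s.arr .st (s'.var .i + 1) ∧
      (∀ v < n, 1 ≤ s.arr .bk v → s'.var .i ≤ s.arr .bk v) ∧ k ≤ 8 * E.top + 9 := by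
  have hmem := hE.mem
  have hst := hE.stride_eq
  have htop := hE.top_ge
  unfold Store.Leveled at hL
  refine .seq (.block hE.toFits (by simp; omega) ?_)
  refine .mono (.loop (fun s' => ScanPost E.top s s' ∧ s'.var .y = s'.var .i + 1 ∧
    s'.var .a = s.arr .st (s'.var .i) ∧ s'.var .b = s.arr .st (s'.var .i + 1))
    (fun s' => 8 * (E.top - s'.var .i)) ?_ ?_) ?_
  · refine ⟨⟨⟨?_, ?_⟩, ?_, ?_, ?_⟩, ?_, ?_, ?_⟩
    · intro z hz
      simp at hz
      simp [hz]
    · simp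
    · simp
    · simp; omega
    · intro l h₁ h₂
      simp at h₂
      omega
    all_goals simp
  · rintro s₁ ⟨h, hy, ha, hb⟩ ht
    have hst₁ : s₁.arr .st = s.arr .st := h.frame.arr _ (by decide)
    have h₁ := h.le
    have h₂ := h.ge
    simp [ha, hb] at ht
    have hlt : s₁.var .i < E.top := by
      refine lt_of_le_of_ne h₁ fun e => ?_
      rw [e, hL.st_top] at ht
      have := hL.st_le_size
      omega
    refine .block hE.toFits (by simp [hy]; omega) ⟨⟨⟨⟨?_, ?_⟩, ?_, ?_, ?_⟩, ?_, ?_, ?_⟩, ?_⟩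
    · intro z hz
      have := h.frame.var z hz
      simp at hz
      simp [hz, this]
    · intro z hz
      simpa using h.frame.arr z hz
    · simp; omega
    · simp; omega
    · intro l h₃ h₄
      simp [hy] at h₄
      rcases h₄.lt_or_eq with h₄ | rfl
      · exact h.empty l h₃ h₄
      · exact ht
    · simp
    · simp [hst₁]
    · simp [hst₁]
    · simp
      omega
  · rintro k s' ⟨⟨h, hy, ha, hb⟩, hne, hk⟩
    have h₁ := h.le
    have h₂ := h.ge
    simp [ha, hb] at hne hk ⊢
    refine ⟨h, lt_of_le_of_ne (hL.mono _ h₁) hne, ?_, by omega⟩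
    intro v hv hbv
    by_contra hlt
    have h₃ := hL.st_le v hv
    have h₄ := hL.lt_st v hv
    rw [← h.empty _ hbv (by omega)] at h₄
    omega

/-- The invariant of Dijkstra's algorithm. -/
structure Store.Dijkstra (A : AdjLists G) (src : Fin n) (W K inf : ℕ) (s : Store) (lim : ℕ → ℕ) :
    Prop where
  leveled : s.Leveled n K
  bounds : Bounds K inf (s.arr .bd)
  keys : Keys n K inf (s.arr .dist) (s.arr .bk) (s.arr .bd) ∅
  tree : Tree A src W inf (s.arr .dist) (s.arr .bk) (s.arr .st 1) lim

theorem Store.Dijkstra.congr {src : Fin n} {W K inf : ℕ} {lim : ℕ → ℕ} {s' : Store}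
    (h : s.Dijkstra A src W K inf lim) (hs : s'.arr = s.arr) : s'.Dijkstra A src W K inf lim := by
  obtain ⟨h₁, h₂, h₃, h₄⟩ := h
  refine ⟨?_, ?_, ?_, ?_⟩ <;> simpa only [hs, Store.Leveled]

structure RelaxPost (A : AdjLists G) (src : Fin n) (W K inf : ℕ) (s s' : Store) : Prop where
  frame : Frame [.u, .x, .y, .k, .j, .b, .q, .a] [.dist, .ord, .pos, .bk, .st] s s'
  dijkstra : s'.Dijkstra A src W K inf (Function.update A.deg (s.var .v) (s'.var .k))
  k_le : s'.var .k ≤ A.deg (s.var .v)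
  settled_iff : ∀ v, 1 ≤ s'.arr .bk v ↔ 1 ≤ s.arr .bk v
  st_one : s'.arr .st 1 = s.arr .st 1
  dist_eq : s'.arr .dist (s.var .v) = s.arr .dist (s.var .v)

/-- The current vertex `v` has the last extracted key, so every settled key is at most its key and
every new key is at least `bd 1`. An edge costs a constant, and sinking is paid by the level sum.
The factor 52 exceeds the 24 needed so that the potential is the one for redistribution. -/
theorem computes_relaxEdges (hE : E.Good n w) {src : Fin n} {W : ℕ}
    (hW : ∀ u v, G.graph.Adj u v → G.weight u v ≤ W) (hWinf : W ≤ E.inf)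
    (hv : s.var .v < n) (hdv : s.var .dv = s.arr .dist (s.var .v))
    (hlast : s.arr .dist (s.var .v) = s.arr .bd 1)
    (hg : s.var .g = A.deg (s.var .v)) (hk : s.var .k = 0)
    (hbound : s.arr .dist (s.var .v) + W ≤ s.arr .st 1 * W)
    (hD : s.Dijkstra A src W E.top E.inf (Function.update A.deg (s.var .v) 0)) :
    Computes w A E relaxEdges s fun k s' =>
      s'.Dijkstra A src W E.top E.inf A.deg ∧ s'.arr .st 1 = s.arr .st 1 ∧
      (∀ v, 1 ≤ s'.arr .bk v ↔ 1 ≤ s.arr .bk v) ∧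
      k + 52 * levelSum n (s'.arr .bk) ≤
        52 * levelSum n (s.arr .bk) + 22 * A.deg (s.var .v) + 1 := by
  have hmem := hE.mem
  have hst := hE.stride_eq
  have hinf := hE.inf_lt
  refine .mono (.loop (RelaxPost A src W E.top E.inf s)
    (fun s' => 52 * levelSum n (s'.arr .bk) + 22 * (A.deg (s.var .v) - s'.var .k)) ?_ ?_) ?_
  · exact ⟨.refl _ _ _, by rwa [hk], by omega, fun _ => Iff.rfl, rfl, rfl⟩
  · intro s₁ h ht
    have hv₁ : s₁.var .v = s.var .v := h.frame.var _ (by decide)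
    have hdv₁ : s₁.var .dv = s.var .dv := h.frame.var _ (by decide)
    have hg₁ : s₁.var .g = s.var .g := h.frame.var _ (by decide)
    have hbd₁ : s₁.arr .bd = s.arr .bd := h.frame.arr _ (by decide)
    obtain ⟨hL₁, hB₁, hK₁, hT₁⟩ := h.dijkstra
    have hd₁ := h.dist_eq
    simp [hg₁, hg] at ht
    have hdeg := A.deg_le (s.var .v)
    set v := s.var .v with hvdef
    obtain ⟨hu, hadj, hwt⟩ := A.nbr_spec hv ht
    have hwW := hW _ _ hadj
    rw [hwt] at hwW
    have hinfv := hK₁.le_inf v hv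
    set u := A.nbr v (s₁.var .k) with hudef
    set x := A.wt v (s₁.var .k) with hxdef
    refine .seq (.block hE.toFits ?_ (.seq (.ite ?_ ?_)))
    · simp [hv₁, hdv₁, hdv, ← hudef, ← hxdef]
      omega
    · intro hlt
      simp [hv₁, hdv₁, hdv, ← hudef, ← hxdef] at hlt
      rw [← hd₁, add_comm] at hlt
      -- A settled vertex has a key of at most `bd 1`, the key of `v`, which a path through `v`
      -- cannot improve.
      have hbu : 1 ≤ s₁.arr .bk u := by
        by_contra h0
        have := hK₁.le_last u hu (by omega)
        rw [hbd₁] at this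
        omega
      have hK₂ := hK₁.decrease (u := u) (x := s₁.arr .dist v + x) hlt (by rw [hbd₁]; omega)
      have hT₂ := hT₁.relax hW hv ht hlt (hK₁.le_inf u hu)
        (fun z hz h0 => by
          have := hK₁.le_last z hz h0
          rw [hbd₁] at this
          omega)
        (by rw [h.st_one, hd₁]; exact hbound)
      have hup := hK₂.upper u hu hbu
      rw [Function.update_self] at hup
      refine .seq (.block hE.toFits (by simp [hv₁, ← hudef]; omega)
        (.mono (computes_sink hE.toFits hst ?_ ?_ ?_ ?_ ?_) ?_))
      · simpa [Store.Leveled] using hL₁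
      · simpa [hv₁, ← hudef] using hu
      · simpa [hv₁, ← hudef] using hbu
      · simp [hv₁, hdv₁, hdv, ← hxdef, hbd₁]
        omega
      · simp [hv₁, hdv₁, hdv, ← hudef, ← hxdef]
        rwa [← hd₁, add_comm x]
      · rintro k₂ s₂ ⟨h₂, hlow, hcost⟩
        have hsunk := h₂.sunk
        have hpos := h₂.pos
        have hup₂ := h₂.upper
        simp [hv₁, hdv₁, hdv, ← hudef, ← hxdef] at hsunk hpos hup₂ hlow hcost
        rw [← hd₁, add_comm x] at hup₂ hlow
        have hframe : Frame [.u, .x, .y, .k, .j, .b, .q, .a] [.dist, .ord, .pos, .bk, .st]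
            s s₂ := by
          refine h.frame.trans (V' := [.u, .x, .j, .b, .q, .a, .y])
            (B' := [.dist, .ord, .pos, .bk, .st]) ⟨?_, ?_⟩
          · intro z hz
            have := h₂.frame.var z
            simp at hz this
            rw [this] <;> simp [hz]
          · intro z hz
            have := h₂.frame.arr z
            simp at hz this
            rw [this] <;> simp [hz]
        have hk₂ : s₂.var .k = s₁.var .k := by
          rw [h₂.frame.var _ (by decide)]
          simp
        have hdist₂ : s₂.arr .dist =
            Function.update (s₁.arr .dist) u (s₁.arr .dist v + x) := by
          rw [h₂.frame.arr _ (by decide)]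
          simp [hv₁, hdv₁, hdv, ← hudef, ← hxdef]
          rw [← hd₁, add_comm x]
        have hbd₂ : s₂.arr .bd = s₁.arr .bd := by
          rw [h₂.frame.arr _ (by decide)]
          simp
        have hne : v ≠ u := by
          intro e
          rw [← e] at hlt
          omega
        have hls := hsunk.levelSum_le
        refine .block hE.toFits (by simp [hk₂]; omega) ⟨⟨⟨?_, ?_⟩, ⟨?_, ?_, ?_, ?_⟩, ?_, ?_, ?_, ?_⟩, ?_⟩
        · intro z hz
          have := hframe.var z hz
          simp at hz
          simp [hz, this]
        · intro z hz
          simpa using hframe.arr z hz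
        · simpa [Store.Leveled] using h₂.leveled
        · simpa [hbd₂] using hB₁
        · simp [hbd₂, hdist₂]
          refine (hK₂.sunk hsunk hpos ?_ ?_).mono_exempt (by simp)
          · simpa using hlow
          · simpa using hup₂
        · simp [hdist₂, hk₂]
          rw [hsunk.st_below 1 hpos]
          exact hT₂.congr (hsunk.bk_pos_iff hpos)
        · simp [hk₂]
          omega
        · intro z
          simp
          exact (hsunk.bk_pos_iff hpos z).trans (h.settled_iff z)
        · simp
          rw [hsunk.st_below 1 hpos, h.st_one]
        · simp [hdist₂]
          rw [Function.update_of_ne hne, hd₁]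
        · simp [hk₂]
          omega
    · intro hlt
      simp [hv₁, hdv₁, hdv, ← hudef, ← hxdef] at hlt
      rw [← hd₁, add_comm] at hlt
      refine .block hE.toFits (by simp) (.block hE.toFits (by simp; omega)
        ⟨⟨⟨?_, ?_⟩, ⟨?_, ?_, ?_, ?_⟩, ?_, ?_, ?_, ?_⟩, ?_⟩)
      · intro z hz
        have := h.frame.var z hz
        simp at hz
        simp [hz, this]
      · intro z hz
        simpa using h.frame.arr z hz
      · simpa [Store.Leveled] using hL₁
      · simpa using hB₁
      · simpa using hK₁
      · simpa using hT₁.skip hlt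
      · simp
        omega
      · simpa using h.settled_iff
      · simpa using h.st_one
      · simpa using h.dist_eq
      · simp
        omega
  · rintro k s' ⟨h, hlt, hk'⟩
    have hg' : s'.var .g = s.var .g := h.frame.var _ (by decide)
    have h₁ := h.k_le
    simp [hg', hg, hk] at hlt hk' ⊢
    have h₂ := h.dijkstra
    rw [le_antisymm h₁ hlt, Function.update_eq_self] at h₂
    exact ⟨h₂, h.st_one, h.settled_iff, by omega⟩

/-- A sum over the vertices that are not yet settled. -/
def unsettledSum (n : ℕ) (f bk : ℕ → ℕ) : ℕ :=
  ∑ v ∈ Finset.range n, if 1 ≤ bk v then f v else 0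

theorem unsettledSum_congr {f bk bk' : ℕ → ℕ} (h : ∀ v, 1 ≤ bk' v ↔ 1 ≤ bk v) :
    unsettledSum n f bk' = unsettledSum n f bk := by
  simp only [unsettledSum, h]

theorem unsettledSum_settle {f bk : ℕ → ℕ} {u : ℕ} (hu : u < n) (h : 1 ≤ bk u) :
    unsettledSum n f (Function.update bk u 0) + f u = unsettledSum n f bk := by
  unfold unsettledSum
  have hu' : u ∈ Finset.range n := Finset.mem_range.2 hu
  rw [← Finset.add_sum_erase _ _ hu', ← Finset.add_sum_erase _ _ hu', Function.update_self,
    Finset.sum_congr rfl fun v hv => by rw [Function.update_of_ne (Finset.ne_of_mem_erase hv)]]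
  simp [h]
  omega

theorem unsettledSum_le (f bk : ℕ → ℕ) : unsettledSum n f bk ≤ ∑ v ∈ Finset.range n, f v := by
  refine Finset.sum_le_sum fun v _ => ?_
  split_ifs <;> simp

/-- Level 1 has width at most one, so each of its vertices has the key `bd 1`. Settling one is a
single descent to level 0, which also raises `st 1`, the number of settled vertices. The function
`f` is a budget per vertex, released when the vertex is settled. -/
theorem computes_settleNext (hE : E.Good n w) {src : Fin n} {W : ℕ}
    (hW : ∀ u v, G.graph.Adj u v → G.weight u v ≤ W) (hWinf : (n + 1) * W < E.inf)
    (hne : s.arr .st 1 < s.arr .st 2) (hi : s.arr .st 1 < n)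
    (hfin : ∀ v < n, s.arr .bk v = 1 → s.arr .dist v < E.inf)
    (hD : s.Dijkstra A src W E.top E.inf A.deg) (f : ℕ → ℕ) :
    Computes w A E settleNext s fun k s' =>
      s'.Dijkstra A src W E.top E.inf A.deg ∧
      ∃ v, k + 52 * levelSum n (s'.arr .bk) + unsettledSum n f (s'.arr .bk) + f v ≤
        52 * levelSum n (s.arr .bk) + unsettledSum n f (s.arr .bk) + 22 * A.deg v + 40 := by
  have hmem := hE.mem
  have hst := hE.stride_eq
  have htop := hE.top_ge
  obtain ⟨hL, hB, hK, hT⟩ := hD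
  have hL' := hL
  unfold Store.Leveled at hL
  have hu := hL.ord_lt _ hi
  set u := s.arr .ord (s.arr .st 1) with hudef
  have hpu : s.arr .pos u = s.arr .st 1 := hL.pos_ord _ hi
  have hbu : s.arr .bk u = 1 := by
    refine hL.bk_eq hu (by omega) ?_ ?_ <;> rw [hpu]
    exact hne
  have hlast : s.arr .dist u = s.arr .bd 1 := by
    have h₁ := hK.last_le u hu (by omega)
    have h₂ := hK.upper u hu (by omega) (by omega)
    rw [hbu] at h₂
    have h₃ : s.arr .dist u < s.arr .bd 2 := h₂
    have h₄ := hB.width_one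
    omega
  have hbound := hT.bound u hu (hfin u hu hbu)
  have hWinf' : W ≤ E.inf := by
    have : W ≤ (n + 1) * W := Nat.le_mul_of_pos_left _ (by omega)
    omega
  have hd := hL.descend hu (by omega)
  have hls := levelSum_update (n := n) (bk := s.arr .bk) hu (by omega)
  have hus := unsettledSum_settle (f := f) (bk := s.arr .bk) hu (by omega)
  have hkeys := hK.settle hlast.le
  have htree := hT.settle u
  rw [hpu, hbu, ← hudef] at hd
  rw [hbu] at hls
  refine .seq (.block hE.toFits ?_ (.mono (computes_relaxEdges hE hW hWinf' (src := src)
    ?_ ?_ ?_ ?_ ?_ ?_ ?_) ?_))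
  · simp [descendOps, ← hudef, hpu]
    omega
  · simpa [descendOps, ← hudef]
  · simp [descendOps, ← hudef]
  · simpa [descendOps, ← hudef]
  · simp [descendOps, ← hudef]
  · simp [descendOps, ← hudef]
  · simp [descendOps, ← hudef]
    rw [Nat.succ_mul]
    omega
  · refine ⟨?_, ?_, ?_, ?_⟩
    · simpa [descendOps, ← hudef, Store.Leveled, hpu] using hd
    · simpa [descendOps] using hB
    · simpa [descendOps, ← hudef] using hkeys
    · simpa [descendOps, ← hudef] using htree
  · rintro k s' ⟨h₁, h₂, h₃, h₄⟩
    refine ⟨h₁, u, ?_⟩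
    have h₅ := unsettledSum_congr (n := n) (f := f) h₃
    simp [descendOps, ← hudef] at h₄ h₅ hls
    simp [descendOps]
    omega

/-- All vertices start on the top level with infinite keys, which is consistent. Then the key of the
source becomes 0, and sinking the source ends its exemption. -/
theorem computes_initHeap (hE : E.Good n w) {src : Fin n} (hsrc : E.src = src) (W : ℕ)
    (harr : s.arr = fun _ _ => 0) :
    Computes w A E initHeap s fun k s' =>
      s'.Dijkstra A src W E.top E.inf A.deg ∧ levelSum n (s'.arr .bk) ≤ n * E.top ∧
      k + 24 * levelSum n (s'.arr .bk) ≤ 24 * (n * E.top) + 11 * n + 25 := by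
  have hmem := hE.mem
  have hst := hE.stride_eq
  have hinf := hE.inf_lt
  have htop := hE.top_ge
  have hslt := hE.src_lt
  have hinf0 : 0 < E.inf := by rw [hE.inf_eq]; positivity
  refine .seq (.block hE.toFits (by simp) ?_)
  refine .seq (.mono (.loop (fun s' => s'.var .i ≤ n ∧
      (∀ v < s'.var .i, s'.arr .dist v = E.inf ∧ s'.arr .pos v = v ∧ s'.arr .ord v = v ∧
        s'.arr .bk v = E.top) ∧ s'.arr .st = (fun _ => 0) ∧ s'.arr .bd = fun _ => 0)
      (fun s' => 11 * (n - s'.var .i)) ?_ ?_) ?_)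
  · simp [harr]
  · rintro s₁ ⟨hi, hv, hs, hb⟩ ht
    simp at ht
    refine .block hE.toFits (by simp; omega) ⟨⟨?_, ?_, ?_, ?_⟩, ?_⟩
    · simp; omega
    · intro v hlt
      simp at hlt
      rcases hlt.lt_or_eq with hlt | rfl
      · have := hv v hlt
        simp [Function.update_of_ne hlt.ne, this]
      · simp
    · simpa using hs
    · simpa using hb
    · simp
      omega
  rintro k₁ s₁ ⟨⟨hi, hv, hs, hb⟩, hlt, hk₁⟩
  simp at hlt hk₁
  rw [le_antisymm hi hlt] at hv
  have hls : ∀ v, v < n → s₁.arr .bk v = E.top := fun v h => (hv v h).2.2.2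
  have hL : Buckets n E.top (s₁.arr .ord) (s₁.arr .pos) (s₁.arr .bk)
      (Function.update (s₁.arr .st) (E.top + 1) (n + 1)) := by
    have h₁ : ∀ j ≤ E.top, Function.update (s₁.arr .st) (E.top + 1) (n + 1) j = 0 := by
      intro j hj
      rw [Function.update_of_ne (by omega), hs]
    constructor
    · intro v h
      rw [(hv v h).2.1]
      exact h
    · intro v h
      rw [(hv v h).2.2.1]
      exact h
    · intro v h
      rw [(hv v h).2.1, (hv v h).2.2.1]
    · intro v h
      rw [(hv v h).2.2.1, (hv v h).2.1]
    · intro v h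
      rw [hls v h]
    · intro v h
      rw [hls v h, h₁ _ le_rfl]
      exact Nat.zero_le _
    · intro v h
      rw [hls v h, (hv v h).2.1, Function.update_self]
      omega
    · intro j hj
      rw [h₁ j hj]
      exact Nat.zero_le _
    · exact h₁ 0 (by omega)
    · rw [h₁ _ le_rfl]
      exact Nat.zero_le _
    · rw [Function.update_self]
  have hB : Bounds E.top E.inf (Function.update (s₁.arr .bd) E.top E.inf) := by
    have h₁ : ∀ j < E.top, Function.update (s₁.arr .bd) E.top E.inf j = 0 := by
      intro j hj
      rw [Function.update_of_ne (by omega), hb]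
    constructor
    · intro j h₂ h₃
      rw [h₁ j h₃]
      exact Nat.zero_le _
    · rw [Function.update_self]
    · rw [h₁ 2 (by omega)]
      exact Nat.zero_le _
    · intro j h₂ h₃
      -- Initially level `K - 1` covers all finite keys. Its allowed width `2 ^ (K - 3)` is the
      -- reason for the value of `inf`.
      by_cases h₄ : j + 1 = E.top
      · rw [h₄, Function.update_self, hE.inf_eq, show E.top - 3 = j - 2 by omega]
        exact Nat.le_add_left _ _
      · rw [h₁ (j + 1) (by omega)]
        exact Nat.zero_le _
  have hbd1 : Function.update (s₁.arr .bd) E.top E.inf 1 = 0 := by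
    rw [Function.update_of_ne (by omega), hb]
  have hK : Keys n E.top E.inf (Function.update (s₁.arr .dist) E.src 0) (s₁.arr .bk)
      (Function.update (s₁.arr .bd) E.top E.inf) {E.src} := by
    constructor
    · intro v h h₁ h₂
      rw [hls v h] at h₂
      omega
    · intro v h h₁ h₂
      rw [Function.update_of_ne h₂, (hv v h).1, hls v h, Function.update_self]
    · intro v h h₁
      rw [hbd1]
      exact Nat.zero_le _
    · intro v h h₁
      rw [hls v h] at h₁
      omega
    · intro v h
      rw [Function.update_apply]
      split_ifs
      · exact Nat.zero_le _
      · exact (hv v h).1.le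
  have hsum : levelSum n (s₁.arr .bk) = n * E.top := by
    unfold levelSum
    rw [Finset.sum_congr rfl fun v h => hls v (Finset.mem_range.1 h)]
    simp
  have hbs := hls E.src hslt
  refine .seq (.block hE.toFits (by simp; omega)
    (.mono (computes_sink hE.toFits hst ?_ ?_ ?_ ?_ ?_) ?_))
  · simpa [Store.Leveled] using hL
  · simpa using hslt
  · simp [hbs]
    omega
  · simp [hbd1]
  · simp [hbs]
  · rintro k₂ s₂ ⟨h₂, hlow, hcost⟩
    have hsunk := h₂.sunk
    have hpos := h₂.pos
    have hup₂ := h₂.upper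
    have hdist₂ := h₂.frame.arr .dist (by decide)
    have hbd₂ := h₂.frame.arr .bd (by decide)
    simp at hsunk hpos hup₂ hlow hcost hdist₂ hbd₂
    have hls₂ := hsunk.levelSum_le
    have hiff := hsunk.bk_pos_iff hpos
    refine ⟨⟨h₂.leveled, ?_, ?_, ⟨?_, ?_, ?_, ?_⟩⟩, ?_, ?_⟩
    · rwa [hbd₂]
    · rw [hbd₂, hdist₂]
      refine (hK.sunk hsunk hpos ?_ ?_).mono_exempt (by simp)
      · rw [Function.update_self]
        exact hlow.le
      · rw [Function.update_self]
        exact hup₂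
    · intro v h
      rw [hdist₂, Function.update_apply] at h ⊢
      split_ifs at h ⊢ with e
      · have : v = src := Fin.ext (e.trans hsrc)
        subst this
        exact .nil v
      · have := (hv v v.2).1
        omega
    · intro v h h'
      rw [hdist₂, Function.update_apply] at h' ⊢
      split_ifs at h' ⊢ with e
      · exact Nat.zero_le _
      · have := (hv v h).1
        omega
    · rw [hdist₂, ← hsrc, Function.update_self]
    · intro v h h₁
      have := (hiff v).2 (by rw [hls v h]; omega)
      omega
    · omega
    · simp
      omega

/-- The number of edges. -/
def AdjLists.size (A : AdjLists G) : ℕ := ∑ v ∈ Finset.range n, A.deg v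

/-- The potential of a vertex that is not yet settled. -/
def vertexCost (A : AdjLists G) (K v : ℕ) : ℕ := 23 * K + 22 * A.deg v + 100

theorem sum_vertexCost (A : AdjLists G) (K : ℕ) :
    ∑ v ∈ Finset.range n, vertexCost A K v = 23 * (n * K) + 22 * A.size + 100 * n := by
  simp only [vertexCost, Finset.sum_add_distrib, Finset.sum_const, Finset.card_range,
    ← Finset.mul_sum, AdjLists.size, smul_eq_mul]
  ring

/-- The time needed for one run of Dijkstra's algorithm. -/
theorem computes_dijkstra (hE : E.Good n w) {src : Fin n} (hsrc : E.src = src) {W : ℕ}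
    (hW : ∀ u v, G.graph.Adj u v → G.weight u v ≤ W) (hWinf : (n + 1) * W < E.inf)
    (harr : s.arr = fun _ _ => 0) :
    Computes w A E dijkstra s fun k s' =>
      (∀ t : Fin n, G.dist src t =
        if s'.arr .dist t = E.inf then ⊤ else (s'.arr .dist t : ℕ∞)) ∧
      k ≤ 75 * (n * E.top) + 22 * A.size + 111 * n + 8 * E.top + 50 := by
  have htop := hE.top_ge
  have hinf0 : 0 < E.inf := by rw [hE.inf_eq]; positivity
  refine .seq (.mono (computes_initHeap hE hsrc W harr) ?_)
  rintro k₁ s₁ ⟨h₁, hls₁, hc₁⟩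
  refine .seq (.mono (computes_scan hE h₁.leveled) ?_)
  rintro k₂ s₂ ⟨hp₂, hne₂, hfirst₂, hc₂⟩
  have harr₂ : s₂.arr = s₁.arr := funext fun k => hp₂.frame.arr k (by simp)
  rw [← harr₂] at hne₂ hfirst₂ hc₁ hls₁
  refine .mono (.loop (fun s => s.Dijkstra A src W E.top E.inf A.deg ∧
      1 ≤ s.var .i ∧ s.arr .st (s.var .i) < s.arr .st (s.var .i + 1) ∧
      ∀ v < n, 1 ≤ s.arr .bk v → s.var .i ≤ s.arr .bk v)
    (fun s => 52 * levelSum n (s.arr .bk) + unsettledSum n (vertexCost A E.top) (s.arr .bk))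
    ⟨h₁.congr harr₂, hp₂.ge, hne₂, hfirst₂⟩ ?_) ?_
  · rintro s ⟨hD, hi, hne, hfirst⟩ ht
    simp at ht
    -- Both branches lead to a nonempty level 1, with `k₀` steps spent so far. From then on a round
    -- is the same. Its cost `15 * K` for new bounds and `8 * K` for scanning is covered by the `23
    -- * K` in `vertexCost`.
    have key : ∀ (s' : Store) (k₀ : ℕ), s'.Dijkstra A src W E.top E.inf A.deg →
        s'.arr .st 1 < s'.arr .st 2 →
        (∀ v, 1 ≤ s'.arr .bk v ↔ 1 ≤ s.arr .bk v) →
        k₀ + 52 * levelSum n (s'.arr .bk) ≤ 52 * levelSum n (s.arr .bk) + 15 * E.top + 36 →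
        Computes w A E (settleNext ;; scan) s' fun k s' =>
          (s'.Dijkstra A src W E.top E.inf A.deg ∧
            1 ≤ s'.var .i ∧ s'.arr .st (s'.var .i) < s'.arr .st (s'.var .i + 1) ∧
            ∀ v < n, 1 ≤ s'.arr .bk v → s'.var .i ≤ s'.arr .bk v) ∧
          k₀ + k + 1 + (52 * levelSum n (s'.arr .bk) +
            unsettledSum n (vertexCost A E.top) (s'.arr .bk)) ≤
          52 * levelSum n (s.arr .bk) + unsettledSum n (vertexCost A E.top) (s.arr .bk) := by
      intro s' k₀ hD' hne' hiff hc
      have hi' : s'.arr .st 1 < n := by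
        have := hD'.leveled.st_mono (i := 2) (j := E.top) (by omega) (by omega)
        have := hD'.leveled.st_le_size
        omega
      refine .seq (.mono (computes_settleNext hE hW hWinf hne' hi' ?_ hD'
        (vertexCost A E.top)) ?_)
      · intro v hv hb
        have h₃ := hD'.keys.upper v hv (by omega) (by omega)
        have h₄ := hD'.bounds.mono_le (i := 2) (j := E.top) (by omega) (by omega) le_rfl
        rw [hb] at h₃
        rw [hD'.bounds.top] at h₄
        exact h₃.trans_le h₄
      · rintro k₃ s₃ ⟨hD₃, v, hc₃⟩
        refine .mono (computes_scan hE hD₃.leveled) ?_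
        rintro k₄ s₄ ⟨hp₄, hne₄, hfirst₄, hc₄⟩
        have harr₄ : s₄.arr = s₃.arr := funext fun k => hp₄.frame.arr k (by simp)
        rw [← harr₄] at hne₄ hfirst₄ hc₃
        refine ⟨⟨hD₃.congr harr₄, hp₄.ge, hne₄, hfirst₄⟩, ?_⟩
        have h₅ := unsettledSum_congr (n := n) (f := vertexCost A E.top) hiff
        rw [show vertexCost A E.top v = 23 * E.top + 22 * A.deg v + 100 from rfl] at hc₃
        omega
    refine .seq (.ite ?_ ?_)
    · intro hlt
      simp at hlt
      refine .mono (computes_redistribute hE hD.leveled hD.bounds hD.keys ht hlt hne hfirst) ?_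
      rintro k₃ s₃ ⟨h₃, hc₃⟩
      refine key s₃ (k₃ + 1) ⟨h₃.leveled, h₃.bounds, ?_, ?_⟩ h₃.nonempty h₃.settled_iff (by omega)
      · rw [h₃.frame.arr .dist (by decide)]
        exact h₃.keys
      · rw [h₃.frame.arr .dist (by decide), h₃.st_one]
        exact hD.tree.congr h₃.settled_iff
    · intro hlt
      simp at hlt
      rw [show s.var .i = 1 by omega] at hne
      exact .block hE.toFits (by simp) (key s 2 hD hne (fun _ => Iff.rfl) (by omega))
  · rintro k s' ⟨⟨hD, hi, hne, hfirst⟩, hlt, hk⟩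
    simp at hlt
    constructor
    · refine hD.tree.dist_eq hinf0 ?_ hW ?_ hD.keys.le_inf
      · intro v hv h
        by_contra h0
        -- The loop ends with `i = K`, so an unsettled vertex is on level `K` and its key is
        -- infinite.
        have h₃ := hfirst v hv (by omega)
        have h₄ := hD.keys.lower v hv (by omega) (by simp)
        have h₅ := hD.leveled.bk_le v hv
        rw [show s'.arr .bk v = E.top by omega, hD.bounds.top] at h₄
        omega
      -- The count `st 1` of settled vertices is at most `n`, so no finite distance plus an edge
      -- weight reaches `inf`.
      · have h₃ := hD.leveled.st_mono (i := 1) (j := E.top) (by omega) (by omega)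
        have h₄ := hD.leveled.st_le_size
        exact lt_of_le_of_lt (Nat.mul_le_mul_right W (by omega)) hWinf
    · have h₃ := unsettledSum_le (n := n) (vertexCost A E.top) (s₂.arr .bk)
      rw [sum_vertexCost] at h₃
      omega

end APSD

/-! ### Clearing memory and computing the parameters. -/

namespace APSD

variable {n : ℕ} {G : WeightedGraph n} {w : ℕ} {A : AdjLists G} {E : Env}

/-! ### Initialization of the working memory -/

/-- Set up the arrays, with all entries 0. -/
def prepare : Program :=
  .instr (.move 24 22) ;; .instr (.add 25 24 23) ;; .instr (.add 26 25 23) ;;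
  .instr (.add 27 26 23) ;; .instr (.add 28 27 23) ;; .instr (.add 29 28 23) ;;
  .instr (.add 32 29 23) ;; .instr (.move 30 22) ;; .instr (.sub 31 17 17) ;;
  .while (.lt 30 32) (.instr (.store 30 31) ;; .instr (.add 30 30 17))

theorem Arr.exists_idx {q : ℕ} (h : q < 6) : ∃ k : Arr, k.idx = q := by
  interval_cases q
  exacts [⟨.dist, rfl⟩, ⟨.pos, rfl⟩, ⟨.ord, rfl⟩, ⟨.bk, rfl⟩, ⟨.st, rfl⟩, ⟨.bd, rfl⟩]

theorem Env.exists_addr {a : ℕ} (h₁ : E.base ≤ a) (h₂ : a < E.base + 6 * E.stride) :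
    ∃ k i, i < E.stride ∧ a = E.addr k i := by
  have hpos : 0 < E.stride := by omega
  obtain ⟨k, hk⟩ := Arr.exists_idx (q := (a - E.base) / E.stride)
    (Nat.div_lt_of_lt_mul (by rw [mul_comm]; omega))
  refine ⟨k, (a - E.base) % E.stride, Nat.mod_lt _ hpos, ?_⟩
  have := Nat.div_add_mod' (a - E.base) E.stride
  unfold Env.addr
  rw [hk]
  omega

/-- The state after the registers have been set and the memory up to address `a` has been cleared. -/
structure Clearing (w : ℕ) (E : Env) (n : ℕ) (σ : State) (a : ℕ) : Prop where
  par : ∀ p : Param, σ.reg p.reg = E.par n p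
  lt : ∀ r, σ.reg r < 2 ^ w
  ptr : ∀ k : Arr, σ.reg k.reg = E.addr k 0
  zero : σ.reg 31 = 0
  limit : σ.reg 32 = E.base + 6 * E.stride
  ge : E.base ≤ a
  le : a ≤ E.base + 6 * E.stride
  mem : ∀ x, σ.mem x = if E.base ≤ x ∧ x < a then some 0 else none

theorem runs_prepare {r : ℕ → ℕ} (hpar : ∀ p : Param, r p.reg = E.par n p)
    (hlt : ∀ x, r x < 2 ^ w) (hmem : E.base + 6 * E.stride < 2 ^ w) :
    Runs w A prepare ⟨r, fun _ => none⟩ fun k τ =>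
      ∃ s, Sim w E n τ s ∧ s.arr = (fun _ _ => 0) ∧ k ≤ 18 * E.stride + 10 := by
  have hbase : r 22 = E.base := hpar .base
  have hstride : r 23 = E.stride := hpar .stride
  have hone : r 17 = 1 := hpar .one
  have h1 := hlt 17
  rw [hone] at h1
  refine .seq_move (v := E.base) (by simp [hbase]) (by omega) ?_
  refine .seq_add (v := E.base + E.stride) (by simp [hstride]) (by omega) ?_
  refine .seq_add (v := E.base + 2 * E.stride) (by simp [hstride]; omega) (by omega) ?_
  refine .seq_add (v := E.base + 3 * E.stride) (by simp [hstride]; omega) (by omega) ?_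
  refine .seq_add (v := E.base + 4 * E.stride) (by simp [hstride]; omega) (by omega) ?_
  refine .seq_add (v := E.base + 5 * E.stride) (by simp [hstride]; omega) (by omega) ?_
  refine .seq_add (v := E.base + 6 * E.stride) (by simp [hstride]; omega) (by omega) ?_
  refine .seq_move (v := E.base) (by simp [hbase]) (by omega) ?_
  refine .seq_sub (v := 0) (by simp) (by omega) ?_
  refine .mono (.loop (fun σ => Clearing w E n σ (σ.reg 30))
    (fun σ => 3 * (E.base + 6 * E.stride - σ.reg 30)) ?_ ?_) ?_
  · constructor
    · intro p
      have := hpar p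
      cases p <;> simpa [Param.reg] using this
    · intro x
      simp only [Function.update_apply]
      split_ifs <;> first | omega | exact hlt x
    · intro k
      cases k <;> simp [Arr.reg, Arr.idx, Env.addr]
    · simp
    · simp
    · simp
    · simp
    · intro x
      simp
  · intro σ h ht
    have hone' : σ.reg 17 = 1 := h.par .one
    simp only [Cond.Holds, h.limit] at ht
    have hmod : (σ.reg 30 + 1) % 2 ^ w = σ.reg 30 + 1 := Nat.mod_eq_of_lt (by omega)
    refine .seq (.instr rfl (.instr rfl ⟨?_, ?_⟩))
    · have hcur : (((σ.setMem (σ.reg 30) (σ.reg 31)).setReg w 30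
          ((σ.setMem (σ.reg 30) (σ.reg 31)).reg 30 + (σ.setMem (σ.reg 30) (σ.reg 31)).reg 17))).reg
          30 = σ.reg 30 + 1 := by
        simp [State.setReg, State.setMem, hone', hmod]
      rw [hcur]
      constructor
      · intro p
        have := h.par p
        cases p <;> simpa [State.setReg, State.setMem, Param.reg] using this
      · intro x
        simp only [State.setReg, State.setMem, Function.update_apply]
        split_ifs
        · exact Nat.mod_lt _ (by positivity)
        · exact h.lt x
      · intro k
        have := h.ptr k
        cases k <;> simpa [State.setReg, State.setMem, Arr.reg, Arr.idx] using this
      · simpa [State.setReg, State.setMem] using h.zero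
      · simpa [State.setReg, State.setMem] using h.limit
      · have := h.ge
        omega
      · omega
      · intro x
        have := h.ge
        simp only [State.setReg, State.setMem, Function.update_apply, h.mem, h.zero]
        split_ifs <;> first | rfl | omega
    · simp [State.setReg, State.setMem, hone', hmod]
      omega
  · rintro k τ ⟨h, hlt', hk⟩
    have hcur : τ.reg 30 = E.base + 6 * E.stride := by
      simp only [Cond.Holds, h.limit] at hlt'
      have := h.le
      omega
    refine ⟨⟨fun x => τ.reg x.reg, fun _ _ => 0⟩, ?_, rfl, ?_⟩
    · constructor
      · exact h.par
      · intro p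
        rw [← h.par]
        exact h.lt _
      · exact fun _ => rfl
      · exact fun x => h.lt _
      · exact h.ptr
      · intro k i hi
        have := Env.addr_lt (k := k) hi
        rw [h.mem, if_pos ⟨by unfold Env.addr; omega, by omega⟩]
      · intro k i _
        positivity
      · intro a ha
        rw [h.mem, if_neg]
        rintro ⟨h₁, h₂⟩
        obtain ⟨k, i, hi, e⟩ := Env.exists_addr h₁ (hcur ▸ h₂)
        exact ha k i hi e
    · simp at hk
      omega

/-! ### Parameters -/

/-- The number of levels of the heap. -/
def topLevel (c n : ℕ) : ℕ := (c + 2) * Nat.size n + 3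

/-- A number greater than all finite distances. -/
def infinity (c n : ℕ) : ℕ := 2 ^ ((c + 2) * Nat.size n)

/-- The number of steps of a run between two outputs. -/
def period (c : ℕ) (A : AdjLists G) : ℕ := 512 * (topLevel c n + A.size / n + 1)

/-- Compute the number of levels `k`, infinity `y`, the stride `g` and the period `e`. -/
def prelude (c : ℕ) : Program :=
  block [.move .x Param.one, .move .y Param.one, .const .k 3, .const .i 0, .const .g (c + 2),
    .add .b Param.size Param.one] ;;
  .while (Test.lt Var.x Var.b).compile
    (block [.add .x Var.x Var.x, .add .i Var.i Param.one, .const .j 0] ;;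
    .while (Test.lt Var.j Var.g).compile
      (block [.add .y Var.y Var.y, .add .k Var.k Param.one, .add .j Var.j Param.one])) ;;
  block [.const .v 0, .move .p Param.one] ;;
  .while (Test.lt Var.v Param.size).compile
    (block [.degree .g Var.v, .add .p Var.p Var.g, .add .v Var.v Param.one]) ;;
  block [.const .e 0] ;;
  .while (Test.lt Param.size Var.p).compile
    (block [.sub .p Var.p Param.size, .add .e Var.e Param.one]) ;;
  block [.add .e Var.e Var.k, .add .e Var.e Param.one, .add .e Var.e Var.e, .add .e Var.e Var.e,
    .add .e Var.e Var.e, .add .e Var.e Var.e, .add .e Var.e Var.e, .add .e Var.e Var.e,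
    .add .e Var.e Var.e, .add .e Var.e Var.e, .add .e Var.e Var.e,
    .add .g Param.size Var.k, .add .g Var.g Param.one, .add .g Var.g Param.one]

theorem size_lt_infinity (c : ℕ) : n < infinity c n := by
  refine (Nat.lt_size_self n).trans_le (Nat.pow_le_pow_right (by norm_num) ?_)
  exact Nat.le_mul_of_pos_left _ (by omega)

theorem sq_size_lt_infinity (c : ℕ) : n * n < infinity c n := by
  have h := Nat.lt_size_self n
  calc n * n < 2 ^ Nat.size n * 2 ^ Nat.size n := Nat.mul_lt_mul'' h h
    _ = 2 ^ (2 * Nat.size n) := by rw [two_mul, pow_add]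
    _ ≤ infinity c n := Nat.pow_le_pow_right (by norm_num) (Nat.mul_le_mul_right _ (by omega))

theorem size_pos (hn : 1 ≤ n) : 1 ≤ Nat.size n := Nat.size_pos.2 hn

theorem lt_infinity (c : ℕ) (hn : 1 ≤ n) : c + 2 < infinity c n :=
  Nat.lt_two_pow_self.trans_le (Nat.pow_le_pow_right (by norm_num)
    (Nat.le_mul_of_pos_right _ (size_pos hn)))

theorem topLevel_lt (c n : ℕ) : topLevel c n < 8 * infinity c n := by
  have : topLevel c n < 2 ^ topLevel c n := Nat.lt_two_pow_self
  rw [show 2 ^ topLevel c n = 8 * infinity c n by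
    rw [topLevel, pow_add, infinity, mul_comm]; norm_num] at this
  exact this

theorem AdjLists.size_le (A : AdjLists G) : A.size ≤ n * n := by
  have := Finset.sum_le_card_nsmul (Finset.range n) A.deg n fun v _ => A.deg_le v
  simpa [AdjLists.size] using this

theorem size_le_self (n : ℕ) : Nat.size n ≤ n := Nat.size_le.2 Nat.lt_two_pow_self

/-- The environment has stride 0, hence no arrays, so this phase uses no memory. Powers arise by
doubling, and the division by `n` by repeated subtraction takes at most `n` rounds because there are
at most `n * n` edges. So the time is linear in `n`. -/
theorem computes_prelude {c : ℕ} (hn : 1 ≤ n) (hw : 2 ^ 14 * infinity c n ≤ 2 ^ w) (s : Store) :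
    Computes w A ⟨0, 0, 0, 0, 0⟩ (prelude c) s fun k s' =>
      s'.var .k = topLevel c n ∧ s'.var .y = infinity c n ∧
      s'.var .g = n + topLevel c n + 2 ∧ s'.var .e = period c A ∧
      k ≤ (5 * c + 100) * n := by
  have hI := size_lt_infinity (n := n) c
  have hI2 := sq_size_lt_infinity (n := n) c
  have hc := lt_infinity c hn
  have htop := topLevel_lt c n
  have hsz := size_pos hn
  have hE : Env.Fits ⟨0, 0, 0, 0, 0⟩ n w := ⟨by simp, by omega⟩
  refine .seq (.block hE (by simp; omega) ?_)
  refine .seq (.mono (.loop (fun s' => s'.var .g = c + 2 ∧ s'.var .b = n + 1 ∧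
    s'.var .x = 2 ^ (s'.var .i) ∧ s'.var .i ≤ Nat.size n ∧
    s'.var .y = 2 ^ ((c + 2) * s'.var .i) ∧ s'.var .k = (c + 2) * s'.var .i + 3)
    (fun s' => (5 * c + 17) * (Nat.size n - s'.var .i)) ?_ ?_) ?_)
  · simp
  · rintro s₁ ⟨hg, hb, hx, hi, hy, hk⟩ ht
    simp [hx, hb] at ht
    have hi' : s₁.var .i < Nat.size n := Nat.lt_size.2 (by omega)
    have hpow : 2 ^ (s₁.var .i) ≤ infinity c n := by omega
    have hpow' : ∀ j ≤ c + 1, 2 ^ ((c + 2) * s₁.var .i + j) ≤ infinity c n := by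
      intro j hj
      refine Nat.pow_le_pow_right (by norm_num) ?_
      have : (c + 2) * (s₁.var .i + 1) ≤ (c + 2) * Nat.size n := Nat.mul_le_mul_left _ hi'
      rw [Nat.mul_succ] at this
      omega
    have htop' : (c + 2) * (s₁.var .i + 1) + 3 ≤ topLevel c n :=
      Nat.add_le_add_right (Nat.mul_le_mul_left _ hi') 3
    rw [Nat.mul_succ] at htop'
    have hsize := size_le_self n
    refine .seq (.block hE (by simp [hx]; omega) ?_)
    refine .mono (.loop (fun s' => s'.var .g = c + 2 ∧ s'.var .b = n + 1 ∧
      s'.var .x = 2 ^ (s₁.var .i + 1) ∧ s'.var .i = s₁.var .i + 1 ∧ s'.var .j ≤ c + 2 ∧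
      s'.var .y = 2 ^ ((c + 2) * s₁.var .i + s'.var .j) ∧
      s'.var .k = (c + 2) * s₁.var .i + s'.var .j + 3) (fun s' => 5 * (c + 2 - s'.var .j)) ?_ ?_) ?_
    · simp [hg, hb, hx, hy, hk, pow_succ]
      omega
    · rintro s₂ ⟨hg₂, hb₂, hx₂, hi₂, hj₂, hy₂, hk₂⟩ ht₂
      simp [hg₂] at ht₂
      have := hpow' (s₂.var .j) (by omega)
      refine .block hE (by simp [hy₂, hk₂]; omega) ⟨⟨?_, ?_, ?_, ?_, ?_, ?_, ?_⟩, ?_⟩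
      · simp [hg₂]
      · simp [hb₂]
      · simp [hx₂]
      · simp [hi₂]
      · simp; omega
      · simp [hy₂]
        rw [← add_assoc, pow_succ]
        omega
      · simp [hk₂]
        omega
      · simp
        omega
    · rintro k s₂ ⟨⟨hg₂, hb₂, hx₂, hi₂, hj₂, hy₂, hk₂⟩, ht₂, hcost⟩
      simp [hg₂] at ht₂ hcost
      have hj : s₂.var .j = c + 2 := by omega
      refine ⟨⟨hg₂, hb₂, by rw [hx₂, hi₂], by omega, ?_, ?_⟩, ?_⟩
      · rw [hy₂, hi₂, hj, Nat.mul_succ]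
      · rw [hk₂, hi₂, hj, Nat.mul_succ]
      · rw [hi₂]
        obtain ⟨d, hd⟩ : ∃ d, Nat.size n - s₁.var .i = d + 1 :=
          ⟨Nat.size n - s₁.var .i - 1, by omega⟩
        rw [hd, show Nat.size n - (s₁.var .i + 1) = d by omega, Nat.mul_succ]
        simp
        omega
  rintro k₁ s₁ ⟨⟨hg, hb, hx, hi, hy, hk⟩, ht, hc₁⟩
  have hi' : s₁.var .i = Nat.size n := by
    refine le_antisymm hi (not_lt.1 fun h => ?_)
    have := Nat.lt_size.1 h
    simp [hx, hb] at ht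
    omega
  rw [hi'] at hy hk
  have hsz' : (5 * c + 17) * Nat.size n ≤ (5 * c + 17) * n :=
    Nat.mul_le_mul_left _ (size_le_self n)
  simp at hc₁
  have hm := A.size_le
  refine .seq (.block hE (by simp) ?_)
  refine .seq (.mono (.loop (fun s' => s'.var .k = topLevel c n ∧ s'.var .y = infinity c n ∧
    s'.var .v ≤ n ∧ s'.var .p = 1 + ∑ v ∈ Finset.range (s'.var .v), A.deg v)
    (fun s' => 5 * (n - s'.var .v)) ?_ ?_) ?_)
  · simp [hk, hy, topLevel, infinity]
  · rintro s₂ ⟨hk₂, hy₂, hv₂, hp₂⟩ ht₂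
    simp at ht₂
    have hsum : ∑ v ∈ Finset.range (s₂.var .v + 1), A.deg v ≤ A.size :=
      Finset.sum_le_sum_of_subset (Finset.range_subset_range.2 ht₂)
    rw [Finset.sum_range_succ] at hsum
    refine .block hE (by simp [hp₂]; omega) ⟨⟨?_, ?_, ?_, ?_⟩, ?_⟩
    · simp [hk₂]
    · simp [hy₂]
    · simp; omega
    · simp [hp₂, Finset.sum_range_succ, add_assoc]
    · simp
      omega
  rintro k₂ s₂ ⟨⟨hk₂, hy₂, hv₂, hp₂⟩, ht₂, hc₂⟩
  simp at ht₂ hc₂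
  rw [le_antisymm hv₂ ht₂] at hp₂
  have hp₂' : s₂.var .p = 1 + A.size := hp₂
  refine .seq (.block hE (by simp) ?_)
  -- The value `p` starts one above the number of edges. So when `n < p` fails, `p - 1` is a
  -- remainder below `n`, and `e` is the rounded-down quotient.
  refine .seq (.mono (.loop (fun s' => s'.var .k = topLevel c n ∧ s'.var .y = infinity c n ∧
    1 ≤ s'.var .p ∧ s'.var .p + n * s'.var .e = 1 + A.size)
    (fun s' => 4 * (n - s'.var .e)) ?_ ?_) ?_)
  · simp [hk₂, hy₂, hp₂']
  · rintro s₃ ⟨hk₃, hy₃, hp₃, he₃⟩ ht₃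
    simp at ht₃
    have hlt : s₃.var .e < n := by
      by_contra hge
      have := Nat.mul_le_mul_left n (not_lt.1 hge)
      omega
    refine .block hE (by simp; omega) ⟨⟨?_, ?_, ?_, ?_⟩, ?_⟩
    · simp [hk₃]
    · simp [hy₃]
    · simp; omega
    · simp [Nat.mul_succ]
      omega
    · simp
      omega
  rintro k₃ s₃ ⟨⟨hk₃, hy₃, hp₃, he₃⟩, ht₃, hc₃⟩
  simp at ht₃ hc₃
  have hdiv : A.size / n = s₃.var .e := by
    rw [show A.size = (s₃.var .p - 1) + n * s₃.var .e by omega, Nat.add_mul_div_left _ _ hn,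
      Nat.div_eq_of_lt (by omega), zero_add]
  have hdiv' : A.size / n ≤ n := Nat.div_le_of_le_mul hm
  rw [hdiv] at hdiv'
  refine .block hE (by simp [hk₃]; omega) ⟨?_, ?_, ?_, ?_, ?_⟩
  · simp [hk₃]
  · simp [hy₃]
  · simp [hk₃]
  -- Nine doublings give the factor 512.
  · simp [hk₃, period, hdiv]
    omega
  · simp
    have h₁ : (5 * c + 100) * n = (5 * c + 17) * n + 83 * n := by ring
    omega

end APSD

/-! ### Timed emission, and its interleaving with a silent program. -/

namespace APSD

variable {n : ℕ} {G : WeightedGraph n} {w : ℕ} {A : AdjLists G}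

/-! ### Delays of traces -/

/-- The number of steps since the last output, if there have been `k` steps before. -/
def gap : ℕ → List (Option Output) → ℕ
  | k, [] => k
  | k, none :: tr => gap (k + 1) tr
  | _, some _ :: tr => gap 0 tr

/-- All outputs are on time, if there have been `k` steps since the last output before. -/
def OnTime (D : ℕ) : ℕ → List (Option Output) → Prop
  | _, [] => True
  | k, none :: tr => OnTime D (k + 1) tr
  | k, some _ :: tr => k + 1 ≤ D ∧ OnTime D 0 tr

theorem gap_append (tr tr' : List (Option Output)) (k : ℕ) :
    gap k (tr ++ tr') = gap (gap k tr) tr' := by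
  induction tr generalizing k with
  | nil => rfl
  | cons o tr ih => cases o <;> exact ih _

theorem onTime_append {D : ℕ} (tr tr' : List (Option Output)) (k : ℕ) :
    OnTime D k (tr ++ tr') ↔ OnTime D k tr ∧ OnTime D (gap k tr) tr' := by
  induction tr generalizing k with
  | nil => simp [OnTime, gap]
  | cons o tr ih => cases o <;> simp [OnTime, gap, ih, and_assoc]

theorem le_of_mem_delaysFrom {D : ℕ} {tr : List (Option Output)} {k : ℕ} (h : OnTime D k tr)
    (h' : gap k tr ≤ D) : ∀ d ∈ delaysFrom k tr, d ≤ D := by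
  induction tr generalizing k with
  | nil => simpa [delaysFrom, gap] using h'
  | cons o tr ih =>
    cases o with
    | none => exact ih h h'
    | some o =>
      simp only [delaysFrom, List.mem_cons, forall_eq_or_imp]
      exact ⟨h.1, ih h.2 h'⟩

/-- Started at most `k` steps after an output, all outputs are on time, and there are at most `k'`
steps since the last output at the end. -/
def Paced (D k : ℕ) (tr : List (Option Output)) (k' : ℕ) : Prop :=
  ∀ j ≤ k, OnTime D j tr ∧ gap j tr ≤ k'

namespace Paced

variable {D k k' k'' : ℕ} {tr tr' : List (Option Output)}

theorem append (h : Paced D k tr k') (h' : Paced D k' tr' k'') : Paced D k (tr ++ tr') k'' := by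
  intro j hj
  obtain ⟨h₁, h₂⟩ := h j hj
  rw [onTime_append, gap_append]
  exact ⟨⟨h₁, (h' _ h₂).1⟩, (h' _ h₂).2⟩

theorem mono (h : Paced D k tr k') {l l' : ℕ} (hl : l ≤ k) (hl' : k' ≤ l') : Paced D l tr l' :=
  fun j hj => ⟨(h j (hj.trans hl)).1, (h j (hj.trans hl)).2.trans hl'⟩

theorem mono_delay (h : Paced D k tr k') {D' : ℕ} (hD : D ≤ D') : Paced D' k tr k' := by
  intro j hj
  refine ⟨?_, (h j hj).2⟩
  have h' := (h j hj).1
  clear h hj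
  induction tr generalizing j with
  | nil => trivial
  | cons o tr ih =>
    cases o with
    | none => exact ih _ h'
    | some o => exact ⟨h'.1.trans hD, ih _ h'.2⟩

theorem nil : Paced D k [] k := fun _ hj => ⟨trivial, hj⟩

theorem cons_none (h : Paced D (k + 1) tr k') : Paced D k (none :: tr) k' :=
  fun j hj => h (j + 1) (by omega)

theorem cons_some {o : Output} (h : Paced D 0 tr k') (hk : k + 1 ≤ D) :
    Paced D k (some o :: tr) k' :=
  fun j hj => ⟨⟨by omega, (h 0 le_rfl).1⟩, (h 0 le_rfl).2⟩

theorem replicate (m : ℕ) : Paced D k (List.replicate m none) (k + m) := by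
  induction m generalizing k with
  | zero => exact nil
  | succ m ih => exact cons_none (ih.mono le_rfl (by omega))

end Paced

theorem outputs_append (tr tr' : List (Option Output)) :
    outputs (tr ++ tr') = outputs tr ++ outputs tr' := by
  simp [outputs]

@[simp] theorem outputs_replicate (m : ℕ) : outputs (List.replicate m none) = [] := by
  simp [outputs]

/-! ### Emission of stored rows -/

/-- What is to be emitted: the row `val` of distances from `src` (except for the distance to `src`),
which is stored at `base`, if `src < n`, or otherwise the distances from all vertices to themselves.
One output is due after every `period` ticks, and `slack` is a number of additional steps that are
allowed for each output. -/
structure Feed where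
  inf : ℕ
  base : ℕ
  src : ℕ
  period : ℕ
  slack : ℕ
  val : ℕ → ℕ

/-- The output for vertex `t`. -/
def Feed.out (F : Feed) (n t : ℕ) : Output :=
  if F.src < n then (F.src, t, if F.val t = F.inf then ⊤ else (F.val t : ℕ∞)) else (t, t, 0)

/-- The outputs that are still to be made from vertex `t` on. -/
def Feed.pending (F : Feed) (n t : ℕ) : List Output :=
  ((List.range' t (n - t)).filter (· ≠ F.src)).map (F.out n)

theorem Feed.pending_cons (F : Feed) {t : ℕ} (ht : t < n) (hs : t ≠ F.src) :
    F.pending n t = F.out n t :: F.pending n (t + 1) := by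
  unfold Feed.pending
  rw [show n - t = (n - (t + 1)) + 1 by omega, List.range'_succ]
  simp [hs]

theorem Feed.pending_src (F : Feed) : F.pending n F.src = F.pending n (F.src + 1) := by
  rcases Nat.lt_or_ge F.src n with h | h
  · unfold Feed.pending
    rw [show n - F.src = (n - (F.src + 1)) + 1 by omega, List.range'_succ]
    simp
  · unfold Feed.pending
    rw [Nat.sub_eq_zero_of_le h, Nat.sub_eq_zero_of_le (by omega)]
    simp

theorem Feed.pending_of_le (F : Feed) {t : ℕ} (ht : n ≤ t) : F.pending n t = [] := by
  simp [Feed.pending, Nat.sub_eq_zero_of_le ht]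

/-- Skip the vertex `src`. -/
def skipSrc : Program := .ite (.eq 6 5) (.instr (.add 6 6 1)) (.instr (.move 9 9))

def emitNext : Program :=
  .ite (.lt 5 2)
    (.instr (.add 9 4 6) ;; .instr (.load 10 9) ;;
      .ite (.eq 10 3) (.instr (.emitInf 5 6)) (.instr (.emit 5 6 10)))
    (.instr (.emit 6 6 0)) ;;
  .instr (.add 6 6 1) ;; skipSrc

/-- Emit the next output if it is due. -/
def tick : Program :=
  .instr (.sub 8 8 1) ;; .ite (.eq 8 0) (emitNext ;; .instr (.move 8 7)) (.instr (.move 9 9))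

/-- The registers for the emission of outputs. -/
structure Feeding (n : ℕ) (F : Feed) (σ : State) : Prop where
  zero : σ.reg 0 = 0
  one : σ.reg 1 = 1
  size : σ.reg 2 = n
  inf : σ.reg 3 = F.inf
  base : σ.reg 4 = F.base
  src : σ.reg 5 = F.src
  ne_src : σ.reg 6 < n → σ.reg 6 ≠ F.src
  period : σ.reg 7 = F.period

/-- The registers for the timed emission of outputs. -/
structure Ready (n : ℕ) (F : Feed) (σ : State) : Prop extends Feeding n F σ where
  cnt_pos : 1 ≤ σ.reg 8
  cnt_le : σ.reg 8 ≤ F.period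

structure Feed.Fits (F : Feed) (w n : ℕ) : Prop where
  size : n + 2 < 2 ^ w
  mem : F.base + n < 2 ^ w
  period : F.period < 2 ^ w
  slack : 4 ≤ F.slack
  val : ∀ t < n, F.val t < 2 ^ w

/-- The row to be emitted is stored in memory. -/
def Feed.Stored (F : Feed) (n : ℕ) (m : ℕ → Option ℕ) : Prop :=
  F.src < n → ∀ t < n, m (F.base + t) = some (F.val t)

/-- `τ` differs from `σ` only in registers used for emission. -/
structure SameWork (σ τ : State) : Prop where
  reg : ∀ r, 16 ≤ r → τ.reg r = σ.reg r
  mem : τ.mem = σ.mem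

theorem Feeding.congr {F : Feed} {σ τ : State} (h : Feeding n F σ)
    (hr : ∀ r < 8, τ.reg r = σ.reg r) : Feeding n F τ := by
  constructor
  · rw [hr _ (by norm_num), h.zero]
  · rw [hr _ (by norm_num), h.one]
  · rw [hr _ (by norm_num), h.size]
  · rw [hr _ (by norm_num), h.inf]
  · rw [hr _ (by norm_num), h.base]
  · rw [hr _ (by norm_num), h.src]
  · rw [hr _ (by norm_num)]; exact h.ne_src
  · rw [hr _ (by norm_num), h.period]

theorem Ready.congr {F : Feed} {σ τ : State} (h : Ready n F σ)
    (hr : ∀ r < 9, τ.reg r = σ.reg r) : Ready n F τ where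
  toFeeding := h.toFeeding.congr fun r h' => hr r (by omega)
  cnt_pos := by rw [hr _ (by norm_num)]; exact h.cnt_pos
  cnt_le := by rw [hr _ (by norm_num)]; exact h.cnt_le

theorem exec_skipSrc {F : Feed} {σ : State} (hF : F.Fits w n)
    (h0 : σ.reg 1 = 1) (h1 : σ.reg 5 = F.src) (ht : σ.reg 6 ≤ n) :
    ∃ τ, Exec w A skipSrc σ [none, none] τ ∧ SameWork σ τ ∧ (∀ r, r < 9 → r ≠ 6 → τ.reg r = σ.reg r) ∧
      τ.reg 6 ≠ F.src ∧ F.pending n (τ.reg 6) = F.pending n (σ.reg 6) := by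
  by_cases hs : σ.reg 6 = F.src
  · have hmod : (σ.reg 6 + 1) % 2 ^ w = σ.reg 6 + 1 := Nat.mod_eq_of_lt (by have := hF.size; omega)
    refine ⟨_, .ite_true (by simp [Cond.Holds, hs, h1]) (.instr rfl), ⟨?_, rfl⟩, ?_, ?_, ?_⟩
    · intro r hr
      simp only [State.setReg]
      rw [Function.update_of_ne (by omega)]
    · intro r _ hr
      simp only [State.setReg]
      rw [Function.update_of_ne hr]
    · simp only [State.setReg, Function.update_self, h0, hmod]
      omega
    · simp only [State.setReg, Function.update_self, h0, hmod]
      rw [hs]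
      exact F.pending_src.symm
  · refine ⟨_, .ite_false (by simp [Cond.Holds, hs, h1]) (.instr rfl), ⟨?_, rfl⟩, ?_, ?_, ?_⟩
    · intro r hr
      simp only [State.setReg]
      rw [Function.update_of_ne (by omega)]
    · intro r hr _
      simp only [State.setReg]
      rw [Function.update_of_ne (by omega)]
    · simpa [State.setReg] using hs
    · simp [State.setReg]

/-- In a row, four silent steps come before the output: a test, the address, the load and the
comparison with infinity. On the diagonal it is one test. Three steps afterwards advance the pointer
past the source. -/
theorem exec_emitNext {F : Feed} {σ : State} (hF : F.Fits w n) (h : Feeding n F σ)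
    (hm : F.Stored n σ.mem) (ht : σ.reg 6 < n) :
    ∃ k ≤ 4, ∃ τ, Exec w A emitNext σ
        (List.replicate k none ++ [some (F.out n (σ.reg 6))] ++ List.replicate 3 none) τ ∧
      SameWork σ τ ∧ (∀ r, r < 9 → r ≠ 6 → τ.reg r = σ.reg r) ∧ τ.reg 6 ≠ F.src ∧
      F.pending n (σ.reg 6) = F.out n (σ.reg 6) :: F.pending n (τ.reg 6) := by
  have hsz := hF.size
  have hmem := hF.mem
  suffices h₁ : ∃ k ≤ 4, ∃ ρ, Exec w A (.ite (.lt 5 2)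
      (.instr (.add 9 4 6) ;; .instr (.load 10 9) ;;
        .ite (.eq 10 3) (.instr (.emitInf 5 6)) (.instr (.emit 5 6 10)))
      (.instr (.emit 6 6 0))) σ (List.replicate k none ++ [some (F.out n (σ.reg 6))]) ρ ∧
      SameWork σ ρ ∧ ∀ r, r < 9 → ρ.reg r = σ.reg r by
    obtain ⟨k, hk, ρ, h₁, h₂, h₃⟩ := h₁
    have h6 : (ρ.reg 6 + ρ.reg 1) % 2 ^ w = σ.reg 6 + 1 := by
      rw [h₃ 6 (by norm_num), h₃ 1 (by norm_num), h.one]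
      exact Nat.mod_eq_of_lt (by omega)
    obtain ⟨τ, h₄, h₅, h₆, h₇, h₈⟩ := exec_skipSrc (A := A) (F := F)
      (σ := ρ.setReg w 6 (ρ.reg 6 + ρ.reg 1)) hF (by simp [State.setReg, h₃, h.one])
      (by simp [State.setReg, h₃, h.src]) (by simp [State.setReg, h6]; omega)
    refine ⟨k, hk, τ, .seq h₁ (.seq (.instr rfl) h₄), ⟨?_, ?_⟩, ?_, h₇, ?_⟩
    · intro r hr
      rw [h₅.reg r hr]
      simp only [State.setReg]
      rw [Function.update_of_ne (by omega), h₂.reg r hr]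
    · rw [h₅.mem]
      exact h₂.mem
    · intro r hr hr'
      rw [h₆ r hr hr']
      simp only [State.setReg]
      rw [Function.update_of_ne (by omega), h₃ r hr]
    · rw [h₈]
      simp only [State.setReg, Function.update_self, h6]
      exact F.pending_cons ht (h.ne_src ht)
  by_cases hs : F.src < n
  · have hbase : (σ.reg 4 + σ.reg 6) % 2 ^ w = F.base + σ.reg 6 := by
      rw [h.base]
      exact Nat.mod_eq_of_lt (by omega)
    have hval := hF.val _ ht
    have hload : Instr.step w A (σ.setReg w 9 (σ.reg 4 + σ.reg 6)) (.load 10 9) =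
        some ((σ.setReg w 9 (σ.reg 4 + σ.reg 6)).setReg w 10 (F.val (σ.reg 6)), none) := by
      have : (σ.setReg w 9 (σ.reg 4 + σ.reg 6)).mem (F.base + σ.reg 6) = some (F.val (σ.reg 6)) :=
        hm hs _ ht
      simp only [Instr.step]
      rw [show (σ.setReg w 9 (σ.reg 4 + σ.reg 6)).reg 9 = F.base + σ.reg 6 by
        simp [State.setReg, hbase], this]
      rfl
    have hlast : Exec w A (.ite (.eq 10 3) (.instr (.emitInf 5 6)) (.instr (.emit 5 6 10)))
        ((σ.setReg w 9 (σ.reg 4 + σ.reg 6)).setReg w 10 (F.val (σ.reg 6)))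
        [none, some (F.out n (σ.reg 6))]
        ((σ.setReg w 9 (σ.reg 4 + σ.reg 6)).setReg w 10 (F.val (σ.reg 6))) := by
      by_cases hv : F.val (σ.reg 6) = F.inf
      · refine .ite_true ?_ (.instr ?_)
        · simp [Cond.Holds, State.setReg, h.inf, hv]
          exact Nat.mod_eq_of_lt (hv ▸ hval)
        · simp [Instr.step, State.setReg, Feed.out, hs, hv, h.src]
      · refine .ite_false ?_ (.instr ?_)
        · simp [Cond.Holds, State.setReg, h.inf, Nat.mod_eq_of_lt hval, hv]
        · simp [Instr.step, State.setReg, Feed.out, hs, hv, h.src, Nat.mod_eq_of_lt hval]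
    refine ⟨4, le_rfl, (σ.setReg w 9 (σ.reg 4 + σ.reg 6)).setReg w 10 (F.val (σ.reg 6)),
      Exec.ite_true (tr := [none] ++ ([none] ++ [none, some (F.out n (σ.reg 6))]))
        (by simpa [Cond.Holds, h.src, h.size] using hs)
        (.seq (.instr rfl) (.seq (.instr hload) hlast)), ⟨?_, rfl⟩, ?_⟩
    · intro r hr
      simp only [State.setReg]
      rw [Function.update_of_ne (by omega), Function.update_of_ne (by omega)]
    · intro r hr
      simp only [State.setReg]
      rw [Function.update_of_ne (by omega), Function.update_of_ne (by omega)]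
  · refine ⟨1, by norm_num, σ, .ite_false (by simpa [Cond.Holds, h.src, h.size] using hs)
      (.instr ?_), ⟨fun _ _ => rfl, rfl⟩, fun _ _ => rfl⟩
    simp [Instr.step, Feed.out, hs, h.zero]

/-- The number of ticks, plus `period`, that the pending outputs suffice for. -/
def Feed.fuel (F : Feed) (n : ℕ) (σ : State) : ℕ :=
  (F.pending n (σ.reg 6)).length * F.period + σ.reg 8

/-- A bound on the number of steps since the last output. -/
def Feed.lag (F : Feed) (σ : State) : ℕ := 16 * (F.period - σ.reg 8) + F.slack

/-- A bound on the delay. -/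
def Feed.delay (F : Feed) : ℕ := 16 * F.period + F.slack + 16

/-- A run with `k` ticks, where the last output happened at most `l` steps before. -/
structure Advances (n : ℕ) (F : Feed) (k l : ℕ) (σ : State) (tr : List (Option Output))
    (τ : State) : Prop where
  ready : Ready n F τ
  out : F.pending n (σ.reg 6) = outputs tr ++ F.pending n (τ.reg 6)
  fuel : F.fuel n τ + k = F.fuel n σ
  paced : Paced F.delay (F.lag σ + l) tr (F.lag τ)

theorem Advances.trans {F : Feed} {k k' l : ℕ} {σ ρ τ : State} {tr tr' : List (Option Output)}
    (h : Advances n F k l σ tr ρ) (h' : Advances n F k' 0 ρ tr' τ) :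
    Advances n F (k + k') l σ (tr ++ tr') τ where
  ready := h'.ready
  out := by rw [h.out, h'.out, outputs_append, List.append_assoc]
  fuel := by
    have := h.fuel
    have := h'.fuel
    omega
  paced := h.paced.append h'.paced

/-- Either the countdown decreases by one, or it is at 1 and an output is exchanged for a fresh
period. In both cases the fuel decreases by exactly one. The allowance of 16 steps per unit of the
countdown covers the tick and the step of the simulated program. -/
theorem exec_tick {F : Feed} {σ : State} (hF : F.Fits w n) (h : Ready n F σ)
    (hm : F.Stored n σ.mem) (hfuel : 1 + F.period ≤ F.fuel n σ) :
    ∃ tr τ, Exec w A tick σ tr τ ∧ SameWork σ τ ∧ Advances n F 1 1 σ tr τ := by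
  have hcnt := h.cnt_pos
  have hle := h.cnt_le
  have hper := hF.period
  have hslack := hF.slack
  have hsub : (σ.reg 8 + 2 ^ w - σ.reg 1) % 2 ^ w = σ.reg 8 - 1 := by
    rw [h.one, show σ.reg 8 + 2 ^ w - 1 = (σ.reg 8 - 1) + 2 ^ w by omega, Nat.add_mod_right,
      Nat.mod_eq_of_lt (by omega)]
  set ρ := σ.setReg w 8 (σ.reg 8 + 2 ^ w - σ.reg 1) with hρ
  have hρ8 : ρ.reg 8 = σ.reg 8 - 1 := by simp [hρ, State.setReg, hsub]
  have hρr : ∀ r, r ≠ 8 → ρ.reg r = σ.reg r := by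
    intro r hr
    simp only [hρ, State.setReg]
    rw [Function.update_of_ne hr]
  by_cases hc : σ.reg 8 = 1
  · have hρ' : Feeding n F ρ := h.toFeeding.congr fun r hr => hρr r (by omega)
    have hρ6 : ρ.reg 6 = σ.reg 6 := hρr 6 (by norm_num)
    -- Without pending outputs the fuel would be the countdown 1, which is less than `1 + period`.
    have hlt : σ.reg 6 < n := by
      by_contra hge
      rw [Feed.fuel, F.pending_of_le (not_lt.1 hge)] at hfuel
      simp at hfuel
      omega
    obtain ⟨k, hk, ν, h₁, h₂, h₃, h₄, h₅⟩ := exec_emitNext (A := A) hF hρ' hm (by omega)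
    rw [hρ6] at h₁ h₅
    have hν7 : ν.reg 7 = F.period := by rw [h₃ 7 (by norm_num) (by norm_num), hρ'.period]
    have h8 : (ν.setReg w 8 (ν.reg 7)).reg 8 = F.period := by
      simp [State.setReg, hν7, Nat.mod_eq_of_lt hper]
    have hne : ∀ r, r ≠ 8 → (ν.setReg w 8 (ν.reg 7)).reg r = ν.reg r := by
      intro r hr
      simp only [State.setReg]
      rw [Function.update_of_ne hr]
    have h0 : ρ.reg 8 = ρ.reg 0 := by
      rw [hρ8, hρ'.zero]
      omega
    refine ⟨_, _, .seq (.instr rfl) (.ite_true h0 (.seq h₁ (.instr rfl))), ⟨?_, h₂.mem⟩,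
      ⟨⟨?_, ?_, ?_⟩, ?_, ?_, ?_⟩⟩
    · intro r hr
      rw [hne r (by omega), h₂.reg r hr, hρr r (by omega)]
    · constructor
      · rw [hne _ (by norm_num), h₃ _ (by norm_num) (by norm_num), hρ'.zero]
      · rw [hne _ (by norm_num), h₃ _ (by norm_num) (by norm_num), hρ'.one]
      · rw [hne _ (by norm_num), h₃ _ (by norm_num) (by norm_num), hρ'.size]
      · rw [hne _ (by norm_num), h₃ _ (by norm_num) (by norm_num), hρ'.inf]
      · rw [hne _ (by norm_num), h₃ _ (by norm_num) (by norm_num), hρ'.base]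
      · rw [hne _ (by norm_num), h₃ _ (by norm_num) (by norm_num), hρ'.src]
      · rw [hne _ (by norm_num)]
        exact fun _ => h₄
      · rw [hne _ (by norm_num), hν7]
    · rw [h8]
      omega
    · rw [h8]
    · rw [h₅, hne 6 (by norm_num)]
      simp [outputs]
    · rw [Feed.fuel, Feed.fuel, h8, hne 6 (by norm_num), h₅, hc, List.length_cons, Nat.succ_mul]
    · rw [Feed.lag, Feed.lag, h8, hc]
      refine .cons_none (.cons_none ?_)
      rw [List.append_assoc, List.append_assoc]
      refine (Paced.replicate k).append ?_
      refine .cons_some (((Paced.replicate 3).append (Paced.replicate 1)).mono le_rfl ?_) ?_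
      · omega
      · unfold Feed.delay
        omega
  · have h0 : ρ.reg 8 ≠ ρ.reg 0 := by
      rw [hρ8, hρr 0 (by norm_num), h.zero]
      omega
    have hne : ∀ r, r ≠ 9 → (ρ.setReg w 9 (ρ.reg 9)).reg r = ρ.reg r := by
      intro r hr
      simp only [State.setReg]
      rw [Function.update_of_ne hr]
    refine ⟨_, _, .seq (.instr rfl) (.ite_false h0 (.instr rfl)), ⟨?_, rfl⟩,
      ⟨⟨h.toFeeding.congr ?_, ?_, ?_⟩, ?_, ?_, ?_⟩⟩
    · intro r hr
      rw [hne r (by omega), hρr r (by omega)]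
    · intro r hr
      rw [hne r (by omega), hρr r (by omega)]
    · rw [hne 8 (by norm_num), hρ8]
      omega
    · rw [hne 8 (by norm_num), hρ8]
      omega
    · rw [hne 6 (by norm_num), hρr 6 (by norm_num)]
      rfl
    · rw [Feed.fuel, Feed.fuel, hne 6 (by norm_num), hne 8 (by norm_num), hρ8,
        hρr 6 (by norm_num)]
      omega
    · rw [Feed.lag, Feed.lag, hne 8 (by norm_num), hρ8]
      exact (Paced.replicate 3).mono le_rfl (by omega)

/-! ### Interleaving a silent program with ticks -/

/-- Insert a tick after each step. -/
def Program.interleave : Program → Program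
  | .instr i => .instr i ;; tick
  | .seq P Q => P.interleave ;; Q.interleave
  | .ite b P Q => .ite b (tick ;; P.interleave) (tick ;; Q.interleave)
  | .while b P => .while b (tick ;; P.interleave) ;; tick

/-- All registers that occur are at least `16`. -/
def Instr.high : Instr → Bool
  | .const d _ => 16 ≤ d
  | .move d a => 16 ≤ d && 16 ≤ a
  | .add d a b => 16 ≤ d && 16 ≤ a && 16 ≤ b
  | .sub d a b => 16 ≤ d && 16 ≤ a && 16 ≤ b
  | .load d a => 16 ≤ d && 16 ≤ a
  | .store a b => 16 ≤ a && 16 ≤ b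
  | .numVertices d => 16 ≤ d
  | .degree d v => 16 ≤ d && 16 ≤ v
  | .neighbor d v i => 16 ≤ d && 16 ≤ v && 16 ≤ i
  | .weight d v i => 16 ≤ d && 16 ≤ v && 16 ≤ i
  | .emit s t x => 16 ≤ s && 16 ≤ t && 16 ≤ x
  | .emitInf s t => 16 ≤ s && 16 ≤ t

def Cond.high : Cond → Bool
  | .lt a b => 16 ≤ a && 16 ≤ b
  | .eq a b => 16 ≤ a && 16 ≤ b

def Program.high : Program → Bool
  | .instr i => i.high
  | .seq P Q => P.high && Q.high
  | .ite b P Q => b.high && P.high && Q.high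
  | .while b P => b.high && P.high

/-- `σ'` is like `σ` on the registers from `16` on, and its memory extends the memory of `σ` by the
words of `m₀` that are not used in `σ`. -/
structure Extends (m₀ : ℕ → Option ℕ) (σ σ' : State) : Prop where
  reg : ∀ r, 16 ≤ r → σ'.reg r = σ.reg r
  mem : ∀ a, σ'.mem a = (σ.mem a).or (m₀ a)

theorem Extends.setReg {m₀ : ℕ → Option ℕ} {σ σ' : State} (h : Extends m₀ σ σ') (d x : ℕ) :
    Extends m₀ (σ.setReg w d x) (σ'.setReg w d x) where
  reg r hr := by
    simp only [State.setReg, Function.update_apply]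
    split_ifs
    · rfl
    · exact h.reg r hr
  mem := h.mem

theorem Extends.sameWork {m₀ : ℕ → Option ℕ} {σ σ' τ : State} (h : Extends m₀ σ σ')
    (h' : SameWork σ' τ) : Extends m₀ σ τ where
  reg r hr := by rw [h'.reg r hr, h.reg r hr]
  mem a := by rw [h'.mem, h.mem a]

theorem Extends.holds {m₀ : ℕ → Option ℕ} {σ σ' : State} (h : Extends m₀ σ σ') {b : Cond}
    (hb : b.high) : b.Holds σ' ↔ b.Holds σ := by
  cases b <;> simp [Cond.high] at hb <;> simp [Cond.Holds, h.reg _ hb.1, h.reg _ hb.2]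

/-- A load that succeeds in the smaller memory finds the same word in the larger one, because `or`
prefers the first memory. Emission registers are below 16 and remain untouched. -/
theorem Extends.step {m₀ : ℕ → Option ℕ} {σ σ' τ : State} (h : Extends m₀ σ σ') {i : Instr}
    (hi : i.high) (hs : i.step w A σ = some (τ, none)) :
    ∃ τ', i.step w A σ' = some (τ', none) ∧ Extends m₀ τ τ' ∧ ∀ r < 16, τ'.reg r = σ'.reg r := by
  have hlow : ∀ d x, 16 ≤ d → ∀ r < 16, (σ'.setReg w d x).reg r = σ'.reg r := by
    intro d x hd r hr
    simp only [State.setReg]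
    rw [Function.update_of_ne (by omega)]
  cases i with
  | const d k =>
    simp [Instr.high] at hi
    simp only [Instr.step, Option.some.injEq, Prod.mk.injEq, and_true] at hs
    exact ⟨_, rfl, hs ▸ h.setReg _ _, hlow _ _ hi⟩
  | move d a =>
    simp [Instr.high] at hi
    simp only [Instr.step, Option.some.injEq, Prod.mk.injEq, and_true] at hs
    refine ⟨_, rfl, ?_, hlow _ _ hi.1⟩
    rw [h.reg _ hi.2]
    exact hs ▸ h.setReg _ _
  | add d a b =>
    simp [Instr.high] at hi
    simp only [Instr.step, Option.some.injEq, Prod.mk.injEq, and_true] at hs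
    refine ⟨_, rfl, ?_, hlow _ _ hi.1.1⟩
    rw [h.reg _ hi.1.2, h.reg _ hi.2]
    exact hs ▸ h.setReg _ _
  | sub d a b =>
    simp [Instr.high] at hi
    simp only [Instr.step, Option.some.injEq, Prod.mk.injEq, and_true] at hs
    refine ⟨_, rfl, ?_, hlow _ _ hi.1.1⟩
    rw [h.reg _ hi.1.2, h.reg _ hi.2]
    exact hs ▸ h.setReg _ _
  | load d a =>
    simp [Instr.high] at hi
    simp only [Instr.step, Option.map_eq_some_iff, Prod.mk.injEq, and_true] at hs
    obtain ⟨x, hx, rfl⟩ := hs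
    refine ⟨σ'.setReg w d x, ?_, h.setReg _ _, hlow _ _ hi.1⟩
    simp [Instr.step, h.reg _ hi.2, h.mem, hx]
  | store a b =>
    simp [Instr.high] at hi
    simp only [Instr.step, Option.some.injEq, Prod.mk.injEq, and_true] at hs
    subst hs
    refine ⟨_, rfl, ⟨h.reg, ?_⟩, fun _ _ => rfl⟩
    intro x
    simp only [State.setMem, h.reg _ hi.1, h.reg _ hi.2, Function.update_apply]
    split_ifs
    · rfl
    · exact h.mem x
  | numVertices d =>
    simp [Instr.high] at hi
    simp only [Instr.step, Option.some.injEq, Prod.mk.injEq, and_true] at hs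
    exact ⟨_, rfl, hs ▸ h.setReg _ _, hlow _ _ hi⟩
  | degree d v =>
    simp [Instr.high] at hi
    simp only [Instr.step] at hs ⊢
    rw [h.reg _ hi.2]
    split_ifs at hs ⊢ with hv
    simp only [Option.some.injEq, Prod.mk.injEq, and_true] at hs
    exact ⟨_, rfl, hs ▸ h.setReg _ _, hlow _ _ hi.1⟩
  | neighbor d v i =>
    simp [Instr.high] at hi
    simp only [Instr.step] at hs ⊢
    rw [h.reg _ hi.1.2, h.reg _ hi.2]
    split_ifs at hs ⊢ with hv
    simp only [Option.map_eq_some_iff, Prod.mk.injEq, and_true] at hs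
    obtain ⟨x, hx, rfl⟩ := hs
    exact ⟨_, by rw [hx]; rfl, h.setReg _ _, hlow _ _ hi.1.1⟩
  | weight d v i =>
    simp [Instr.high] at hi
    simp only [Instr.step] at hs ⊢
    rw [h.reg _ hi.1.2, h.reg _ hi.2]
    split_ifs at hs ⊢ with hv
    simp only [Option.map_eq_some_iff, Prod.mk.injEq, and_true] at hs
    obtain ⟨x, hx, rfl⟩ := hs
    exact ⟨_, by rw [hx]; rfl, h.setReg _ _, hlow _ _ hi.1.1⟩
  | emit s t x => simp [Instr.step] at hs
  | emitInf s t => simp [Instr.step] at hs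

theorem Instr.step_mem_ne_none {i : Instr} {σ τ : State} {o : Option Output}
    (h : i.step w A σ = some (τ, o)) {a : ℕ} (ha : σ.mem a ≠ none) : τ.mem a ≠ none := by
  cases i with
  | store b x =>
    simp only [Instr.step, Option.some.injEq, Prod.mk.injEq] at h
    rw [← h.1]
    simp only [State.setMem, Function.update_apply]
    split_ifs
    · simp
    · exact ha
  | load d b =>
    simp only [Instr.step, Option.map_eq_some_iff, Prod.mk.injEq] at h
    obtain ⟨x, _, h, _⟩ := h
    rwa [← h]
  | degree d v =>
    simp only [Instr.step] at h
    split_ifs at h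
    simp only [Option.some.injEq, Prod.mk.injEq] at h
    rwa [← h.1]
  | neighbor d v i =>
    simp only [Instr.step] at h
    split_ifs at h
    simp only [Option.map_eq_some_iff, Prod.mk.injEq] at h
    obtain ⟨x, _, h, _⟩ := h
    rwa [← h]
  | weight d v i =>
    simp only [Instr.step] at h
    split_ifs at h
    simp only [Option.map_eq_some_iff, Prod.mk.injEq] at h
    obtain ⟨x, _, h, _⟩ := h
    rwa [← h]
  | _ =>
    simp only [Instr.step, Option.some.injEq, Prod.mk.injEq] at h
    rwa [← h.1]

/-- Words of memory that have been written remain written. -/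
theorem Exec.mem_ne_none {P : Program} {σ τ : State} {tr : List (Option Output)}
    (h : Exec w A P σ tr τ) {a : ℕ} (ha : σ.mem a ≠ none) : τ.mem a ≠ none := by
  induction h with
  | instr h => exact Instr.step_mem_ne_none h ha
  | seq _ _ ih₁ ih₂ => exact ih₂ (ih₁ ha)
  | ite_true _ _ ih => exact ih ha
  | ite_false _ _ ih => exact ih ha
  | while_true _ _ _ ih₁ ih₂ => exact ih₂ (ih₁ ha)
  | while_false _ => exact ha

/-- The interleaved program simulates the given program in a larger memory, while the pending
outputs are emitted at regular intervals. -/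
theorem Exec.interleave {F : Feed} (hF : F.Fits w n) {m₀ : ℕ → Option ℕ} (hm₀ : F.Stored n m₀)
    {P : Program} {σ τ : State} {tr : List (Option Output)} (h : Exec w A P σ tr τ)
    (hP : P.high) (hs : ∀ o ∈ tr, o = none) (hτ : ∀ t < n, τ.mem (F.base + t) = none)
    {σ' : State} (hσ : Extends m₀ σ σ') (hr : Ready n F σ')
    (hf : tr.length + F.period ≤ F.fuel n σ') :
    ∃ tr' τ', Exec w A P.interleave σ' tr' τ' ∧ Extends m₀ τ τ' ∧
      Advances n F tr.length 0 σ' tr' τ' := by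
  have hstored : ∀ {ρ ρ' : State}, Extends m₀ ρ ρ' → (∀ t < n, ρ.mem (F.base + t) = none) →
      F.Stored n ρ'.mem := by
    intro ρ ρ' h₁ h₂ h₃ t ht
    rw [h₁.mem, h₂ t ht, Option.none_or, hm₀ h₃ t ht]
  -- Written words stay written. So a stored row whose words are unwritten by the silent run at its
  -- end is intact at each intermediate tick.
  have hback : ∀ {P : Program} {ρ τ : State} {tr : List (Option Output)}, Exec w A P ρ tr τ →
      (∀ t < n, τ.mem (F.base + t) = none) → ∀ t < n, ρ.mem (F.base + t) = none := by
    intro P ρ τ tr h₁ h₂ t ht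
    by_contra h₃
    exact h₁.mem_ne_none h₃ (h₂ t ht)
  have hpre : ∀ {σ τ : State} {tr : List (Option Output)} {k : ℕ}, Advances n F k 1 σ tr τ →
      Advances n F k 0 σ (none :: tr) τ := fun h => ⟨h.ready, h.out, h.fuel, .cons_none h.paced⟩
  induction h generalizing σ' with
  | @instr i σ τ o hi =>
    have ho : o = none := hs o (by simp)
    subst ho
    obtain ⟨ρ, h₁, h₂, h₃⟩ := hσ.step hP hi
    have h6 := h₃ 6 (by norm_num)
    have h8 := h₃ 8 (by norm_num)
    have hfuel : F.fuel n ρ = F.fuel n σ' := by rw [Feed.fuel, Feed.fuel, h6, h8]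
    obtain ⟨tr, τ', h₄, h₅, h₆⟩ := exec_tick (A := A) hF (hr.congr fun r hr => h₃ r (by omega))
      (hstored h₂ hτ) (by rw [hfuel]; exact hf)
    refine ⟨_, τ', .seq (.instr h₁) h₄, h₂.sameWork h₅, h₆.ready, ?_, ?_, ?_⟩
    · rw [← h6]
      exact h₆.out
    · rw [← hfuel]
      exact h₆.fuel
    · have := h₆.paced
      rw [Feed.lag, h8] at this
      exact .cons_none this
  | @seq P Q σ ρ τ tr tr' h₁ h₂ ih₁ ih₂ =>
    simp only [Program.high, Bool.and_eq_true] at hP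
    simp only [List.length_append] at hf
    obtain ⟨tr₁, ρ', h₃, h₄, h₅⟩ := ih₁ hP.1 (fun o ho => hs o (by simp [ho])) (hback h₂ hτ) hσ hr
      (by omega)
    have := h₅.fuel
    obtain ⟨tr₂, τ', h₆, h₇, h₈⟩ := ih₂ hP.2 (fun o ho => hs o (by simp [ho])) hτ h₄ h₅.ready
      (by omega)
    refine ⟨_, τ', .seq h₃ h₆, h₇, ?_⟩
    rw [List.length_append]
    exact h₅.trans h₈
  | @ite_true b P Q σ τ tr hb h₁ ih =>
    simp only [Program.high, Bool.and_eq_true] at hP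
    simp only [List.length_cons] at hf
    obtain ⟨tr₁, ρ', h₃, h₄, h₅⟩ := exec_tick (A := A) hF hr (hstored hσ (hback h₁ hτ)) (by omega)
    have := h₅.fuel
    obtain ⟨tr₂, τ', h₆, h₇, h₈⟩ := ih hP.1.2 (fun o ho => hs o (by simp [ho])) hτ
      (hσ.sameWork h₄) h₅.ready (by omega)
    refine ⟨_, τ', .ite_true ((hσ.holds hP.1.1).2 hb) (.seq h₃ h₆), h₇, ?_⟩
    rw [List.length_cons, add_comm]
    exact (hpre h₅).trans h₈
  | @ite_false b P Q σ τ tr hb h₁ ih =>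
    simp only [Program.high, Bool.and_eq_true] at hP
    simp only [List.length_cons] at hf
    obtain ⟨tr₁, ρ', h₃, h₄, h₅⟩ := exec_tick (A := A) hF hr (hstored hσ (hback h₁ hτ)) (by omega)
    have := h₅.fuel
    obtain ⟨tr₂, τ', h₆, h₇, h₈⟩ := ih hP.2 (fun o ho => hs o (by simp [ho])) hτ
      (hσ.sameWork h₄) h₅.ready (by omega)
    refine ⟨_, τ', .ite_false (fun h => hb ((hσ.holds hP.1.1).1 h)) (.seq h₃ h₆), h₇, ?_⟩
    rw [List.length_cons, add_comm]
    exact (hpre h₅).trans h₈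
  | @while_true b P σ ρ τ tr tr' hb h₁ h₂ ih₁ ih₂ =>
    have hP' := hP
    simp only [Program.high, Bool.and_eq_true] at hP
    simp only [List.length_cons, List.length_append] at hf
    obtain ⟨tr₁, ρ₁, h₃, h₄, h₅⟩ := exec_tick (A := A) hF hr
      (hstored hσ (hback h₁ (hback h₂ hτ))) (by omega)
    have := h₅.fuel
    obtain ⟨tr₂, ρ₂, h₆, h₇, h₈⟩ := ih₁ hP.2 (fun o ho => hs o (by simp [ho])) (hback h₂ hτ)
      (hσ.sameWork h₄) h₅.ready (by omega)
    have := h₈.fuel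
    obtain ⟨tr₃, τ', h₉, h₁₀, h₁₁⟩ := ih₂ hP' (fun o ho => hs o (by simp [ho])) hτ h₇ h₈.ready
      (by omega)
    -- The interleaved loop ends with a tick for the failing test. The run of the remaining rounds
    -- is taken apart so that this tick stays behind the loop.
    cases h₉ with
    | @seq _ _ _ ν _ tr₄ tr₅ h₁₂ h₁₃ =>
      refine ⟨_, τ', .seq (.while_true ((hσ.holds hP.1).2 hb) (.seq h₃ h₆) h₁₂) h₁₃, h₁₀, ?_⟩
      have := ((hpre h₅).trans h₈).trans h₁₁
      rw [List.length_cons, List.length_append, add_comm (_ + _) 1, ← add_assoc]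
      simpa [List.append_assoc] using this
  | @while_false b P σ hb =>
    simp only [Program.high, Bool.and_eq_true] at hP
    obtain ⟨tr₁, τ', h₃, h₄, h₅⟩ := exec_tick (A := A) hF hr (hstored hσ hτ) (by simpa using hf)
    exact ⟨_, τ', .seq (.while_false fun h => hb ((hσ.holds hP.1).1 h)) h₃, hσ.sameWork h₄,
      hpre h₅⟩

end APSD

/-! ### Time budget and the state between two sources. -/

namespace APSD

variable {n : ℕ} {G : WeightedGraph n} {w : ℕ} {A : AdjLists G}

/-! ### The enumeration program -/

/-- Emit all pending outputs. -/
def flush : Program := .while (.lt 6 2) emitNext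

/-- If anything is emitted, the time since the last output at the end is at most 4: three steps for
the pointer and the failing test. Otherwise only the failing test is added. -/
theorem exec_flush {F : Feed} {σ : State} (hF : F.Fits w n) (h : Feeding n F σ)
    (hm : F.Stored n σ.mem) :
    ∃ tr τ, Exec w A flush σ tr τ ∧ SameWork σ τ ∧ Feeding n F τ ∧ n ≤ τ.reg 6 ∧
      outputs tr = F.pending n (σ.reg 6) ∧
      ∀ D l, 9 ≤ D → l + 6 ≤ D → Paced D l tr (if F.pending n (σ.reg 6) = [] then l + 1 else 4) := by
  induction hl : (F.pending n (σ.reg 6)).length using Nat.strong_induction_on generalizing σ with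
  | _ m ih =>
    by_cases ht : σ.reg 6 < n
    · obtain ⟨k, hk, ρ, h₁, h₂, h₃, h₄, h₅⟩ := exec_emitNext (A := A) hF h hm ht
      have hρ : Feeding n F ρ := by
        constructor
        · rw [h₃ _ (by norm_num) (by norm_num), h.zero]
        · rw [h₃ _ (by norm_num) (by norm_num), h.one]
        · rw [h₃ _ (by norm_num) (by norm_num), h.size]
        · rw [h₃ _ (by norm_num) (by norm_num), h.inf]
        · rw [h₃ _ (by norm_num) (by norm_num), h.base]
        · rw [h₃ _ (by norm_num) (by norm_num), h.src]
        · exact fun _ => h₄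
        · rw [h₃ _ (by norm_num) (by norm_num), h.period]
      rw [h₅] at hl
      obtain ⟨tr, τ, h₆, h₇, h₈, h₉, h₁₀, h₁₁⟩ := ih _ (by rw [← hl]; simp) hρ
        (by rw [h₂.mem]; exact hm) rfl
      refine ⟨_, τ, .while_true (by simpa [Cond.Holds, h.size] using ht) h₁ h₆, ⟨?_, ?_⟩, h₈, h₉,
        ?_, ?_⟩
      · intro r hr
        rw [h₇.reg r hr, h₂.reg r hr]
      · rw [h₇.mem, h₂.mem]
      · rw [h₅, ← h₁₀]
        simp [outputs]
      · intro D l hD hl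
        rw [if_neg (by rw [h₅]; simp)]
        refine .cons_none (.append ?_ ((h₁₁ D 3 hD hD).mono le_rfl (k' := _) ?_))
        · rw [List.append_assoc]
          refine (Paced.replicate k).append (.cons_some ?_ (by omega))
          exact (Paced.replicate 3).mono le_rfl (by omega)
        · split_ifs <;> omega
    · refine ⟨_, σ, .while_false (by simpa [Cond.Holds, h.size] using ht), ⟨fun _ _ => rfl, rfl⟩, h,
        not_lt.1 ht, ?_, ?_⟩
      · rw [F.pending_of_le (not_lt.1 ht)]
        rfl
      · intro D l _ _
        rw [if_pos (F.pending_of_le (not_lt.1 ht))]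
        exact Paced.replicate 1

/-- The number of ticks between two outputs while the parameters are computed. -/
def startPeriod (c : ℕ) : ℕ := 4 * (5 * c + 100)

def setup (c : ℕ) : Program :=
  .instr (.numVertices 2) ;; .instr (.const 1 1) ;; .instr (.const 17 1) ;; .instr (.move 19 2) ;;
  .instr (.move 5 2) ;; .instr (.const 7 (startPeriod c)) ;; .instr (.move 8 7) ;; nop

def setParams : Program :=
  .instr (.move 20 39) ;; .instr (.move 21 35) ;; .instr (.move 23 40) ;; .instr (.move 3 35) ;;
  .instr (.move 7 37) ;; .instr (.move 8 7) ;; .instr (.add 4 23 23) ;; .instr (.add 4 4 23) ;;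
  .instr (.add 4 4 4) ;; nop

/-- Prepare for the emission of the row that has been computed, and go to the next source. -/
def switch : Program :=
  .instr (.move 9 22) ;; .instr (.move 22 4) ;; .instr (.move 4 9) ;; .instr (.move 5 18) ;;
  .instr (.move 6 0) ;; .instr (.move 8 7) ;; .instr (.add 18 18 17) ;; skipSrc

def processSource : Program := (prepare ;; dijkstra).interleave ;; flush ;; switch

def apsd (c : ℕ) : Program :=
  setup c ;; (prelude c).interleave ;; setParams ;; .while (.lt 18 19) processSource ;; flush

/-- The output for the pair `(s, t)`. -/
noncomputable def distOut (G : WeightedGraph n) (s t : ℕ) : Output :=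
  (s, t, if h : s < n ∧ t < n then G.dist ⟨s, h.1⟩ ⟨t, h.2⟩ else 0)

/-- The outputs for the pairs `(s, t)` with `t ≠ s`. -/
noncomputable def rowList (G : WeightedGraph n) (s : ℕ) : List Output :=
  ((List.range n).filter (· ≠ s)).map (distOut G s)

theorem length_rowList {s : ℕ} (hs : s < n) : (rowList G s).length = n - 1 := by
  have h : ((List.range n).filter (· ≠ s)) = (List.range n).erase s := by
    rw [List.nodup_range.erase_eq_filter]
    exact List.filter_congr fun x _ => by by_cases h : x = s <;> simp [h]
  rw [rowList, List.length_map, h, List.length_erase_of_mem (List.mem_range.2 hs),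
    List.length_range]

/-- The factor 512 in `period` is twice 256 because only half of `n` outputs are assumed to be
available. The increment of the rounded-down average degree makes the inequality strict. -/
theorem enough_time (c : ℕ) (A : AdjLists G) (hn : 1 ≤ n) {r : ℕ} (hr : n ≤ 2 * r) :
    256 * (n * topLevel c n + A.size) < r * period c A := by
  have h₁ : A.size < n * (A.size / n + 1) := by
    have := Nat.lt_div_mul_add (a := A.size) hn
    rw [Nat.mul_succ, mul_comm]
    exact this
  calc 256 * (n * topLevel c n + A.size)
      < 256 * (n * topLevel c n + n * (A.size / n + 1)) := by omega
    _ = 256 * (n * (topLevel c n + A.size / n + 1)) := by ring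
    _ ≤ 256 * (2 * r * (topLevel c n + A.size / n + 1)) :=
        Nat.mul_le_mul_left _ (Nat.mul_le_mul_right _ hr)
    _ = r * period c A := by unfold period; ring

/-- The stride of the arrays. -/
def strideOf (c n : ℕ) : ℕ := n + topLevel c n + 2

def mainSlack (c : ℕ) : ℕ := 16 * startPeriod c + 40

/-- The state before source `s` is processed. -/
structure Head (w c : ℕ) (A : AdjLists G) (s : ℕ) (F : Feed) (σ : State) : Prop where
  one : σ.reg 17 = 1
  src : σ.reg 18 = s
  size : σ.reg 19 = n
  top : σ.reg 20 = topLevel c n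
  inf : σ.reg 21 = infinity c n
  stride : σ.reg 23 = strideOf c n
  ready : Ready n F σ
  cnt : σ.reg 8 = F.period
  feed_period : F.period = period c A
  feed_slack : F.slack = mainSlack c
  feed_inf : F.inf = infinity c n
  feed_src : 1 ≤ s → F.src = s - 1
  bases : (σ.reg 22 = 0 ∧ F.base = 6 * strideOf c n) ∨ (σ.reg 22 = 6 * strideOf c n ∧ F.base = 0)
  stored : F.Stored n σ.mem
  val_lt : ∀ t < n, F.val t < 2 ^ w
  used : ∀ a, σ.mem a ≠ none → a < 12 * strideOf c n
  reg_lt : ∀ r, σ.reg r < 2 ^ w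
  enough : s < n → n ≤ 2 * (F.pending n (σ.reg 6)).length

theorem Instr.step_reg_lt {i : Instr} {σ τ : State} {o : Option Output}
    (h : i.step w A σ = some (τ, o)) (hr : ∀ r, σ.reg r < 2 ^ w) (r : ℕ) : τ.reg r < 2 ^ w := by
  have key : ∀ d x r, (σ.setReg w d x).reg r < 2 ^ w := by
    intro d x r
    simp only [State.setReg, Function.update_apply]
    split_ifs
    · exact Nat.mod_lt _ (by positivity)
    · exact hr r
  cases i with
  | load d b =>
    simp only [Instr.step, Option.map_eq_some_iff, Prod.mk.injEq] at h
    obtain ⟨x, _, h, _⟩ := h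
    exact h ▸ key _ _ _
  | degree d v =>
    simp only [Instr.step] at h
    split_ifs at h
    simp only [Option.some.injEq, Prod.mk.injEq] at h
    exact h.1 ▸ key _ _ _
  | neighbor d v i =>
    simp only [Instr.step] at h
    split_ifs at h
    simp only [Option.map_eq_some_iff, Prod.mk.injEq] at h
    obtain ⟨x, _, h, _⟩ := h
    exact h ▸ key _ _ _
  | weight d v i =>
    simp only [Instr.step] at h
    split_ifs at h
    simp only [Option.map_eq_some_iff, Prod.mk.injEq] at h
    obtain ⟨x, _, h, _⟩ := h
    exact h ▸ key _ _ _
  | store b x =>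
    simp only [Instr.step, Option.some.injEq, Prod.mk.injEq] at h
    exact h.1 ▸ hr r
  | emit s t x =>
    simp only [Instr.step, Option.some.injEq, Prod.mk.injEq] at h
    exact h.1 ▸ hr r
  | emitInf s t =>
    simp only [Instr.step, Option.some.injEq, Prod.mk.injEq] at h
    exact h.1 ▸ hr r
  | _ =>
    simp only [Instr.step, Option.some.injEq, Prod.mk.injEq] at h
    exact h.1 ▸ key _ _ _

theorem Exec.reg_lt {P : Program} {σ τ : State} {tr : List (Option Output)}
    (h : Exec w A P σ tr τ) (hr : ∀ r, σ.reg r < 2 ^ w) : ∀ r, τ.reg r < 2 ^ w := by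
  induction h with
  | instr h => exact Instr.step_reg_lt h hr
  | seq _ _ ih₁ ih₂ => exact ih₂ (ih₁ hr)
  | ite_true _ _ ih => exact ih hr
  | ite_false _ _ ih => exact ih hr
  | while_true _ _ _ ih₁ ih₂ => exact ih₂ (ih₁ hr)
  | while_false _ => exact hr

section Bounds

variable {c : ℕ}

theorem infinity_pos (c n : ℕ) : 0 < infinity c n := by unfold infinity; positivity

theorem stride_lt (hw : 2 ^ 14 * infinity c n ≤ 2 ^ w) : 12 * strideOf c n < 2 ^ w := by
  have := size_lt_infinity (n := n) c
  have := topLevel_lt c n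
  unfold strideOf
  omega

theorem period_lt (A : AdjLists G) (hw : 2 ^ 14 * infinity c n ≤ 2 ^ w) :
    period c A < 2 ^ w := by
  have := size_lt_infinity (n := n) c
  have := topLevel_lt c n
  have : A.size / n ≤ n := Nat.div_le_of_le_mul A.size_le
  unfold period
  omega

theorem startPeriod_lt (hn : 1 ≤ n) (hw : 2 ^ 14 * infinity c n ≤ 2 ^ w) :
    startPeriod c < 2 ^ w := by
  have := lt_infinity c hn
  unfold startPeriod
  omega

theorem Env.good {E : Env} (hw : 2 ^ 14 * infinity c n ≤ 2 ^ w) (hsrc : E.src < n)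
    (htop : E.top = topLevel c n) (hinf : E.inf = infinity c n)
    (hstride : E.stride = strideOf c n) (hbase : E.base ≤ 6 * strideOf c n) : E.Good n w where
  mem := by
    have := stride_lt hw
    rw [hstride]
    omega
  size := by
    have := size_lt_infinity (n := n) c
    omega
  stride_eq := by rw [hstride, htop, strideOf]
  top_ge := by
    rw [htop]
    unfold topLevel
    omega
  inf_eq := by
    rw [hinf, htop]
    simp [infinity, topLevel]
  inf_lt := by
    have := infinity_pos c n
    rw [hinf]
    omega
  src_lt := hsrc

/-- Both `n + 1` and `n` are at most `2 ^ Nat.size n`, so `c + 1` such factors suffice, and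
`infinity` has one more. -/
theorem weight_lt_infinity (hn : 1 ≤ n) (c : ℕ) : (n + 1) * n ^ c < infinity c n := by
  have h₁ : n < 2 ^ Nat.size n := Nat.lt_size_self n
  have h₂ := size_pos hn
  calc (n + 1) * n ^ c ≤ 2 ^ Nat.size n * (2 ^ Nat.size n) ^ c :=
        Nat.mul_le_mul h₁ (Nat.pow_le_pow_left h₁.le c)
    _ = 2 ^ ((c + 1) * Nat.size n) := by rw [← pow_mul, ← pow_add]; ring_nf
    _ < infinity c n := by
        refine Nat.pow_lt_pow_right (by norm_num) ?_
        exact Nat.mul_lt_mul_of_pos_right (by omega) h₂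

/-- The single-source computation, on an empty memory. -/
theorem runs_singleSource (hn : 1 ≤ n) (hG : ∀ u v, G.graph.Adj u v → G.weight u v ≤ n ^ c)
    (hw : 2 ^ 14 * infinity c n ≤ 2 ^ w) {E : Env} (hsrc : E.src < n)
    (htop : E.top = topLevel c n) (hinf : E.inf = infinity c n)
    (hstride : E.stride = strideOf c n) (hbase : E.base ≤ 6 * strideOf c n)
    {r : ℕ → ℕ} (hpar : ∀ p : Param, r p.reg = E.par n p) (hlt : ∀ x, r x < 2 ^ w) :
    Runs w A (prepare ;; dijkstra) ⟨r, fun _ => none⟩ fun k τ =>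
      ∃ s, Sim w E n τ s ∧
        (∀ t : Fin n, G.dist ⟨E.src, hsrc⟩ t =
          if s.arr .dist t = E.inf then ⊤ else (s.arr .dist t : ℕ∞)) ∧
        k ≤ 256 * (n * topLevel c n + A.size) := by
  have hgood := Env.good hw hsrc htop hinf hstride hbase
  have hmem : E.base + 6 * E.stride < 2 ^ w := by
    have := stride_lt hw
    rw [hstride]
    omega
  refine .seq (.mono (runs_prepare hpar hlt hmem) ?_)
  rintro k₁ σ ⟨s, hsim, harr, hk₁⟩
  refine .mono (computes_dijkstra hgood (src := ⟨E.src, hsrc⟩) rfl hG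
    (by rw [hinf]; exact weight_lt_infinity hn c) harr σ hsim) ?_
  rintro k₂ τ ⟨s', hsim', hdist, hk₂⟩
  refine ⟨s', hsim', hdist, ?_⟩
  rw [hstride, strideOf] at hk₁
  rw [htop] at hk₂
  have h₁ : n * 3 ≤ n * topLevel c n := Nat.mul_le_mul_left n (by unfold topLevel; omega)
  have h₂ : topLevel c n ≤ n * topLevel c n := Nat.le_mul_of_pos_left _ hn
  omega

end Bounds

theorem pending_eq_rowList {F : Feed} {s : ℕ} (hs : s < n) (hsrc : F.src = s)
    (hval : ∀ t : Fin n, G.dist ⟨s, hs⟩ t = if F.val t = F.inf then ⊤ else (F.val t : ℕ∞)) :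
    F.pending n 0 = rowList G s := by
  unfold Feed.pending rowList
  rw [Nat.sub_zero, ← List.range_eq_range', hsrc]
  refine List.map_congr_left fun t ht => ?_
  have ht' : t < n := List.mem_range.1 (List.mem_of_mem_filter ht)
  simp [Feed.out, distOut, hsrc, hs, ht', hval ⟨t, ht'⟩]

theorem high_singleSource : (prepare ;; dijkstra).high = true := rfl

theorem high_prelude (c : ℕ) : (prelude c).high = true := rfl

end APSD

/-! ### Processing a source while the preceding row is emitted. -/

namespace APSD

variable {n : ℕ} {G : WeightedGraph n} {w : ℕ} {A : AdjLists G} {c : ℕ}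

theorem Runs.nop {σ : State} {Q : ℕ → State → Prop}
    (h : Q 1 ⟨Function.update σ.reg 16 (σ.reg 16 % 2 ^ w), σ.mem⟩) : Runs w A APSD.nop σ Q :=
  .instr rfl h

theorem Head.fits (hw : 2 ^ 14 * infinity c n ≤ 2 ^ w) {s : ℕ} {F : Feed} {σ : State}
    (h : Head w c A s F σ) : F.Fits w n where
  size := by
    have := size_lt_infinity (n := n) c
    omega
  mem := by
    have := stride_lt (n := n) hw
    have h₁ : n ≤ strideOf c n := by unfold strideOf; omega
    rcases h.bases with ⟨_, h₂⟩ | ⟨_, h₂⟩ <;> omega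
  period := by
    rw [h.feed_period]
    exact period_lt A hw
  slack := by
    rw [h.feed_slack]
    unfold mainSlack
    omega
  val := h.val_lt

/-- A bound on the number of steps since the last output before each source. -/
def headGap (c : ℕ) : ℕ := 16 * startPeriod c + 30

/-- A bound on the delay. -/
def maxDelay (c : ℕ) (A : AdjLists G) : ℕ := 16 * period c A + mainSlack c + 16

/-- The effect of `switch`, up to skipping the source. -/
theorem exec_switch {F : Feed} {σ : State} {s b b' q : ℕ} (hF : F.Fits w n)
    (h0 : σ.reg 0 = 0) (h1 : σ.reg 1 = 1) (h2 : σ.reg 2 = n) (h3 : σ.reg 3 = F.inf)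
    (h4 : σ.reg 4 = b') (h7 : σ.reg 7 = q) (h17 : σ.reg 17 = 1) (h18 : σ.reg 18 = s)
    (h22 : σ.reg 22 = b) (hb : b < 2 ^ w) (hb' : b' < 2 ^ w) (hq : q < 2 ^ w) (hq0 : 1 ≤ q)
    (hs : s < n) (hFb : F.base = b) (hFs : F.src = s) (hFq : F.period = q) :
    ∃ τ, Exec w A switch σ (List.replicate 9 none) τ ∧ τ.mem = σ.mem ∧ Ready n F τ ∧
      τ.reg 8 = q ∧ τ.reg 18 = s + 1 ∧ τ.reg 22 = b' ∧
      (∀ r, 16 ≤ r → r ≠ 18 → r ≠ 22 → τ.reg r = σ.reg r) ∧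
      F.pending n (τ.reg 6) = F.pending n 0 := by
  have hsz := hF.size
  suffices h : Runs w A switch σ fun k τ => k = 9 ∧ τ.mem = σ.mem ∧ Ready n F τ ∧
      τ.reg 8 = q ∧ τ.reg 18 = s + 1 ∧ τ.reg 22 = b' ∧
      (∀ r, 16 ≤ r → r ≠ 18 → r ≠ 22 → τ.reg r = σ.reg r) ∧
      F.pending n (τ.reg 6) = F.pending n 0 by
    obtain ⟨k, τ, h₁, rfl, h₂⟩ := h
    exact ⟨τ, h₁, h₂⟩
  refine .seq_move (v := b) h22 hb ?_
  refine .seq_move (v := b') (by simp [h4]) hb' ?_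
  refine .seq_move (v := b) (by simp) hb ?_
  refine .seq_move (v := s) (by simp [h18]) (by omega) ?_
  refine .seq_move (v := 0) (by simp [h0]) (by omega) ?_
  refine .seq_move (v := q) (by simp [h7]) hq ?_
  refine .seq_add (v := s + 1) (by simp [h17, h18]) (by omega) ?_
  obtain ⟨τ, h₁, h₂, h₃, h₄, h₅⟩ := exec_skipSrc (A := A) (F := F) (w := w) (σ :=
    ⟨Function.update (Function.update (Function.update (Function.update (Function.update
      (Function.update (Function.update σ.reg 9 b) 22 b') 4 b) 5 s) 6 0) 8 q) 18 (s + 1), σ.mem⟩)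
    hF (by simp [h1]) (by simp [hFs]) (by simp)
  refine ⟨2, τ, h₁, rfl, h₂.mem, ⟨⟨?_, ?_, ?_, ?_, ?_, ?_, fun _ => h₄, ?_⟩, ?_, ?_⟩, ?_, ?_, ?_,
    ?_, ?_⟩
  · rw [h₃ _ (by norm_num) (by norm_num)]; simp [h0]
  · rw [h₃ _ (by norm_num) (by norm_num)]; simp [h1]
  · rw [h₃ _ (by norm_num) (by norm_num)]; simp [h2]
  · rw [h₃ _ (by norm_num) (by norm_num)]; simp [h3]
  · rw [h₃ _ (by norm_num) (by norm_num)]; simp [hFb]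
  · rw [h₃ _ (by norm_num) (by norm_num)]; simp [hFs]
  · rw [h₃ _ (by norm_num) (by norm_num)]; simp [h7, hFq]
  · rw [h₃ _ (by norm_num) (by norm_num)]; simpa using hq0
  · rw [h₃ _ (by norm_num) (by norm_num)]; simp [hFq]
  · rw [h₃ _ (by norm_num) (by norm_num)]; simp
  · rw [h₂.reg _ (by norm_num)]; simp
  · rw [h₂.reg _ (by norm_num)]; simp
  · intro r hr hr' hr''
    rw [h₂.reg r hr]
    simp only [Function.update_apply]
    repeat rw [if_neg (by omega)]
  · rw [h₅]; simp

/-- The fuel exceeds the running time, so some outputs are still pending when the run ends. Flushing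
them makes the last output recent, whatever the run did, so the gap at the next source is bounded
again. Then the two memory regions exchange their roles. -/
theorem exec_processSource (hn : 1 ≤ n) (hG : ∀ u v, G.graph.Adj u v → G.weight u v ≤ n ^ c)
    (hw : 2 ^ 14 * infinity c n ≤ 2 ^ w) {s : ℕ} {F : Feed} {σ : State} (h : Head w c A s F σ)
    (hs : s < n) :
    ∃ tr τ F', Exec w A processSource σ tr τ ∧ Head w c A (s + 1) F' τ ∧
      outputs tr = F.pending n (σ.reg 6) ∧ F'.pending n (τ.reg 6) = rowList G s ∧
      Paced (maxDelay c A) (headGap c + 1) tr (headGap c) := by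
  have hF := h.fits hw
  have hst := stride_lt (n := n) hw
  set E : Env := ⟨s, topLevel c n, infinity c n, σ.reg 22, strideOf c n⟩ with hEdef
  have hbase : E.base ≤ 6 * strideOf c n := by
    show σ.reg 22 ≤ _
    rcases h.bases with ⟨h₂, _⟩ | ⟨h₂, _⟩ <;> omega
  have hpar : ∀ p : Param, σ.reg p.reg = E.par n p := by
    intro p
    cases p
    · exact h.one
    · exact h.src
    · exact h.size
    · exact h.top
    · exact h.inf
    · rfl
    · exact h.stride
  obtain ⟨k, τ₀, hrun, st, hsim, hdist, hk⟩ := runs_singleSource (A := A) hn hG hw (E := E) hs rfl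
    rfl rfl hbase hpar h.reg_lt
  have hunused : ∀ a, ¬ (E.base ≤ a ∧ a < E.base + 6 * strideOf c n) → τ₀.mem a = none := by
    intro a ha
    refine hsim.unused a fun k i hi e => ha ?_
    have := Env.addr_lt (k := k) hi
    rw [e]
    exact ⟨by unfold Env.addr; omega, this⟩
  have hle : n ≤ strideOf c n := by unfold strideOf; omega
  -- The run writes only in one of the regions of `6 * stride` words, and the row to be emitted is
  -- in the other.
  have hdisj : ∀ t < n, τ₀.mem (F.base + t) = none := by
    intro t ht
    refine hunused _ ?_
    show ¬ (σ.reg 22 ≤ _ ∧ _ < σ.reg 22 + _)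
    rcases h.bases with ⟨h₂, h₃⟩ | ⟨h₂, h₃⟩ <;> omega
  have henough := enough_time c A hn (h.enough hs)
  have hfuel : F.fuel n σ = (F.pending n (σ.reg 6)).length * period c A + F.period := by
    rw [Feed.fuel, h.cnt, h.feed_period]
  -- The silent run starts in an empty memory, and the whole actual memory plays the role of `m₀`.
  -- Stale words in the region that is reused are therefore invisible to the run.
  obtain ⟨tr₁, σ₁, hx₁, hext, hadv⟩ := hrun.interleave hF h.stored high_singleSource
    (fun o ho => List.eq_of_mem_replicate ho) hdisj (σ' := σ)
    ⟨fun _ _ => rfl, fun _ => rfl⟩ h.ready (by rw [List.length_replicate, hfuel]; omega)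
  rw [List.length_replicate] at hadv
  have hfuel₁ := hadv.fuel
  rw [hfuel, Feed.fuel] at hfuel₁
  have hcnt₁ := hadv.ready.cnt_le
  have hcnt₁' := hadv.ready.cnt_pos
  have hne : F.pending n (σ₁.reg 6) ≠ [] := by
    intro e
    rw [e] at hfuel₁
    simp at hfuel₁
    omega
  have hstored₁ : F.Stored n σ₁.mem := by
    intro h₁ t ht
    rw [hext.mem, hdisj t ht, Option.none_or, h.stored h₁ t ht]
  obtain ⟨tr₂, σ₂, hx₂, hsame, hfeed, hdone, hout, hpace⟩ := exec_flush (A := A) hF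
    hadv.ready.toFeeding hstored₁
  have hpar₂ : ∀ p : Param, σ₂.reg p.reg = E.par n p := by
    intro p
    have := p.reg_le
    rw [hsame.reg _ (by omega), hext.reg _ (by omega), hsim.par]
  set F' : Feed := ⟨infinity c n, σ.reg 22, s, period c A, mainSlack c, st.arr .dist⟩ with hF'def
  have hval' : ∀ t < n, F'.val t < 2 ^ w := fun t ht => hsim.arr_lt _ _ (by
    show t < strideOf c n
    omega)
  have hF' : F'.Fits w n := by
    refine ⟨hF.size, ?_, period_lt A hw, ?_, hval'⟩
    · have : F'.base ≤ 6 * strideOf c n := hbase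
      omega
    · show 4 ≤ mainSlack c
      unfold mainSlack
      omega
  have hq : 1 ≤ period c A := Nat.mul_pos (by norm_num) (Nat.succ_pos _)
  obtain ⟨σ₃, hx₃, hmem₃, hready₃, h8, h18, h22, hreg₃, hpend₃⟩ := exec_switch (A := A) (F := F')
    (σ := σ₂) (b := σ.reg 22) (b' := F.base) (q := period c A) (s := s) hF'
    hfeed.zero hfeed.one hfeed.size (hfeed.inf.trans h.feed_inf) hfeed.base
    (hfeed.period.trans h.feed_period) (hpar₂ .one) (hpar₂ .src) (hpar₂ .base) (h.reg_lt _)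
    (by rcases h.bases with ⟨_, h₃⟩ | ⟨_, h₃⟩ <;> omega) (period_lt A hw) hq hs rfl rfl rfl
  have hrow : F'.pending n 0 = rowList G s := pending_eq_rowList hs rfl hdist
  have hmem₂ : ∀ a, σ₃.mem a = (τ₀.mem a).or (σ.mem a) := by
    intro a
    rw [hmem₃, hsame.mem, hext.mem]
  refine ⟨_, σ₃, F', .seq hx₁ (.seq hx₂ hx₃), ?_, ?_, by rw [hpend₃, hrow], ?_⟩
  · constructor
    · rw [hreg₃ 17 (by norm_num) (by norm_num) (by norm_num)]
      exact hpar₂ .one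
    · exact h18
    · rw [hreg₃ 19 (by norm_num) (by norm_num) (by norm_num)]
      exact hpar₂ .size
    · rw [hreg₃ 20 (by norm_num) (by norm_num) (by norm_num)]
      exact hpar₂ .top
    · rw [hreg₃ 21 (by norm_num) (by norm_num) (by norm_num)]
      exact hpar₂ .inf
    · rw [hreg₃ 23 (by norm_num) (by norm_num) (by norm_num)]
      exact hpar₂ .stride
    · exact hready₃
    · exact h8
    · rfl
    · rfl
    · rfl
    · exact fun _ => rfl
    · rw [h22]
      show (F.base = 0 ∧ σ.reg 22 = _) ∨ (F.base = _ ∧ σ.reg 22 = 0)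
      rcases h.bases with ⟨h₂, h₃⟩ | ⟨h₂, h₃⟩
      · exact .inr ⟨h₃, h₂⟩
      · exact .inl ⟨h₃, h₂⟩
    · intro _ t ht
      have h₁ := hsim.arr .dist t (show t < strideOf c n by omega)
      -- The distances are the first array of the region, so the new row starts at its base.
      have h₂ : E.addr .dist t = F'.base + t := by simp [Env.addr, Arr.idx, hEdef, hF'def]
      rw [h₂] at h₁
      rw [hmem₂, h₁]
      rfl
    · exact hval'
    · intro a ha
      rw [hmem₂] at ha
      by_contra hge
      refine ha ?_
      rw [hunused a (by omega), Option.none_or]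
      by_contra h₁
      exact hge (h.used a h₁)
    · exact Exec.reg_lt (.seq hx₁ (.seq hx₂ hx₃)) h.reg_lt
    -- Another source exists only if `n ≥ 2`, and then a row of `n - 1` outputs has at least `n / 2`
    -- of them.
    · intro hs'
      rw [hpend₃, hrow, length_rowList hs]
      omega
  · rw [outputs_append, outputs_append, outputs_replicate, List.append_nil, hout]
    exact hadv.out.symm
  · have hD : F.delay = maxDelay c A := by
      rw [Feed.delay, h.feed_period, h.feed_slack, maxDelay]
    have h₁ := hadv.paced
    rw [hD, Feed.lag, Feed.lag, h.cnt, h.feed_slack] at h₁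
    have h₂ := hpace (maxDelay c A) (16 * (F.period - σ₁.reg 8) + mainSlack c)
      (by unfold maxDelay; omega) (by rw [h.feed_period] at *; unfold maxDelay; omega)
    rw [if_neg hne] at h₂
    refine ((h₁.append (h₂.append (Paced.replicate 9)))).mono ?_ ?_
    · unfold headGap mainSlack
      omega
    · unfold headGap
      omega

/-- Processing all sources. -/
theorem exec_sources (hn : 1 ≤ n) (hG : ∀ u v, G.graph.Adj u v → G.weight u v ≤ n ^ c)
    (hw : 2 ^ 14 * infinity c n ≤ 2 ^ w) {s : ℕ} {F : Feed} {σ : State} (h : Head w c A s F σ)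
    (hs : s ≤ n) :
    ∃ tr τ F', Exec w A (.while (.lt 18 19) processSource) σ tr τ ∧ Head w c A n F' τ ∧
      outputs tr ++ F'.pending n (τ.reg 6) =
        F.pending n (σ.reg 6) ++ (List.range' s (n - s)).flatMap (rowList G) ∧
      Paced (maxDelay c A) (headGap c) tr (headGap c + 1) := by
  induction hd : n - s generalizing s F σ with
  | zero =>
    obtain rfl : s = n := by omega
    refine ⟨_, σ, F, .while_false ?_, h, ?_, Paced.replicate 1⟩
    · simp [Cond.Holds, h.src, h.size]
    · simp [outputs]
  | succ d ih =>
    obtain ⟨tr₁, ρ, F₁, h₁, h₂, h₃, h₄, h₅⟩ := exec_processSource hn hG hw h (by omega)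
    obtain ⟨tr₂, τ, F₂, h₆, h₇, h₈, h₉⟩ := ih h₂ (by omega) (by omega)
    refine ⟨_, τ, F₂, .while_true ?_ h₁ h₆, h₇, ?_, .cons_none (h₅.append h₉)⟩
    · simp only [Cond.Holds, h.src, h.size]
      omega
    · rw [show outputs (none :: (tr₁ ++ tr₂)) = outputs tr₁ ++ outputs tr₂ by
        rw [← outputs_append]; rfl, List.append_assoc, h₈, h₃, h₄, List.range'_succ,
        List.flatMap_cons]

end APSD

/-! ### The first phase, the complete run, and the constants. -/

namespace APSD

variable {n : ℕ} {G : WeightedGraph n} {w : ℕ} {A : AdjLists G} {c : ℕ}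

/-- The outputs for the pairs `(t, t)`. -/
def diagList (n : ℕ) : List Output := (List.range n).map fun t => (t, t, 0)

theorem Feed.pending_diag {F : Feed} (h : F.src = n) (t : ℕ) :
    F.pending n t = (List.range' t (n - t)).map fun t => (t, t, 0) := by
  have h₁ : (List.range' t (n - t)).filter (· ≠ F.src) = List.range' t (n - t) := by
    rw [List.filter_eq_self]
    intro x hx
    rw [List.mem_range'_1] at hx
    simp
    omega
  rw [Feed.pending, h₁]
  refine List.map_congr_left fun x _ => ?_
  simp [Feed.out, h]

theorem runs_setup (hn : 1 ≤ n) (hw : 2 ^ 14 * infinity c n ≤ 2 ^ w) :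
    Runs w A (setup c) State.init fun k σ => k = 8 ∧ σ.mem = (fun _ => none) ∧ σ.reg 0 = 0 ∧
      σ.reg 1 = 1 ∧ σ.reg 2 = n ∧ σ.reg 3 = 0 ∧ σ.reg 4 = 0 ∧ σ.reg 5 = n ∧ σ.reg 6 = 0 ∧
      σ.reg 7 = startPeriod c ∧ σ.reg 8 = startPeriod c ∧ σ.reg 17 = 1 ∧ σ.reg 19 = n ∧
      ∀ r, 18 ≤ r → r ≠ 19 → σ.reg r = 0 := by
  have h₁ := startPeriod_lt hn hw
  have h₂ := size_lt_infinity (n := n) c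
  refine .seq (.instr (τ := ⟨Function.update State.init.reg 2 n, fun _ => none⟩) ?_ ?_)
  · rw [Instr.step, State.setReg, Nat.mod_eq_of_lt (by omega)]
    rfl
  refine .seq_const (by omega) (.seq_const (by omega) ?_)
  refine .seq_move (v := n) (by simp) (by omega) ?_
  refine .seq_move (v := n) (by simp) (by omega) ?_
  refine .seq_const h₁ ?_
  refine .seq_move (v := startPeriod c) (by simp) h₁ ?_
  refine .nop ?_
  simp [State.init]
  intro r hr hr'
  simp [Function.update_apply]
  repeat rw [if_neg (by omega)]
  exact fun _ => rfl

theorem runs_setParams {σ : State} {K I N q : ℕ} (hw : 12 * N < 2 ^ w) (hK : K < 2 ^ w)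
    (hI : I < 2 ^ w) (hq : q < 2 ^ w) (h1 : σ.reg 39 = K) (h2 : σ.reg 35 = I) (h3 : σ.reg 40 = N)
    (h4 : σ.reg 37 = q) :
    Runs w A setParams σ fun k τ => k = 10 ∧ τ.mem = σ.mem ∧ τ.reg 20 = K ∧ τ.reg 21 = I ∧
      τ.reg 23 = N ∧ τ.reg 3 = I ∧ τ.reg 7 = q ∧ τ.reg 8 = q ∧ τ.reg 4 = 6 * N ∧
      ∀ r < 23, r ∉ [3, 4, 7, 8, 16, 20, 21] → τ.reg r = σ.reg r := by
  refine .seq_move (v := K) (by simp [h1]) hK ?_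
  refine .seq_move (v := I) (by simp [h2]) hI ?_
  refine .seq_move (v := N) (by simp [h3]) (by omega) ?_
  refine .seq_move (v := I) (by simp [h2]) hI ?_
  refine .seq_move (v := q) (by simp [h4]) hq ?_
  refine .seq_move (v := q) (by simp) hq ?_
  refine .seq_add (v := 2 * N) (by simp; omega) (by omega) ?_
  refine .seq_add (v := 3 * N) (by simp; omega) (by omega) ?_
  refine .seq_add (v := 6 * N) (by simp; omega) (by omega) ?_
  refine .nop ?_
  simp
  intro r hr h3 h4 h7 h8 h16 h20 h21
  simp [Function.update_apply, h3, h4, h7, h8, h16, h20, h21]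
  omega

/-- The computation up to the first source. -/
theorem exec_start (hn : 1 ≤ n) (hw : 2 ^ 14 * infinity c n ≤ 2 ^ w) :
    ∃ tr₁ tr₂ tr₃ σ₁ σ₂ τ F, Exec w A (setup c) State.init tr₁ σ₁ ∧
      Exec w A (prelude c).interleave σ₁ tr₂ σ₂ ∧ Exec w A setParams σ₂ tr₃ τ ∧
      Head w c A 0 F τ ∧
      outputs tr₁ ++ (outputs tr₂ ++ outputs tr₃) ++ F.pending n (τ.reg 6) = diagList n ∧
      Paced (maxDelay c A) 0 (tr₁ ++ (tr₂ ++ tr₃)) (headGap c) := by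
  have hI := size_lt_infinity (n := n) c
  have hK := topLevel_lt c n
  have hsp := startPeriod_lt (c := c) hn hw
  obtain ⟨k₁, σ₁, hx₁, rfl, hmem₁, e0, e1, e2, e3, e4, e5, e6, e7, e8, e17, e19, er⟩ :=
    runs_setup (A := A) hn hw
  set E₀ : Env := ⟨0, 0, 0, 0, 0⟩ with hE₀
  -- The source `n` stands for the diagonal, which needs no stored row.
  set F₀ : Feed := ⟨0, 0, n, startPeriod c, 8, fun _ => 0⟩ with hF₀
  have hsim₁ : Sim w E₀ n σ₁ ⟨fun _ => 0, fun _ _ => 0⟩ := by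
    constructor
    · intro p
      cases p
      · exact e17
      · exact er 18 (by norm_num) (by norm_num)
      · exact e19
      · exact er 20 (by norm_num) (by norm_num)
      · exact er 21 (by norm_num) (by norm_num)
      · exact er 22 (by norm_num) (by norm_num)
      · exact er 23 (by norm_num) (by norm_num)
    · intro p
      cases p <;> simp only [Env.par, hE₀] <;> omega
    · intro x
      have := x.le_reg
      exact er _ (by omega) (by omega)
    · intro x
      positivity
    · intro k
      have := k.reg_le
      rw [er _ (by omega) (by omega)]
      simp [Env.addr, hE₀]
    · intro k i hi
      simp [hE₀] at hi
    · intro k i hi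
      positivity
    · intro a _
      rw [hmem₁]
  have hfits₀ : F₀.Fits w n := ⟨by omega, by simp [hF₀]; omega, hsp, by simp [hF₀],
    fun t _ => by simp [hF₀]⟩
  have hsp0 : 1 ≤ startPeriod c := by unfold startPeriod; omega
  have hready₀ : Ready n F₀ σ₁ := by
    refine ⟨⟨e0, e1, e2, e3, e4, e5, fun _ => ?_, e7⟩, ?_, ?_⟩
    · rw [e6]
      simp [hF₀]
      omega
    · rw [e8]
      exact hsp0
    · rw [e8]
  have hpend₀ : F₀.pending n (σ₁.reg 6) = diagList n := by
    rw [e6, Feed.pending_diag rfl, diagList, List.range_eq_range']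
    rfl
  have hfuel₀ : F₀.fuel n σ₁ = n * startPeriod c + startPeriod c := by
    rw [Feed.fuel, hpend₀, e8]
    simp [diagList, hF₀]
  obtain ⟨k₂, τ₀, hrun, st, hsim, hk, hy, hg, he, hcost⟩ :=
    computes_prelude (A := A) hn hw _ σ₁ hsim₁
  have hnone : ∀ a, τ₀.mem a = none := fun a => hsim.unused a fun k i hi => by simp at hi
  -- The parameters use at most a quarter of the ticks that the diagonal provides, so more than half
  -- of it is left for the first source.
  have hcost' : 4 * k₂ ≤ n * startPeriod c := by
    unfold startPeriod
    calc 4 * k₂ ≤ 4 * ((5 * c + 100) * n) := by omega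
      _ = _ := by ring
  obtain ⟨tr₂, σ₂, hx₂, hext, hadv⟩ := hrun.interleave hfits₀ (m₀ := fun _ => none)
    (fun h => absurd h (lt_irrefl n)) (high_prelude c)
    (fun o ho => List.eq_of_mem_replicate ho) (fun t _ => hnone _) (σ' := σ₁)
    ⟨fun _ _ => rfl, fun a => by simp⟩ hready₀ (by
      rw [List.length_replicate, hfuel₀]
      simp [hF₀]
      omega)
  rw [List.length_replicate] at hadv
  have hfuel₂ := hadv.fuel
  have hcnt := hadv.ready.cnt_le
  have hcnt' := hadv.ready.cnt_pos
  rw [hfuel₀, Feed.fuel] at hfuel₂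
  have hvar : ∀ x : Var, σ₂.reg x.reg = st.var x := by
    intro x
    have := x.le_reg
    rw [hext.reg _ (by omega), hsim.var]
  have hpar : ∀ p : Param, σ₂.reg p.reg = E₀.par n p := by
    intro p
    have := p.reg_le
    rw [hext.reg _ (by omega), hsim.par]
  obtain ⟨k₃, σ₃, hx₃, rfl, hmem₃, f20, f21, f23, f3, f7, f8, f4, fr⟩ :=
    runs_setParams (A := A) (σ := σ₂) (K := topLevel c n) (I := infinity c n) (N := strideOf c n)
      (q := period c A) (stride_lt hw) (by omega) (by omega) (period_lt A hw)
      ((hvar .k).trans hk) ((hvar .y).trans hy) ((hvar .g).trans hg) ((hvar .e).trans he)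
  set F : Feed := ⟨infinity c n, 6 * strideOf c n, n, period c A, mainSlack c, fun _ => 0⟩ with hF
  have hmem₃' : ∀ a, σ₃.mem a = none := by
    intro a
    rw [hmem₃, hext.mem, hnone]
    rfl
  have h6 : σ₃.reg 6 = σ₂.reg 6 := fr 6 (by norm_num) (by decide)
  have hpend : F.pending n (σ₃.reg 6) = F₀.pending n (σ₂.reg 6) := by
    rw [h6, Feed.pending_diag rfl, Feed.pending_diag rfl]
  have hq : 1 ≤ period c A := Nat.mul_pos (by norm_num) (Nat.succ_pos _)
  have hready := hadv.ready
  refine ⟨_, tr₂, _, σ₁, σ₂, σ₃, F, hx₁, hx₂, hx₃, ?_, ?_, ?_⟩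
  · constructor
    · rw [fr 17 (by norm_num) (by decide)]
      exact hpar .one
    · rw [fr 18 (by norm_num) (by decide)]
      exact hpar .src
    · rw [fr 19 (by norm_num) (by decide)]
      exact hpar .size
    · exact f20
    · exact f21
    · exact f23
    · refine ⟨⟨?_, ?_, ?_, f3, f4, ?_, ?_, f7⟩, by rw [f8]; exact hq, by rw [f8]⟩
      · rw [fr 0 (by norm_num) (by decide), hready.zero]
      · rw [fr 1 (by norm_num) (by decide), hready.one]
      · rw [fr 2 (by norm_num) (by decide), hready.size]
      · rw [fr 5 (by norm_num) (by decide), hready.src]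
      · intro h
        exact h.ne
    · exact f8
    · rfl
    · rfl
    · rfl
    · omega
    · refine .inl ⟨?_, rfl⟩
      rw [fr 22 (by norm_num) (by decide)]
      exact hpar .base
    · exact fun h => absurd h (lt_irrefl n)
    · intro t _
      simp [hF]
    · intro a ha
      exact absurd (hmem₃' a) ha
    · refine Exec.reg_lt hx₃ (Exec.reg_lt hx₂ (Exec.reg_lt hx₁ fun r => ?_))
      simp [State.init]
    · intro _
      rw [hpend]
      set r := (F₀.pending n (σ₂.reg 6)).length
      have h₁ : σ₂.reg 8 ≤ startPeriod c := hcnt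
      have h₂ : r * startPeriod c + σ₂.reg 8 + k₂ = n * startPeriod c + startPeriod c := hfuel₂
      refine Nat.le_of_mul_le_mul_right (c := startPeriod c) ?_ hsp0
      rw [Nat.mul_assoc]
      omega
  · rw [outputs_replicate, outputs_replicate, hpend, ← hpend₀, hadv.out]
    simp
  · have h₁ := hadv.paced
    rw [Feed.lag, e8, Feed.lag] at h₁
    have h₂ : F₀.delay ≤ maxDelay c A := by
      show 16 * startPeriod c + 8 + 16 ≤ _
      unfold maxDelay mainSlack
      omega
    refine ((Paced.replicate 8).append (((h₁.mono_delay h₂).mono ?_ le_rfl).append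
      (Paced.replicate 10))).mono le_rfl ?_
    · simp [hF₀]
    · have h₃ : F₀.period = startPeriod c := rfl
      have h₄ : F₀.slack = 8 := rfl
      rw [h₃, h₄]
      unfold headGap
      omega

/-- The complete run. -/
theorem exec_apsd (hn : 1 ≤ n) (hG : ∀ u v, G.graph.Adj u v → G.weight u v ≤ n ^ c)
    (hw : 2 ^ 14 * infinity c n ≤ 2 ^ w) :
    ∃ tr τ, ∃ F : Feed, Exec w A (apsd c) State.init tr τ ∧
      outputs tr = diagList n ++ (List.range n).flatMap (rowList G) ∧
      (∀ d ∈ delaysFrom 0 tr, d ≤ maxDelay c A) ∧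
      (∀ a ∈ τ.usedMem, a < 12 * strideOf c n) ∧ F.src < n ∧ F.Stored n τ.mem := by
  obtain ⟨tr₁, tr₂, tr₃, σ₁, σ₂, σ₃, F₃, h₁, h₂, h₃, h₄, h₅, h₆⟩ := exec_start (A := A) hn hw
  obtain ⟨tr₄, σ₄, F₄, h₇, h₈, h₉, h₁₀⟩ := exec_sources hn hG hw h₄ (Nat.zero_le n)
  obtain ⟨tr₅, σ₅, h₁₁, h₁₂, h₁₃, h₁₄, h₁₅, h₁₆⟩ := exec_flush (A := A) (h₈.fits hw)
    h₈.ready.toFeeding h₈.stored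
  -- As there is at least one source, the last feed is a stored row of `n` words. This yields the
  -- lower bound on the space.
  have hsrc := h₈.feed_src hn
  refine ⟨_, σ₅, F₄, .seq h₁ (.seq h₂ (.seq h₃ (.seq h₇ h₁₁))), ?_, ?_, ?_, by omega, ?_⟩
  · simp only [outputs_append]
    rw [h₁₅, h₉, Nat.sub_zero, ← List.range_eq_range', ← h₅]
    simp only [List.append_assoc]
  · have h₁₇ : headGap c + 1 + 6 ≤ maxDelay c A := by
      unfold headGap maxDelay mainSlack
      omega
    have h₁₈ := h₁₆ (maxDelay c A) (headGap c + 1) (by unfold headGap at h₁₇; omega) h₁₇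
    have h₁₉ := h₆.append (h₁₀.append h₁₈)
    have h₂₀ := h₁₉ 0 le_rfl
    simp only [List.append_assoc] at h₂₀
    refine le_of_mem_delaysFrom h₂₀.1 (h₂₀.2.trans ?_)
    split_ifs <;> omega
  · intro a ha
    refine h₈.used a ?_
    rw [← h₁₂.mem]
    exact ha
  · rw [h₁₂.mem]
    exact h₈.stored

theorem WeightedGraph.dist_self (G : WeightedGraph n) (s : Fin n) : G.dist s s = 0 :=
  nonpos_iff_eq_zero.1 (iInf₂_le 0 (.nil s))

theorem distOut_eq (s t : Fin n) : distOut G s t = ((s : ℕ), (t : ℕ), G.dist s t) := by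
  simp [distOut]

/-- Diagonal outputs have equal coordinates, and those in row `s` have first coordinate `s` and a
different second one, so the lists are disjoint. -/
theorem nodup_outputs (G : WeightedGraph n) :
    (diagList n ++ (List.range n).flatMap (rowList G)).Nodup := by
  have hdiag : ∀ o ∈ diagList n, o.1 = o.2.1 := by
    intro o ho
    obtain ⟨t, _, rfl⟩ := List.mem_map.1 ho
    rfl
  have hrow : ∀ s, ∀ o ∈ rowList G s, o.1 = s ∧ o.2.1 ≠ s := by
    intro s o ho
    obtain ⟨t, ht, rfl⟩ := List.mem_map.1 ho
    refine ⟨rfl, show t ≠ s from ?_⟩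
    simpa using List.of_mem_filter ht
  rw [List.nodup_append']
  refine ⟨?_, ?_, ?_⟩
  · exact List.nodup_range.map fun a b h => (Prod.mk.inj h).1
  · rw [List.nodup_flatMap]
    refine ⟨fun s _ => ?_, ?_⟩
    · exact (List.nodup_range.filter _).map fun a b h => (Prod.mk.inj (Prod.mk.inj h).2).1
    · refine List.nodup_range.imp fun {s s'} hne o ho ho' => hne ?_
      rw [← (hrow s o ho).1, (hrow s' o ho').1]
  · intro o ho ho'
    obtain ⟨s, _, hs⟩ := List.mem_flatMap.1 ho'
    have h₁ := hrow s o hs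
    exact h₁.2 ((hdiag o ho).symm.trans h₁.1)

theorem mem_outputs_iff (G : WeightedGraph n) (o : Output) :
    o ∈ diagList n ++ (List.range n).flatMap (rowList G) ↔
      ∃ s t : Fin n, o = ((s : ℕ), (t : ℕ), G.dist s t) := by
  rw [List.mem_append, List.mem_flatMap]
  constructor
  · rintro (h | ⟨s, hs, h⟩)
    · obtain ⟨t, ht, rfl⟩ := List.mem_map.1 h
      exact ⟨⟨t, List.mem_range.1 ht⟩, ⟨t, List.mem_range.1 ht⟩, by rw [G.dist_self]⟩
    · obtain ⟨t, ht, rfl⟩ := List.mem_map.1 h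
      have ht' := List.mem_range.1 (List.mem_of_mem_filter ht)
      exact ⟨⟨s, List.mem_range.1 hs⟩, ⟨t, ht'⟩, distOut_eq ⟨s, List.mem_range.1 hs⟩ ⟨t, ht'⟩⟩
  · rintro ⟨s, t, rfl⟩
    by_cases hst : s = t
    · subst hst
      rw [G.dist_self]
      exact .inl (List.mem_map.2 ⟨s, List.mem_range.2 s.2, rfl⟩)
    · refine .inr ⟨s, List.mem_range.2 s.2, List.mem_map.2 ⟨t, ?_, distOut_eq s t⟩⟩
      refine List.mem_filter.2 ⟨List.mem_range.2 t.2, ?_⟩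
      simpa using fun e => hst (Fin.ext e).symm

theorem AdjLists.size_div_le (A : AdjLists G) : ((A.size / n : ℕ) : ℝ) ≤ G.averageDegree := by
  have h : (A.size : ℝ) = ∑ v, (G.degree v : ℝ) := by
    rw [AdjLists.size, Finset.sum_range]
    push_cast
    refine Finset.sum_congr rfl fun v _ => ?_
    have : {u | G.graph.Adj v u} = ((A.nbrs v).toFinset : Set (Fin n)) := by
      ext u
      simp [A.mem_iff]
    rw [WeightedGraph.degree, this, Set.ncard_coe_finset, List.toFinset_card_of_nodup (A.nodup v)]
    simp [AdjLists.deg]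
  rw [WeightedGraph.averageDegree, ← h]
  exact Nat.cast_div_le

theorem size_le_log (hn : 1 ≤ n) : (Nat.size n : ℝ) ≤ 2 * Real.log n + 1 := by
  obtain ⟨m, hm⟩ : ∃ m, Nat.size n = m + 1 := ⟨Nat.size n - 1, by have := size_pos hn; omega⟩
  have h₁ : 2 ^ m ≤ n := Nat.lt_size.1 (by omega)
  have h₂ : (m : ℝ) * Real.log 2 ≤ Real.log n := by
    rw [← Real.log_pow]
    exact Real.log_le_log (by positivity) (by exact_mod_cast h₁)
  have h₃ := Real.log_two_gt_d9
  have h₄ : (m : ℝ) * (1 / 2) ≤ m * Real.log 2 :=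
    mul_le_mul_of_nonneg_left (by linarith) (Nat.cast_nonneg m)
  rw [hm]
  push_cast
  linarith

/-- The constant for delay and space. -/
def bigConst (c : ℕ) : ℕ := 20000 * (c + 10)

theorem maxDelay_le (hn : 1 ≤ n) (A : AdjLists G) :
    (maxDelay c A : ℝ) ≤ bigConst c * (G.averageDegree + Real.log n + 1) := by
  have h₁ := A.size_div_le
  have h₂ := size_le_log hn
  have h₃ : 0 ≤ Real.log n := Real.log_natCast_nonneg n
  have h₄ : (0 : ℝ) ≤ (A.size / n : ℕ) := Nat.cast_nonneg _
  have h₅ : (0 : ℝ) ≤ c := Nat.cast_nonneg c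
  have h₆ : ((c : ℝ) + 2) * Nat.size n ≤ (c + 2) * (2 * Real.log n + 1) :=
    mul_le_mul_of_nonneg_left h₂ (by linarith)
  have h₇ : 0 ≤ (c : ℝ) * Real.log n := mul_nonneg h₅ h₃
  have h₈ : 0 ≤ (c : ℝ) * G.averageDegree := mul_nonneg h₅ (h₄.trans h₁)
  unfold maxDelay bigConst period mainSlack startPeriod topLevel
  push_cast
  nlinarith

theorem stride_le (hn : 1 ≤ n) : 12 * strideOf c n ≤ bigConst c * n := by
  have h : (c + 2) * Nat.size n ≤ (c + 2) * n := Nat.mul_le_mul_left _ (size_le_self n)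
  unfold strideOf topLevel bigConst
  nlinarith [Nat.mul_le_mul_left c hn]

end APSD

theorem mainTheorem7 (c : ℕ) :
    ∃ (P : APSD.Program) (K C : ℕ),
      ∀ (n : ℕ) (_ : 1 ≤ n) (G : APSD.WeightedGraph n)
        (_ : ∀ u v, G.graph.Adj u v → G.weight u v ≤ n ^ c)
        (A : APSD.AdjLists G) (w : ℕ) (_ : K * Nat.size n ≤ w),
        ∃ (tr : List (Option APSD.Output)) (σ : APSD.State),
          APSD.Exec w A P APSD.State.init tr σ ∧
          APSD.EnumeratesAPSD G tr ∧
          APSD.HasDelay tr (C * (G.averageDegree + Real.log n + 1)) ∧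
          (∀ a ∈ σ.usedMem, a < C * n) ∧
          n ≤ C * σ.usedMem.ncard := by
  refine ⟨APSD.apsd c, c + 16, APSD.bigConst c, fun n hn G hG A w hw => ?_⟩
  -- Of the `c + 16` multiples of `Nat.size n`, `c + 2` make room for `infinity`. The other 14
  -- provide the factor `2 ^ 14` that keeps periods and addresses within a word.
  have hw' : 2 ^ 14 * APSD.infinity c n ≤ 2 ^ w := by
    rw [APSD.infinity, ← pow_add]
    refine Nat.pow_le_pow_right (by norm_num) (le_trans ?_ hw)
    have := APSD.size_pos hn
    have h : (c + 16) * Nat.size n = (c + 2) * Nat.size n + 14 * Nat.size n := by ring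
    omega
  obtain ⟨tr, τ, F, h₁, h₂, h₃, h₄, h₅, h₆⟩ := APSD.exec_apsd (A := A) hn hG hw'
  refine ⟨tr, τ, h₁, ⟨?_, ?_⟩, ?_, ?_, ?_⟩
  · rw [h₂]
    exact APSD.nodup_outputs G
  · rw [h₂]
    exact APSD.mem_outputs_iff G
  · intro d hd
    exact le_trans (by exact_mod_cast h₃ d hd) (APSD.maxDelay_le hn A)
  · exact fun a ha => (h₄ a ha).trans_le (APSD.stride_le hn)
  · have hfin : τ.usedMem.Finite := (Set.finite_lt_nat _).subset h₄
    have hsub : (fun t => F.base + t) '' (Finset.range n : Set ℕ) ⊆ τ.usedMem := by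
      rintro _ ⟨t, ht, rfl⟩
      have := h₆ h₅ t (by simpa using ht)
      simp [APSD.State.usedMem, this]
    have hcard := Set.ncard_le_ncard hsub hfin
    rw [Set.ncard_image_of_injective _ (add_right_injective F.base), Set.ncard_coe_finset,
      Finset.card_range] at hcard
    exact hcard.trans (Nat.le_mul_of_pos_left _ (by unfold APSD.bigConst; omega))
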